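/- Let $A$ be a finite alphabet and let $\xi$ be a substitution on $A$, i.e. an endomorphism of the free monoid $A^*$ such that $\xi(a)$ begins with $a$ for some letter $a$ and $|\xi^n(b)|\to\infty$ for every letter $b$. Let $M_\xi$ be its incidence matrix, whose entry $(i,j)$ is the number of occurrences of $i$ in $\xi(j)$. Assume that $\xi$ is primitive (some power of $M_\xi$ has strictly positive entries) and proper (all words $\xi(b)$ start with a common letter, and all end with a common letter). Let $\Omega_\xi\subset A^{\mathbb Z}$ be the set of two-sided sequences all of whose factors occur in words $\xi^n(b)$, $n\ge 0$, $b\in A$; let $S$ be the shift on $\Omega_\xi$, $\mu$ its unique invariant probability measure, and $[a]=\{x\in\Omega_\xi : x_0=a\}$. Let $E^s\subset\mathbb R^A$ be the $M_\xi^t$-invariant subspace of those $v$ that lie in the range of every power of $M_\xi^t$ and satisfy $(M_\xi^t)^k v\to 0$ (the sum of the generalized eigenspaces for the eigenvalues $\lambda$ with $0<|\lambda|<1$), and write $\dim E^s=d-1$. Assume Hypotheses P: i) the characteristic polynomial of $M_\xi$ has a unique root of modulus greater than $1$; ii) there are real numbers $\alpha_1,\dots,\alpha_{d-1}$ such that $1,\alpha_1,\dots,\alpha_{d-1}$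 are linearly independent over $\mathbb Q$ and each $\exp(2i\pi\alpha_j)$ is an eigenvalue of $(\Omega_\xi,\mu,S)$, i.e. $f\circ S=\exp(2i\pi\alpha_j)f$ $\mu$-a.e. for some nonzero $f\in L^2(\mu)$; iii) the Perron number $\beta$ of $\xi$ (the dominant eigenvalue of $M_\xi$) satisfies $\beta\,\bigl|\det\bigl(M_\xi^t|_{E^s}\bigr)\bigr|=1$. For $k\ge 1$ and $x\in\Omega_\xi$ let $r_k(x)=\min\{j\ge 0 : S^jx\in\xi^{k-1}(\Omega_\xi)\}$, and let $s_k(x)\in\mathbb Z^A$ be the vector with coordinates $$s_k(x)_a=\#\{\,r_k(x)\le i<r_{k+1}(x) : S^ix\in\xi^{k-1}([a])\,\},\qquad a\in A.$$ Then there are vectors $v(1),\dots,v(d-1)\in E^s$ such that, for some $m\in\mathbb N$, every vector $(M_\xi^t)^m\bigl(\alpha_i(1,\dots,1)^t-v(i)\bigr)$ has integer entries. For all such vectors, the series $$F(x)=\Bigl(\sum_{k\ge 1}\bigl\langle s_k(x),(M_\xi^t)^k v(i)\bigr\rangle\Bigr)_{1\le i\le d-1}$$ converges uniformly on $\Omega_\xi$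 to a continuous map $F:\Omega_\xi\to\mathbb R^{d-1}$, and $F$ is one-to-one off a $\mu$-null set: there is $\mathcal N\subset\Omega_\xi$ with $\mu(\mathcal N)=0$ such that $x=y$ whenever $x,y\in\Omega_\xi\setminus\mathcal N$ and $F(x)=F(y)$. -/

import Mathlib

open Filter Topology MeasureTheory

namespace SubstShift

variable {A : Type*}

/-- The endomorphism of the free monoid `List A` determined by the images of the letters. -/
def wordMap (ξ : A → List A) (u : List A) : List A := u.flatMap ξ

/-- `ξ` is a substitution: some letter `a` is the first letter of `ξ a`, and
the length of the word `ξⁿ(b)` tends to infinity for every letter `b`. -/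
def IsSubstitution (ξ : A → List A) : Prop :=
  (∃ a, (ξ a).head? = some a) ∧
    ∀ b, Tendsto (fun n : ℕ => ((wordMap ξ)^[n] [b]).length) atTop atTop

/-- `ξ` is proper: all the words `ξ b` start with the same letter, and all of them end with the
same letter. -/
def IsProper (ξ : A → List A) : Prop :=
  (∃ a, ∀ b, (ξ b).head? = some a) ∧ (∃ a, ∀ b, (ξ b).getLast? = some a)

/-- The incidence matrix (with real entries): the entry `(i, j)` is the number of occurrences of
`i` in the word `ξ j`. -/
def incidence [DecidableEq A] (ξ : A → List A) : Matrix A A ℝ :=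
  Matrix.of fun i j => ((ξ j).count i : ℝ)

/-- The language of `ξ`: all words that occur in some `ξⁿ(b)`. -/
def language (ξ : A → List A) : Set (List A) :=
  {u | ∃ (n : ℕ) (b : A), u <:+: (wordMap ξ)^[n] [b]}

/-- The factor `x_i x_{i+1} ⋯ x_{i+l-1}` of a two-sided sequence. -/
def factor (x : ℤ → A) (i : ℤ) (l : ℕ) : List A :=
  (List.range l).map fun j => x (i + j)

/-- The shift on two-sided sequences. -/
def shift (x : ℤ → A) : ℤ → A := fun i => x (i + 1)

/-- The substitutive subshift `Ω_ξ`: the two-sided sequences all of whose factors belong to the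
language of `ξ`. -/
def Omega (ξ : A → List A) : Set (ℤ → A) :=
  {x | ∀ (i : ℤ) (l : ℕ), factor x i l ∈ language ξ}

theorem shift_mem_Omega {ξ : A → List A} {x : ℤ → A} (hx : x ∈ Omega ξ) :
    shift x ∈ Omega ξ := by
  intro i l
  have h : factor (shift x) i l = factor x (i + 1) l := by
    unfold factor shift
    refine List.map_congr_left fun j _ => ?_
    congr 1
    ring
  rw [h]
  exact hx _ _

/-- The shift as a self-map of `Ω_ξ`. -/
def shiftOmega (ξ : A → List A) (x : Omega ξ) : Omega ξ :=
  ⟨shift x.1, shift_mem_Omega x.2⟩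

/-- The map induced by a non-erasing `ξ` on two-sided sequences by concatenation,
`⋯ x₋₁ . x₀ x₁ ⋯ ↦ ⋯ ξ(x₋₁) . ξ(x₀) ξ(x₁) ⋯`.  The letter of index `i ≥ 0` is read in the word
`ξ(x₀ ⋯ x_i)`, counted from its left end; the letter of index `-(j+1) < 0` is read in the word
`ξ(x_{-(j+1)} ⋯ x₋₁)`, counted from its right end.  These words are long enough when `ξ` is
non-erasing, so the default letter passed to `getD` is not used then. -/
def seqMap (ξ : A → List A) (x : ℤ → A) : ℤ → A
  | Int.ofNat i => (wordMap ξ (factor x 0 (i + 1))).getD i (x 0)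
  | Int.negSucc j => (wordMap ξ (factor x (Int.negSucc j) (j + 1))).reverse.getD j (x 0)

/-- The cylinder `[a] = {x ∈ Ω_ξ ; x₀ = a}`. -/
def cyl (ξ : A → List A) (a : A) : Set (ℤ → A) := {x | x ∈ Omega ξ ∧ x 0 = a}

/-- The entrance time `r_n(x) = min {k ≥ 0 ; S^k x ∈ ξ^{n-1}(Ω_ξ)}`, for `n ≥ 1`. -/
noncomputable def entranceTime (ξ : A → List A) (n : ℕ) (x : ℤ → A) : ℕ :=
  sInf {k : ℕ | shift^[k] x ∈ (seqMap ξ)^[n - 1] '' Omega ξ}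

/-- The vector `s_k(x)`, for `k ≥ 1`: its coordinate of index `a` is the number of times
`r_k(x) ≤ i < r_{k+1}(x)` for which `S^i x ∈ ξ^{k-1}([a])`. -/
noncomputable def visitCount (ξ : A → List A) (k : ℕ) (x : ℤ → A) (a : A) : ℕ :=
  Set.ncard {i : ℕ | entranceTime ξ k x ≤ i ∧ i < entranceTime ξ (k + 1) x ∧
    shift^[i] x ∈ (seqMap ξ)^[k - 1] '' cyl ξ a}

section Linear

variable [Fintype A] [DecidableEq A]

/-- `M_ξᵗ` as an endomorphism of `ℝ^A`. -/
def transposeMap (ξ : A → List A) : (A → ℝ) →ₗ[ℝ] (A → ℝ) := (incidence ξ).transpose.mulVecLin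

/-- The vectors `v` with `(M_ξᵗ)^k v → 0`. -/
def contracted (ξ : A → List A) : Submodule ℝ (A → ℝ) where
  carrier := {v | Tendsto (fun k : ℕ => (transposeMap ξ ^ k) v) atTop (𝓝 0)}
  add_mem' {u v} hu hv := by
    simp only [Set.mem_ofPred_eq, map_add] at *
    simpa using hu.add hv
  zero_mem' := by simp
  smul_mem' c v hv := by
    simp only [Set.mem_ofPred_eq, map_smul] at *
    simpa using hv.const_smul c

/-- The space `E^s`, that is the sum of the generalized eigenspaces of `M_ξᵗ` for the eigenvalues
`λ` with `0 < |λ| < 1` (real and imaginary parts being taken).  It is described as the set of the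
vectors that are contracted to `0` and lie in the range of every power of `M_ξᵗ`. The second
condition removes the generalized kernel, on the complement of which `M_ξᵗ` is invertible. -/
def stableSpace (ξ : A → List A) : Submodule ℝ (A → ℝ) :=
  contracted ξ ⊓ ⨅ n : ℕ, LinearMap.range (transposeMap ξ ^ n)

theorem transposeMap_mem_stableSpace (ξ : A → List A) :
    ∀ v ∈ stableSpace ξ, transposeMap ξ v ∈ stableSpace ξ := by
  rintro v ⟨h1, h2⟩
  refine ⟨?_, ?_⟩
  · have h : Tendsto (fun k : ℕ => (transposeMap ξ ^ (k + 1)) v) atTop (𝓝 0) :=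
      (tendsto_add_atTop_iff_nat 1).2 h1
    refine h.congr fun k => ?_
    rw [pow_succ]
    rfl
  · simp only [SetLike.mem_coe, Submodule.mem_iInf, LinearMap.mem_range] at h2 ⊢
    intro n
    obtain ⟨u, rfl⟩ := h2 n
    refine ⟨transposeMap ξ u, ?_⟩
    rw [← Module.End.mul_apply, ← Module.End.mul_apply, ← pow_succ, ← pow_succ']

/-- The determinant of the restriction of `M_ξᵗ` to `E^s`. -/
noncomputable def stableDet (ξ : A → List A) : ℝ :=
  LinearMap.det ((transposeMap ξ).restrict (transposeMap_mem_stableSpace ξ))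

/-- `z` is a root of the characteristic polynomial of `M_ξ`. -/
def IsCharRoot (ξ : A → List A) (z : ℂ) : Prop :=
  ((incidence ξ).charpoly.map (algebraMap ℝ ℂ)).IsRoot z

/-- `β` is the Perron number of `ξ`: the dominant root of the characteristic polynomial. -/
def IsPerronNumber (ξ : A → List A) (β : ℝ) : Prop :=
  IsCharRoot ξ β ∧ ∀ z : ℂ, IsCharRoot ξ z → z ≠ β → ‖z‖ < β

/-- `v(1), …, v(n)` are vectors of `E^s` for which, with `w(i) = α_i (1, …, 1)ᵗ - v(i)`,
the vector `(M_ξᵗ)^m w(i)` is integral for some `m`. -/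
def IsSplitting (ξ : A → List A) {n : ℕ} (α : Fin n → ℝ) (v : Fin n → A → ℝ) : Prop :=
  ∀ i, v i ∈ stableSpace ξ ∧ ∃ w : A → ℝ, (∀ a, α i = v i a + w a) ∧
    ∃ m : ℕ, ∀ a, ∃ z : ℤ, (transposeMap ξ ^ m) w a = z

/-- The term `⟨s_k(x), (M_ξᵗ)^k v⟩`. -/
noncomputable def mapTerm (ξ : A → List A) (v : A → ℝ) (k : ℕ) (x : ℤ → A) : ℝ :=
  ∑ a, (visitCount ξ k x a : ℝ) * (transposeMap ξ ^ k) v a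

/-- `F_N(x) = (∑_{1 ≤ k < N} ⟨s_k(x), (M_ξᵗ)^k v(i)⟩)_i`. -/
noncomputable def mapPartial (ξ : A → List A) {n : ℕ} (v : Fin n → A → ℝ) (N : ℕ)
    (x : Omega ξ) : Fin n → ℝ :=
  fun i => ∑ k ∈ Finset.Ico 1 N, mapTerm ξ (v i) k x

/-- `F(x) = (∑_{k ≥ 1} ⟨s_k(x), (M_ξᵗ)^k v(i)⟩)_i`. -/
noncomputable def mapF (ξ : A → List A) {n : ℕ} (v : Fin n → A → ℝ)
    (x : Omega ξ) : Fin n → ℝ :=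
  fun i => ∑' k : ℕ, mapTerm ξ (v i) (k + 1) x

end Linear

/-- `c` is an eigenvalue of the measurable dynamical system `(X, μ, T)`: there is a non-zero
`f ∈ L²(μ)` with `f ∘ T = c f`. -/
def IsSystemEigenvalue {X : Type*} [MeasurableSpace X] (μ : Measure X) (T : X → X) (c : ℂ) :
    Prop :=
  ∃ f : X → ℂ, MemLp f 2 μ ∧ ¬ (f =ᵐ[μ] 0) ∧ ∀ᵐ x ∂μ, f (T x) = c * f x

end SubstShift

/-! Write `M` for the transpose of the incidence matrix and `S` for the shift. On `E^s` the powers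
of `M` decay exponentially, so the sums of a vector `v` of `E^s` along the words of the language are
bounded. Since the subshift is minimal, the function `x ↦ v (x 0)` is then a continuous coboundary,
as in the Gottschalk-Hedlund theorem, and the solutions can be normalized so that `F v (S x) = F v x
- v (x 0)` and `F v (ξ x) = F (M v) x` (`exists_isTransfer`). If the visits counted by `s_k` are
exactly the cuts of one decomposition into words `ξ^(k-1)(b)`, the series telescopes to `F (M
v(i))`. The limit map is thus `H` applied to `vecF`, the vector of the `F (v(i))`, where `H` is the
invertible matrix of `M` on `E^s`.

Injectivity rests on two facts. The law of `vecF` is absolutely continuous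
(`IsTransfer.measure_vecF_preimage_eq_zero`): integrality makes `H^m vecF` equivariant, modulo
integers and up to a time change by the lengths of the `ξ^m(b)`, towards the rotation by `α`, and a
rotation invariant measure on the torus is a multiple of Lebesgue measure. Moreover the tiles, the
images of the cylinders, are subdivided into affine copies of each other. The condition `β |det H| =
1` and Perron-Frobenius theory turn the resulting volume inequality into an equality, so the pieces
are disjoint in measure. Properness carries this over to distinct tiles, by the common first letter,
and to tiles translated one step back, by the common last letter. Almost surely, then, `vecF x`
determines `x 0` and `x (-1)`, hence all of `x`.

The telescoping needs recognizability, which comes from the same facts: the points with two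
different positions in words `ξ^m(b)` are mapped into a null set, so they do not fill the subshift,
and any two decompositions of a point share a cut (`IsTiling.exists_common_cut`). Passing to
elementary morphisms, for which a decomposition is determined by one cut, gives the recognizability
of a power of `ξ`, and then of all powers.

The vectors `v(i)` exist because an eigenvalue `c` satisfies `c ^ |ξⁿ(b)| → 1`
(`IsSystemEigenvalue.tendsto_pow_length`): the vectors of distances of `α |ξⁿ(b)|` to the nearest
integers tend to `0`, so `M` eventually sends each of them exactly to the next. -/

namespace SubstShift

/-! ### Concatenations of blocks and their cutting points -/

section Concat

variable {A B C : Type*}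

/-- Translation of two-sided sequences by an integer. -/
def shiftZ (j : ℤ) (x : ℤ → A) : ℤ → A := fun i => x (i + j)

@[simp] theorem shiftZ_apply (j : ℤ) (x : ℤ → A) (i : ℤ) : shiftZ j x i = x (i + j) := rfl

@[simp] theorem shiftZ_zero (x : ℤ → A) : shiftZ 0 x = x := by funext i; simp

theorem shiftZ_shiftZ (i j : ℤ) (x : ℤ → A) : shiftZ i (shiftZ j x) = shiftZ (i + j) x := by
  funext k; simp [add_assoc]

theorem shift_eq_shiftZ : (shift : (ℤ → A) → ℤ → A) = shiftZ 1 := rfl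

theorem shift_iterate (n : ℕ) (x : ℤ → A) : shift^[n] x = shiftZ n x := by
  induction n with
  | zero => simp
  | succ n ih =>
    rw [Function.iterate_succ_apply', ih, shift_eq_shiftZ, shiftZ_shiftZ]
    congr 1; push_cast; ring

theorem factor_eq_map (x : ℤ → A) (i : ℤ) (l : ℕ) :
    factor x i l = (List.range l).map fun j : ℕ => x (i + j) := by
  unfold factor
  simp only [List.bind_eq_flatMap, List.pure_def, List.map_flatMap, List.map_cons, List.map_nil]
  exact List.map_eq_flatMap.symm

@[simp] theorem length_factor (x : ℤ → A) (i : ℤ) (l : ℕ) : (factor x i l).length = l := by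
  simp [factor_eq_map]

@[simp] theorem factor_zero (x : ℤ → A) (i : ℤ) : factor x i 0 = [] := rfl

theorem getElem_factor (x : ℤ → A) (i : ℤ) (l j : ℕ) (h : j < (factor x i l).length) :
    (factor x i l)[j] = x (i + j) := by
  simp [factor_eq_map]

theorem getElem?_factor (x : ℤ → A) (i : ℤ) (l j : ℕ) (h : j < l) :
    (factor x i l)[j]? = some (x (i + j)) := by
  simp [factor_eq_map, h]

theorem factor_succ (x : ℤ → A) (i : ℤ) (l : ℕ) :
    factor x i (l + 1) = factor x i l ++ [x (i + l)] := by
  simp [factor_eq_map, List.range_succ]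

theorem factor_add (x : ℤ → A) (i : ℤ) (l m : ℕ) :
    factor x i (l + m) = factor x i l ++ factor x (i + l) m := by
  induction m with
  | zero => simp
  | succ m ih =>
    rw [← add_assoc, factor_succ, ih, factor_succ, List.append_assoc]
    congr 4; push_cast; ring

theorem factor_eq_iff {x y : ℤ → A} {i j : ℤ} {l : ℕ} :
    factor x i l = factor y j l ↔ ∀ k : ℕ, k < l → x (i + k) = y (j + k) := by
  simp [factor_eq_map]

theorem factor_shiftZ (x : ℤ → A) (j i : ℤ) (l : ℕ) :
    factor (shiftZ j x) i l = factor x (i + j) l := by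
  rw [factor_eq_iff]
  intro k _
  simp only [shiftZ_apply]; congr 1; ring

/-- The position of the left end of the block `σ (y n)` in the concatenation of the blocks
`σ (y i)`, the block of index `0` being put at the origin. -/
def cut (σ : C → List B) (y : ℤ → C) : ℤ → ℤ
  | Int.ofNat n => ((factor y 0 n).flatMap σ).length
  | Int.negSucc n => -((factor y (Int.negSucc n) (n + 1)).flatMap σ).length

@[simp] theorem cut_zero (σ : C → List B) (y : ℤ → C) : cut σ y 0 = 0 := rfl

theorem cut_natCast (σ : C → List B) (y : ℤ → C) (n : ℕ) :
    cut σ y n = ((factor y 0 n).flatMap σ).length := rfl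

theorem cut_add_one (σ : C → List B) (y : ℤ → C) (i : ℤ) :
    cut σ y (i + 1) = cut σ y i + (σ (y i)).length := by
  rcases i with n | n
  · change cut σ y ((n : ℤ) + 1) = cut σ y (n : ℤ) + (σ (y n)).length
    have : ((n : ℤ) + 1) = ((n + 1 : ℕ) : ℤ) := by push_cast; ring
    rw [this, cut_natCast, cut_natCast, factor_succ]
    simp
  · rcases n with _ | n
    · change cut σ y 0 = -((factor y (-1) 1).flatMap σ).length + ((σ (y (-1))).length : ℤ)
      simp [factor_eq_map]
    · have h1 : (Int.negSucc (n + 1) + 1 : ℤ) = Int.negSucc n := by omega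
      rw [h1]
      change -(((factor y (Int.negSucc n) (n + 1)).flatMap σ).length : ℤ)
        = -(((factor y (Int.negSucc (n + 1)) (n + 1 + 1)).flatMap σ).length : ℤ)
          + ((σ (y (Int.negSucc (n + 1)))).length : ℤ)
      have h2 : factor y (Int.negSucc (n + 1)) (n + 1 + 1)
          = y (Int.negSucc (n + 1)) :: factor y (Int.negSucc n) (n + 1) := by
        rw [add_comm (n + 1) 1, factor_add]
        have : (Int.negSucc (n + 1) + (1 : ℕ) : ℤ) = Int.negSucc n := by omega
        rw [this]; simp [factor_eq_map]
      rw [h2]; simp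

/-- `cut` is characterised by its value at `0` and its increments. -/
theorem cut_unique {σ : C → List B} {y : ℤ → C} {c : ℤ → ℤ}
    (h : ∀ i, c (i + 1) = c i + (σ (y i)).length) (i : ℤ) : c i = c 0 + cut σ y i := by
  induction i using Int.induction_on with
  | zero => simp
  | succ i ih => rw [h, ih, cut_add_one]; ring
  | pred i ih =>
    have h1 := h (-(i : ℤ) - 1)
    have h2 := cut_add_one σ y (-(i : ℤ) - 1)
    rw [sub_add_cancel] at h1 h2
    linarith

theorem cut_shiftZ (σ : C → List B) (y : ℤ → C) (j i : ℤ) :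
    cut σ (shiftZ j y) i = cut σ y (i + j) - cut σ y j := by
  have := cut_unique (σ := σ) (y := shiftZ j y) (c := fun i => cut σ y (i + j)) (fun i => by
    have := cut_add_one σ y (i + j)
    simp only [shiftZ_apply]
    rw [← this]; congr 1; ring) i
  simp only [zero_add] at this
  linarith

theorem cut_add_natCast (σ : C → List B) (y : ℤ → C) (i : ℤ) (l : ℕ) :
    cut σ y (i + l) = cut σ y i + ((factor y i l).flatMap σ).length := by
  have h := cut_shiftZ σ y i l
  rw [cut_natCast, factor_shiftZ, zero_add] at h
  rw [add_comm i]; linarith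

variable {σ : C → List B}

theorem cut_strictMono (hσ : ∀ c, σ c ≠ []) (y : ℤ → C) : StrictMono (cut σ y) := by
  refine strictMono_int_of_lt_succ fun n => ?_
  rw [cut_add_one]
  have := List.length_pos_iff.2 (hσ (y n))
  omega

theorem le_cut_natCast (hσ : ∀ c, σ c ≠ []) (y : ℤ → C) (n : ℕ) : (n : ℤ) ≤ cut σ y n := by
  induction n with
  | zero => simp
  | succ n ih =>
    have := cut_strictMono hσ y (lt_add_one (n : ℤ))
    push_cast; omega

theorem cut_neg_natCast_le (hσ : ∀ c, σ c ≠ []) (y : ℤ → C) (n : ℕ) : cut σ y (-n) ≤ -n := by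
  induction n with
  | zero => simp
  | succ n ih =>
    have := cut_strictMono hσ y (sub_one_lt (-(n : ℤ)))
    rw [show (-((n + 1 : ℕ) : ℤ)) = -(n : ℤ) - 1 by push_cast; ring]
    omega

/-- Every position belongs to a block. -/
theorem exists_cut_le_lt (hσ : ∀ c, σ c ≠ []) (y : ℤ → C) (p : ℤ) :
    ∃ i, cut σ y i ≤ p ∧ p < cut σ y (i + 1) := by
  obtain ⟨i, hi, hmax⟩ := Int.exists_greatest_of_bdd (P := fun i => cut σ y i ≤ p)
    ⟨p.natAbs, fun z hz => by
      by_contra hlt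
      have h1 := cut_strictMono hσ y (not_le.1 hlt)
      have h2 := le_cut_natCast hσ y p.natAbs
      omega⟩
    ⟨-p.natAbs, by have := cut_neg_natCast_le hσ y p.natAbs; omega⟩
  refine ⟨i, hi, ?_⟩
  by_contra h
  have := hmax (i + 1) (not_lt.1 h)
  omega

theorem cut_le_lt_unique (hσ : ∀ c, σ c ≠ []) {y : ℤ → C} {p i j : ℤ}
    (hi : cut σ y i ≤ p ∧ p < cut σ y (i + 1)) (hj : cut σ y j ≤ p ∧ p < cut σ y (j + 1)) :
    i = j := by
  have h1 : i < j + 1 := (cut_strictMono hσ y).lt_iff_lt.1 (hi.1.trans_lt hj.2)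
  have h2 : j < i + 1 := (cut_strictMono hσ y).lt_iff_lt.1 (hj.1.trans_lt hi.2)
  omega

/-- The two-sided sequence `z` is the concatenation of the words `σ (y i)`, the word `σ (y 0)`
starting at the origin. -/
def IsConcat (σ : C → List B) (y : ℤ → C) (z : ℤ → B) : Prop :=
  ∀ i, factor z (cut σ y i) (σ (y i)).length = σ (y i)

theorem IsConcat.factor_eq {y : ℤ → C} {z : ℤ → B} (h : IsConcat σ y z) (i : ℤ) (l : ℕ) :
    factor z (cut σ y i) ((factor y i l).flatMap σ).length = (factor y i l).flatMap σ := by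
  induction l with
  | zero => simp
  | succ l ih =>
    rw [factor_succ, List.flatMap_append, List.length_append, factor_add, ih, ← cut_add_natCast]
    simp [h (i + l)]

theorem IsConcat.apply_eq {y : ℤ → C} {z : ℤ → B} (h : IsConcat σ y z) {i p : ℤ}
    (h1 : cut σ y i ≤ p) (h2 : p < cut σ y (i + 1)) :
    (σ (y i))[(p - cut σ y i).toNat]? = some (z p) := by
  rw [cut_add_one] at h2
  conv_lhs => rw [← h i]
  rw [getElem?_factor _ _ _ _ (by omega)]
  congr 2
  omega

theorem IsConcat.unique (hσ : ∀ c, σ c ≠ []) {y : ℤ → C} {z z' : ℤ → B} (h : IsConcat σ y z)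
    (h' : IsConcat σ y z') : z = z' := by
  funext p
  obtain ⟨i, h1, h2⟩ := exists_cut_le_lt hσ y p
  have e := h.apply_eq h1 h2
  rw [h'.apply_eq h1 h2] at e
  exact (Option.some.inj e).symm

theorem exists_isConcat (hσ : ∀ c, σ c ≠ []) (y : ℤ → C) : ∃ z, IsConcat σ y z := by
  have key : ∀ p : ℤ, ∃ b : B, ∀ i, cut σ y i ≤ p → p < cut σ y (i + 1) →
      (σ (y i))[(p - cut σ y i).toNat]? = some b := by
    intro p
    obtain ⟨i, h1, h2⟩ := exists_cut_le_lt hσ y p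
    have h3 := h2
    rw [cut_add_one] at h3
    have hlt : (p - cut σ y i).toNat < (σ (y i)).length := by omega
    refine ⟨(σ (y i))[(p - cut σ y i).toNat], fun j hj1 hj2 => ?_⟩
    obtain rfl := cut_le_lt_unique hσ ⟨h1, h2⟩ ⟨hj1, hj2⟩
    exact List.getElem?_eq_getElem hlt
  choose z hz using key
  refine ⟨z, fun i => ?_⟩
  apply List.ext_getElem
  · simp
  · intro k hk1 hk2
    rw [getElem_factor]
    have := hz (cut σ y i + k) i (by omega) (by rw [cut_add_one]; omega)
    have e : (cut σ y i + (k : ℤ) - cut σ y i).toNat = k := by omega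
    rw [e, List.getElem?_eq_getElem hk2] at this
    exact (Option.some.inj this).symm

theorem IsConcat.shiftZ {y : ℤ → C} {z : ℤ → B} (h : IsConcat σ y z) (j : ℤ) :
    IsConcat σ (shiftZ j y) (shiftZ (cut σ y j) z) := by
  intro i
  rw [factor_shiftZ, cut_shiftZ, sub_add_cancel]
  exact h (i + j)

theorem cut_comp {β : A → List C} {y : ℤ → A} {u : ℤ → C}
    (h : IsConcat β y u) (i : ℤ) :
    cut (fun a => (β a).flatMap σ) y i = cut σ u (cut β y i) := by
  have := cut_unique (σ := fun a => (β a).flatMap σ) (y := y)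
    (c := fun i => cut σ u (cut β y i)) (fun i => by
      rw [cut_add_one, cut_add_natCast, h i]) i
  simpa using this.symm

theorem IsConcat.comp {β : A → List C} {y : ℤ → A} {u : ℤ → C} {z : ℤ → B}
    (h : IsConcat β y u) (h' : IsConcat σ u z) :
    IsConcat (fun a => (β a).flatMap σ) y z := by
  intro i
  rw [cut_comp h]
  have := h'.factor_eq (cut β y i) (β (y i)).length
  rwa [h i] at this

theorem IsConcat.factor_zero {y : ℤ → C} {z : ℤ → B} (h : IsConcat σ y z) (n : ℕ) :
    factor z 0 ((factor y 0 n).flatMap σ).length = (factor y 0 n).flatMap σ :=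
  h.factor_eq 0 n

end Concat

/-! ### The substitution on two-sided sequences and its iterates -/

section SeqMap

variable {A : Type*} {ξ : A → List A}

/-- On each side of the origin the concatenation has at least as many letters as blocks, so the
index read by `getD` is always in range and the default letter plays no role. -/
theorem isConcat_seqMap (hξ : ∀ a, ξ a ≠ []) (y : ℤ → A) : IsConcat ξ y (seqMap ξ y) := by
  obtain ⟨z, hz⟩ := exists_isConcat hξ y
  suffices h : seqMap ξ y = z by rwa [h]
  funext p
  rcases p with i | j
  · change (((factor y 0 (i + 1)).flatMap ξ)).getD i (y 0) = z i
    have h1 := hz.factor_eq 0 (i + 1)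
    have h2 := le_cut_natCast hξ y (i + 1)
    rw [cut_natCast] at h2
    rw [List.getD_eq_getElem?_getD, ← h1, getElem?_factor _ _ _ _ (by omega)]
    simp
  · change (((factor y (Int.negSucc j) (j + 1)).flatMap ξ)).reverse.getD j (y 0)
      = z (Int.negSucc j)
    have h1 := hz.factor_eq (Int.negSucc j) (j + 1)
    have h2 := cut_neg_natCast_le hξ y (j + 1)
    have h3 : cut ξ y (Int.negSucc j)
      = -((factor y (Int.negSucc j) (j + 1)).flatMap ξ).length := rfl
    rw [show (-((j + 1 : ℕ) : ℤ)) = Int.negSucc j by omega, h3] at h2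
    rw [List.getD_eq_getElem?_getD, List.getElem?_reverse (by omega), ← h1, length_factor,
      getElem?_factor _ _ _ _ (by omega), h3, Option.getD_some]
    congr 1
    omega

theorem wordMap_iterate_append (n : ℕ) (u v : List A) :
    (wordMap ξ)^[n] (u ++ v) = (wordMap ξ)^[n] u ++ (wordMap ξ)^[n] v := by
  induction n generalizing u v with
  | zero => rfl
  | succ n ih => simp [Function.iterate_succ_apply, wordMap, ← ih]

/-- The words `ξⁿ(a)`. -/
def iter (ξ : A → List A) (n : ℕ) (a : A) : List A := (wordMap ξ)^[n] [a]

theorem flatMap_iter (n : ℕ) (u : List A) : u.flatMap (iter ξ n) = (wordMap ξ)^[n] u := by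
  induction u with
  | nil =>
    induction n with
    | zero => rfl
    | succ n ih => simpa [Function.iterate_succ_apply, wordMap] using ih
  | cons a u ih =>
    rw [List.flatMap_cons, ih, iter, ← wordMap_iterate_append]
    rfl

@[simp] theorem iter_zero (a : A) : iter ξ 0 a = [a] := rfl

@[simp] theorem iter_one : iter ξ 1 = ξ := by funext a; simp [iter, wordMap]

theorem iter_add (m n : ℕ) (a : A) : iter ξ (m + n) a = (iter ξ n a).flatMap (iter ξ m) := by
  rw [flatMap_iter, iter, Function.iterate_add_apply]; rfl

theorem iter_add_flatMap (m n : ℕ) (u : List A) :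
    u.flatMap (iter ξ (m + n)) = (u.flatMap (iter ξ n)).flatMap (iter ξ m) := by
  simp only [flatMap_iter, Function.iterate_add_apply]

theorem iter_ne_nil (hξ : ∀ a, ξ a ≠ []) (n : ℕ) (a : A) : iter ξ n a ≠ [] := by
  induction n generalizing a with
  | zero => simp
  | succ n ih =>
    rw [iter_add, iter_one]
    obtain ⟨b, l, h⟩ := List.exists_cons_of_ne_nil (hξ a)
    simp [h, ih b]

theorem isConcat_seqMap_iterate (hξ : ∀ a, ξ a ≠ []) (n : ℕ) (y : ℤ → A) :
    IsConcat (iter ξ n) y ((seqMap ξ)^[n] y) := by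
  induction n with
  | zero =>
    intro i
    have := cut_unique (σ := iter ξ 0) (y := y) (c := id) (fun i => by simp) i
    simp only [id, zero_add] at this
    simp [← this, factor_eq_map]
  | succ n ih =>
    rw [Function.iterate_succ_apply']
    have := ih.comp (isConcat_seqMap hξ _)
    have e : (fun a => (iter ξ n a).flatMap ξ) = iter ξ (n + 1) := by
      funext a; rw [add_comm, iter_add, iter_one]
    rwa [e] at this

theorem seqMap_iterate_shiftZ (hξ : ∀ a, ξ a ≠ []) (n : ℕ) (y : ℤ → A) (j : ℤ) :
    (seqMap ξ)^[n] (shiftZ j y) = shiftZ (cut (iter ξ n) y j) ((seqMap ξ)^[n] y) :=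
  (isConcat_seqMap_iterate hξ n _).unique (iter_ne_nil hξ n)
    ((isConcat_seqMap_iterate hξ n y).shiftZ j)

end SeqMap

/-! ### Factors of sequences and of concatenations -/

section Words

variable {A B C : Type*}

theorem factor_congr {x y : ℤ → A} {i : ℤ} {l : ℕ} (h : ∀ j : ℕ, j < l → x (i + j) = y (i + j)) :
    factor x i l = factor y i l := factor_eq_iff.2 h

theorem factor_infix_factor (x : ℤ → A) {i j : ℤ} {l m : ℕ} (h1 : j ≤ i) (h2 : i + l ≤ j + m) :
    factor x i l <:+: factor x j m := by
  obtain ⟨k, rfl⟩ : ∃ k : ℕ, i = j + k := ⟨(i - j).toNat, by omega⟩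
  obtain ⟨r, rfl⟩ : ∃ r : ℕ, m = k + l + r := ⟨m - k - l, by omega⟩
  exact ⟨factor x j k, factor x (j + (k + l : ℕ)) r, by rw [factor_add, factor_add]⟩

theorem infix_factor_iff {x : ℤ → A} {i : ℤ} {l : ℕ} {u : List A} :
    u <:+: factor x i l ↔ ∃ k : ℕ, k + u.length ≤ l ∧ factor x (i + k) u.length = u := by
  constructor
  · rintro ⟨s, t, h⟩
    have hl := congrArg List.length h
    simp only [List.length_append, length_factor] at hl
    refine ⟨s.length, by omega, ?_⟩
    rw [← hl, factor_add, factor_add] at h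
    have h1 := List.append_inj_left h (by simp)
    exact (List.append_inj_right h1 (by simp)).symm
  · rintro ⟨k, hk, h⟩
    have := factor_infix_factor x (i := i + k) (j := i) (l := u.length) (m := l) (by omega)
      (by omega)
    rwa [h] at this

theorem exists_eq_of_prefix_flatMap {σ : C → List B} {m : ℕ} (hm : ∀ c, (σ c).length ≤ m)
    {w : List C} {u : List B} (h : u <+: w.flatMap σ) :
    ∃ w' p, u = w'.flatMap σ ++ p ∧ w' <+: w ∧ p.length ≤ m := by
  induction w generalizing u with
  | nil => exact ⟨[], [], by simpa using h, List.prefix_rfl, by simp⟩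
  | cons a w ih =>
    rw [List.flatMap_cons] at h
    rcases List.prefix_or_prefix_of_prefix h (List.prefix_append (σ a) _) with h1 | ⟨v, rfl⟩
    · exact ⟨[], u, by simp, List.nil_prefix, h1.length_le.trans (hm a)⟩
    · rw [List.prefix_append_right_inj] at h
      obtain ⟨w', p, rfl, h2, h3⟩ := ih h
      exact ⟨a :: w', p, by simp, by simpa using h2, h3⟩

/-- A factor of a concatenation of blocks is a concatenation of consecutive blocks, up to two
words not longer than the blocks. -/
theorem exists_eq_of_infix_flatMap {σ : C → List B} {m : ℕ} (hm : ∀ c, (σ c).length ≤ m)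
    {w : List C} {u : List B} (h : u <:+: w.flatMap σ) :
    ∃ s w' p, u = s ++ w'.flatMap σ ++ p ∧ w' <:+: w ∧ s.length ≤ m ∧ p.length ≤ m := by
  induction w with
  | nil => exact ⟨[], [], [], by simpa using h, List.infix_rfl, by simp, by simp⟩
  | cons a w ih =>
    rw [List.flatMap_cons, List.infix_append_iff] at h
    rcases h with h | h | ⟨t, v, rfl, h1, h2⟩
    · exact ⟨u, [], [], by simp, List.nil_infix, h.length_le.trans (hm a), by simp⟩
    · obtain ⟨s, w', p, h1, h2, h3⟩ := ih h
      exact ⟨s, w', p, h1, List.infix_cons h2, h3⟩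
    · obtain ⟨w', p, rfl, h3, h4⟩ := exists_eq_of_prefix_flatMap hm h2
      exact ⟨t, w', p, by simp, List.infix_cons h3.isInfix, h1.length_le.trans (hm a), h4⟩

theorem flatMap_infix {σ : C → List B} {u w : List C} (h : u <:+: w) :
    u.flatMap σ <:+: w.flatMap σ := by
  obtain ⟨s, t, rfl⟩ := h
  exact ⟨s.flatMap σ, t.flatMap σ, by simp⟩

theorem exists_length_le {A B : Type*} [Fintype A] (σ : A → List B) : ∃ m, ∀ a, (σ a).length ≤ m :=
  ⟨Finset.univ.sup fun a => (σ a).length,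
    fun a => Finset.le_sup (f := fun a => (σ a).length) (Finset.mem_univ a)⟩

end Words

/-! ### The language of a primitive substitution and minimality -/

section Language

variable {A : Type*} {ξ : A → List A}

theorem IsProper.ne_nil (h : IsProper ξ) (a : A) : ξ a ≠ [] := by
  obtain ⟨⟨l, hl⟩, _⟩ := h
  intro h0
  simpa [h0] using hl a

theorem language_of_infix {u w : List A} (h : u <:+: w) (hw : w ∈ language ξ) :
    u ∈ language ξ := by
  obtain ⟨n, b, hb⟩ := hw
  exact ⟨n, b, h.trans hb⟩

theorem flatMap_iter_mem_language {u : List A} (hu : u ∈ language ξ) (n : ℕ) :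
    u.flatMap (iter ξ n) ∈ language ξ := by
  obtain ⟨k, b, hb⟩ := hu
  refine ⟨n + k, b, ?_⟩
  change _ <:+: iter ξ (n + k) b
  rw [iter_add]
  exact flatMap_infix hb

theorem singleton_mem_language (a : A) : [a] ∈ language ξ := ⟨0, a, List.infix_rfl⟩

theorem shiftZ_mem_Omega {x : ℤ → A} (hx : x ∈ Omega ξ) (j : ℤ) : shiftZ j x ∈ Omega ξ := by
  intro i l
  rw [factor_shiftZ]
  exact hx _ _

theorem mem_Omega_of_isConcat {n : ℕ} (hξ : ∀ a, ξ a ≠ []) {y z : ℤ → A} (hy : y ∈ Omega ξ)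
    (h : IsConcat (iter ξ n) y z) : z ∈ Omega ξ := by
  intro i l
  have hσ := iter_ne_nil hξ n
  obtain ⟨a, ha, -⟩ := exists_cut_le_lt hσ y i
  obtain ⟨b, -, hb⟩ := exists_cut_le_lt hσ y (i + l)
  have hab : a < b + 1 := (cut_strictMono hσ y).lt_iff_lt.1 (by omega)
  obtain ⟨m, hm⟩ : ∃ m : ℕ, b + 1 = a + m := ⟨(b + 1 - a).toNat, by omega⟩
  rw [hm, cut_add_natCast] at hb
  refine language_of_infix (factor_infix_factor z ha hb.le) ?_
  rw [h.factor_eq]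
  exact flatMap_iter_mem_language (hy _ _) n

theorem seqMap_iterate_mem_Omega (hξ : ∀ a, ξ a ≠ []) (n : ℕ) {y : ℤ → A} (hy : y ∈ Omega ξ) :
    (seqMap ξ)^[n] y ∈ Omega ξ :=
  mem_Omega_of_isConcat hξ hy (isConcat_seqMap_iterate hξ n y)

section Primitive

variable [Fintype A] [DecidableEq A]

theorem count_flatMap_eq_sum (σ : A → List A) (u : List A) (i : A) :
    (u.flatMap σ).count i = ∑ j, (σ j).count i * u.count j := by
  induction u with
  | nil => simp
  | cons a u ih =>
    simp [List.count_append, ih, List.count_cons, mul_add, Finset.sum_add_distrib, add_comm]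

theorem incidence_pow_apply (n : ℕ) (i j : A) :
    (incidence ξ ^ n) i j = ((iter ξ n j).count i : ℝ) := by
  induction n generalizing i j with
  | zero =>
    rw [pow_zero, Matrix.one_apply, iter_zero, List.count_singleton]
    by_cases h : i = j
    · simp [h]
    · simp [h, Ne.symm h]
  | succ n ih =>
    rw [pow_succ', Matrix.mul_apply, add_comm, iter_add, iter_one, count_flatMap_eq_sum]
    push_cast
    exact Finset.sum_congr rfl fun k _ => by rw [ih]; rfl

theorem exists_forall_mem_iter (hprim : (incidence ξ).IsPrimitive) :
    ∃ k, ∀ i j, i ∈ iter ξ k j := by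
  obtain ⟨k, -, hk⟩ := hprim.exists_pos_pow
  refine ⟨k, fun i j => ?_⟩
  have := hk i j
  rw [incidence_pow_apply] at this
  exact List.count_pos_iff.1 (by exact_mod_cast this)

theorem exists_forall_infix_iter (hprim : (incidence ξ).IsPrimitive) {u : List A}
    (hu : u ∈ language ξ) : ∃ N, ∀ c, u <:+: iter ξ N c := by
  obtain ⟨n, b, hb⟩ := hu
  obtain ⟨k, hk⟩ := exists_forall_mem_iter hprim
  refine ⟨n + k, fun c => ?_⟩
  rw [iter_add]
  obtain ⟨s, t, hst⟩ := List.append_of_mem (hk b c)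
  refine hb.trans ?_
  rw [hst]
  exact ⟨s.flatMap (iter ξ n), t.flatMap (iter ξ n), by simp [iter]⟩

/-- Every word of the language occurs with bounded gaps in every point of `Ω_ξ`. -/
theorem exists_gap (hprim : (incidence ξ).IsPrimitive) {u : List A} (hu : u ∈ language ξ) :
    ∃ R : ℕ, ∀ x ∈ Omega ξ, ∀ p : ℤ,
      ∃ k : ℕ, k + u.length ≤ R ∧ factor x (p + k) u.length = u := by
  obtain ⟨N, hN⟩ := exists_forall_infix_iter hprim hu
  choose m hm using fun n => exists_length_le (iter ξ n)
  -- The sum prevents a word of length `R` from lying in some `ξⁿ(b)` with `n < N`. The term `2 * m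
  -- N + 1` leaves room, between two incomplete end blocks, for a whole block `ξᴺ(c)`, which
  -- contains `u`.
  let R := 2 * m N + 1 + ∑ n ∈ Finset.range N, m n
  refine ⟨R, fun x hx p => infix_factor_iff.1 ?_⟩
  obtain ⟨n, b, hb⟩ := hx p R
  change _ <:+: iter ξ n b at hb
  rcases lt_or_ge n N with hn | hn
  · have h1 := hb.length_le.trans (hm n b)
    have h2 : m n ≤ ∑ n ∈ Finset.range N, m n :=
      Finset.single_le_sum (fun _ _ => Nat.zero_le _) (Finset.mem_range.2 hn)
    rw [length_factor] at h1
    omega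
  · obtain ⟨r, rfl⟩ := Nat.exists_eq_add_of_le hn
    rw [iter_add] at hb
    obtain ⟨s, w', t, h1, -, h3, h4⟩ := exists_eq_of_infix_flatMap (hm N) hb
    rcases w' with _ | ⟨c, w'⟩
    · have := congrArg List.length h1
      simp at this
      omega
    · refine (hN c).trans ?_
      rw [h1]
      exact ⟨s, w'.flatMap (iter ξ N) ++ t, by simp⟩

end Primitive

end Language

/-- The subshift `Ω_ξ` of a primitive substitution is minimal. -/
theorem Omega_subset_of_isClosed {A : Type*} [TopologicalSpace A] [Fintype A] [DecidableEq A]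
    {ξ : A → List A} (hprim : (incidence ξ).IsPrimitive) {K : Set (ℤ → A)}
    (hK : IsClosed K) (hne : (K ∩ Omega ξ).Nonempty) (hS : ∀ x ∈ K ∩ Omega ξ, shiftZ 1 x ∈ K) :
    Omega ξ ⊆ K := by
  obtain ⟨z, hz, hzΩ⟩ := hne
  have hS' : ∀ n : ℕ, shiftZ n z ∈ K ∩ Omega ξ := by
    intro n
    induction n with
    | zero => simpa using ⟨hz, hzΩ⟩
    | succ n ih =>
      have := hS _ ih
      rw [shiftZ_shiftZ] at this
      rw [show ((n + 1 : ℕ) : ℤ) = 1 + n by push_cast; ring]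
      exact ⟨this, shiftZ_mem_Omega hzΩ _⟩
  intro x hx
  -- The central word of `x` is sought to the right of the origin of `z`, because `K` is only
  -- assumed stable under the forward shift.
  have key : ∀ n : ℕ, ∃ q : ℕ, ∀ i : ℤ, -n ≤ i → i ≤ n → shiftZ q z i = x i := by
    intro n
    obtain ⟨R, hR⟩ := exists_gap hprim (hx (-n) (2 * n + 1))
    obtain ⟨k, -, hk⟩ := hR z hzΩ 0
    rw [length_factor, factor_eq_iff] at hk
    refine ⟨k + n, fun i h1 h2 => ?_⟩
    have := hk (i + n).toNat (by omega)
    rw [shiftZ_apply]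
    convert this using 2 <;> push_cast <;> omega
  choose q hq using key
  refine hK.mem_of_tendsto (f := fun n => shiftZ (q n) z) (b := atTop) ?_
    (Eventually.of_forall fun n => (hS' (q n)).1)
  rw [tendsto_pi_nhds]
  intro i
  refine tendsto_const_nhds.congr' ?_
  filter_upwards [eventually_ge_atTop i.natAbs] with n hn
  exact (hq n i (by omega) (by omega)).symm

/-! ### Topology of the subshift and consequences of minimality -/

section Topology

variable {A : Type*} [TopologicalSpace A] [DiscreteTopology A] {ξ : A → List A}

theorem isLocallyConstant_of_finite {β : Type*} (s : Finset ℤ) {f : (ℤ → A) → β}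
    (h : ∀ x x' : ℤ → A, (∀ i ∈ s, x i = x' i) → f x = f x') : IsLocallyConstant f := by
  rw [IsLocallyConstant.iff_eventually_eq]
  intro x
  have h1 : {x' : ℤ → A | ∀ i ∈ s, x' i = x i} ∈ 𝓝 x := by
    have : IsOpen ((s : Set ℤ).pi fun i => {x i}) :=
      isOpen_set_pi s.finite_toSet fun i _ => isOpen_discrete _
    exact this.mem_nhds (fun i _ => rfl)
  filter_upwards [h1] with x' hx'
  exact h _ _ hx'

theorem isLocallyConstant_factor (i : ℤ) (l : ℕ) :
    IsLocallyConstant fun x : ℤ → A => factor x i l :=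
  isLocallyConstant_of_finite (Finset.Ico i (i + l)) fun x x' h =>
    factor_congr fun j hj => h _ (Finset.mem_Ico.2 ⟨by omega, by omega⟩)

theorem isClopen_factor (i : ℤ) (l : ℕ) (s : Set (List A)) :
    IsClopen {x : ℤ → A | factor x i l ∈ s} :=
  ⟨⟨(isLocallyConstant_factor i l) sᶜ⟩, (isLocallyConstant_factor i l) s⟩

theorem isClosed_Omega : IsClosed (Omega ξ) := by
  have : Omega ξ = ⋂ (i : ℤ) (l : ℕ), {x | factor x i l ∈ language ξ} := by
    ext x; simp [Omega]
  rw [this]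
  exact isClosed_iInter fun i => isClosed_iInter fun l => (isClopen_factor i l _).1

theorem isCompact_Omega [Finite A] : IsCompact (Omega ξ) := isClosed_Omega.isCompact

theorem isClopen_apply (i : ℤ) (a : A) : IsClopen {x : ℤ → A | x i = a} :=
  (isClopen_discrete {a}).preimage (continuous_apply i)

theorem isCompact_cyl [Finite A] (a : A) : IsCompact (cyl ξ a) :=
  isCompact_Omega.inter_right (isClopen_apply 0 a).1

theorem continuous_shiftZ {A : Type*} [TopologicalSpace A] (j : ℤ) :
    Continuous (shiftZ j : (ℤ → A) → ℤ → A) :=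
  continuous_pi fun i => continuous_apply (i + j)

theorem continuous_seqMap : Continuous (seqMap ξ) := by
  refine continuous_pi fun p => IsLocallyConstant.continuous ?_
  rcases p with i | j
  · refine isLocallyConstant_of_finite (Finset.Icc 0 i) fun x x' h => ?_
    have e : factor x 0 (i + 1) = factor x' 0 (i + 1) :=
      factor_congr fun k hk => h _ (Finset.mem_Icc.2 ⟨by omega, by omega⟩)
    simp only [seqMap, e, h 0 (by simp)]
  · refine isLocallyConstant_of_finite (Finset.Icc (Int.negSucc j) 0) fun x x' h => ?_
    have e : factor x (Int.negSucc j) (j + 1) = factor x' (Int.negSucc j) (j + 1) :=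
      factor_congr fun k hk => h _ (Finset.mem_Icc.2 ⟨by omega, by omega⟩)
    simp only [seqMap, e, h 0 (Finset.mem_Icc.2 ⟨by omega, le_rfl⟩)]

theorem continuous_seqMap_iterate (n : ℕ) : Continuous (seqMap ξ)^[n] :=
  continuous_seqMap.iterate n

variable [Fintype A] [DecidableEq A]

/-- The level sets are closed and shift invariant, so minimality forces a single one. This rigidity
is what makes the transfer functions unique up to constants. -/
theorem eq_of_shift_invariant (hprim : (incidence ξ).IsPrimitive) {f : (ℤ → A) → ℝ}
    (hf : ContinuousOn f (Omega ξ)) (hS : ∀ x ∈ Omega ξ, f (shiftZ 1 x) = f x)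
    {x y : ℤ → A} (hx : x ∈ Omega ξ) (hy : y ∈ Omega ξ) : f x = f y := by
  have hK : IsClosed (Omega ξ ∩ f ⁻¹' {f y}) :=
    hf.preimage_isClosed_of_isClosed isClosed_Omega isClosed_singleton
  refine (Omega_subset_of_isClosed hprim hK ⟨y, ⟨hy, rfl⟩, hy⟩ ?_ hx).2
  rintro z ⟨⟨hz, h⟩, -⟩
  exact ⟨shiftZ_mem_Omega hz 1, (hS z hz).trans h⟩

/-- Every point of `Ω_ξ` is, up to a shift, in the image of `Ω_ξ` by `ξⁿ`. -/
theorem exists_eq_shiftZ_seqMap (hprim : (incidence ξ).IsPrimitive) (hξ : ∀ a, ξ a ≠ []) (n : ℕ)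
    {x : ℤ → A} (hx : x ∈ Omega ξ) :
    ∃ y ∈ Omega ξ, ∃ k : ℕ, k < (iter ξ n (y 0)).length ∧ x = shiftZ k ((seqMap ξ)^[n] y) := by
  -- The points that can be parsed form a finite union of compact sets, stable under the shift: past
  -- the last letter of a block comes the first letter of the next one. Minimality then gives the
  -- whole subshift.
  let K : Set (ℤ → A) := ⋃ p : Σ b, Fin (iter ξ n b).length,
    (fun y => shiftZ (p.2 : ℕ) ((seqMap ξ)^[n] y)) '' cyl ξ p.1
  have hK : IsClosed K := by
    refine isClosed_iUnion_of_finite fun p => IsCompact.isClosed ?_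
    exact (isCompact_cyl _).image ((continuous_shiftZ _).comp (continuous_seqMap_iterate n))
  have key : ∀ y ∈ Omega ξ, ∀ k : ℕ, k < (iter ξ n (y 0)).length →
      shiftZ k ((seqMap ξ)^[n] y) ∈ K := fun y hy k hk =>
    Set.mem_iUnion.2 ⟨⟨y 0, k, hk⟩, y, ⟨hy, rfl⟩, rfl⟩
  have hpos : ∀ a, 0 < (iter ξ n a).length := fun a => List.length_pos_iff.2 (iter_ne_nil hξ n a)
  have := Omega_subset_of_isClosed hprim hK
    ⟨shiftZ (0 : ℕ) ((seqMap ξ)^[n] x), key x hx 0 (hpos _),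
      shiftZ_mem_Omega (seqMap_iterate_mem_Omega hξ n hx) _⟩ ?_ hx
  · obtain ⟨⟨b, k, hk⟩, y, ⟨hy, rfl⟩, rfl⟩ := Set.mem_iUnion.1 this
    exact ⟨y, hy, k, hk, rfl⟩
  · rintro z ⟨hz, -⟩
    obtain ⟨⟨b, k, hk⟩, y, ⟨hy, rfl⟩, rfl⟩ := Set.mem_iUnion.1 hz
    simp only [shiftZ_shiftZ]
    rcases Nat.lt_or_ge (k + 1) (iter ξ n (y 0)).length with h | h
    · have := key y hy (k + 1) h
      rwa [show ((k + 1 : ℕ) : ℤ) = 1 + k by push_cast; ring] at this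
    · have := key _ (shiftZ_mem_Omega hy 1) 0 (hpos _)
      rw [seqMap_iterate_shiftZ hξ] at this
      have e := cut_add_one (iter ξ n) y 0
      simp only [zero_add, cut_zero] at e
      rw [e, shiftZ_shiftZ] at this
      rwa [show (1 + (k : ℤ)) = ((0 : ℕ) : ℤ) + (iter ξ n (y 0)).length by omega]

end Topology

/-! ### Exponential decay of the powers of a contracting operator -/

section Decay

/-- Convergence on a finite basis controls the operator norm, so some power `L ^ k₀` has norm at
most `1/2`. The ratio `ρ` is the `k₀`-th root of `1/2`, and `K` absorbs the exponents below `k₀`. -/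
theorem exists_norm_pow_le {E : Type*} [NormedAddCommGroup E] [NormedSpace ℝ E]
    [FiniteDimensional ℝ E] (L : E →L[ℝ] E)
    (hL : ∀ v, Tendsto (fun k : ℕ => (L ^ k) v) atTop (𝓝 0)) :
    ∃ K ρ : ℝ, 0 ≤ K ∧ 0 < ρ ∧ ρ < 1 ∧ ∀ k : ℕ, ‖L ^ k‖ ≤ K * ρ ^ k := by
  let b := Module.finBasis ℝ E
  obtain ⟨C, hC, hb⟩ := b.exists_opNorm_le (F := E)
  have h1 : ∀ᶠ k : ℕ in atTop, ∀ i, ‖(L ^ k) (b i)‖ ≤ (2 * C)⁻¹ := by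
    refine eventually_all.2 fun i => ?_
    have := (hL (b i)).norm
    rw [norm_zero] at this
    exact this.eventually_le_const (by positivity)
  obtain ⟨k₀, hk, hk₀⟩ := (h1.and (eventually_ge_atTop 1)).exists
  have h2 : ‖L ^ k₀‖ ≤ 1 / 2 := by
    refine (hb (by positivity) hk).trans (le_of_eq ?_)
    field_simp
  let ρ : ℝ := (1 / 2 : ℝ) ^ ((k₀ : ℝ)⁻¹)
  have hρ0 : 0 < ρ := by positivity
  have hρ1 : ρ < 1 := Real.rpow_lt_one (by norm_num) (by norm_num) (by positivity)
  have hρk : ρ ^ k₀ = 1 / 2 := Real.rpow_inv_natCast_pow (by norm_num) (by omega)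
  let K : ℝ := ∑ r ∈ Finset.range k₀, ‖L ^ r‖ / ρ ^ r
  have hK : 0 ≤ K := Finset.sum_nonneg fun _ _ => by positivity
  refine ⟨K, ρ, hK, hρ0, hρ1, fun k => ?_⟩
  induction k using Nat.strong_induction_on with
  | _ k ih =>
    rcases lt_or_ge k k₀ with hlt | hge
    · have : ‖L ^ k‖ / ρ ^ k ≤ K :=
        Finset.single_le_sum (f := fun r => ‖L ^ r‖ / ρ ^ r) (fun _ _ => by positivity)
          (Finset.mem_range.2 hlt)
      rwa [div_le_iff₀ (by positivity)] at this
    · obtain ⟨j, rfl⟩ := Nat.exists_eq_add_of_le hge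
      rw [pow_add, pow_add, hρk]
      calc ‖L ^ k₀ * L ^ j‖ ≤ ‖L ^ k₀‖ * ‖L ^ j‖ := norm_mul_le _ _
        _ ≤ 1 / 2 * (K * ρ ^ j) := by gcongr; exact ih j (by omega)
        _ = K * (1 / 2 * ρ ^ j) := by ring

end Decay

/-! ### Sums of a vector along words -/

section WordSum

variable {A : Type*}

/-- The sum of the values of `v` at the letters of a word. -/
def wordSum (v : A → ℝ) (u : List A) : ℝ := (u.map v).sum

@[simp] theorem wordSum_nil (v : A → ℝ) : wordSum v [] = 0 := rfl

@[simp] theorem wordSum_append (v : A → ℝ) (u w : List A) :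
    wordSum v (u ++ w) = wordSum v u + wordSum v w := by simp [wordSum]

@[simp] theorem wordSum_cons (v : A → ℝ) (a : A) (u : List A) :
    wordSum v (a :: u) = v a + wordSum v u := by simp [wordSum]

theorem wordSum_one (u : List A) : wordSum (fun _ => 1) u = u.length := by
  induction u with
  | nil => simp
  | cons a u ih => simp [ih]; ring

theorem wordSum_eq_sum_count [Fintype A] [DecidableEq A] (v : A → ℝ) (u : List A) :
    wordSum v u = ∑ a, (u.count a : ℝ) * v a := by
  induction u with
  | nil => simp
  | cons b u ih =>
    simp [ih, List.count_cons, add_mul, Finset.sum_add_distrib, add_comm]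

theorem abs_wordSum_le [Fintype A] (v : A → ℝ) (u : List A) :
    |wordSum v u| ≤ u.length * ‖v‖ := by
  induction u with
  | nil => simp
  | cons a u ih =>
    rw [wordSum_cons]
    have h1 := abs_add_le (v a) (wordSum v u)
    have h2 := norm_le_pi_norm v a
    rw [Real.norm_eq_abs] at h2
    push_cast [List.length_cons]
    linarith

variable [Fintype A] [DecidableEq A] {ξ : A → List A}

theorem transposeMap_apply (v : A → ℝ) (a : A) : transposeMap ξ v a = wordSum v (ξ a) := by
  rw [wordSum_eq_sum_count]
  simp [transposeMap, dotProduct, incidence, mul_comm, Matrix.vecMul]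

/-- The duality behind the whole argument: substituting in the word amounts to applying `M_ξᵗ` to
the vector. -/
theorem wordSum_flatMap (v : A → ℝ) (u : List A) :
    wordSum v (u.flatMap ξ) = wordSum (transposeMap ξ v) u := by
  induction u with
  | nil => simp
  | cons a u ih => simp [ih, transposeMap_apply]

theorem wordSum_flatMap_iter (n : ℕ) (v : A → ℝ) (u : List A) :
    wordSum v (u.flatMap (iter ξ n)) = wordSum ((transposeMap ξ ^ n) v) u := by
  induction n generalizing u with
  | zero => simp [flatMap_iter]
  | succ n ih =>
    rw [iter_add_flatMap, iter_one, ih, wordSum_flatMap, pow_succ']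
    rfl

theorem transposeMap_pow_apply (n : ℕ) (v : A → ℝ) (a : A) :
    (transposeMap ξ ^ n) v a = wordSum v (iter ξ n a) := by
  have := wordSum_flatMap_iter (ξ := ξ) n v [a]
  simpa using this.symm

theorem transposeMap_pow_mem_stableSpace {v : A → ℝ} (hv : v ∈ stableSpace ξ) (n : ℕ) :
    (transposeMap ξ ^ n) v ∈ stableSpace ξ := by
  induction n with
  | zero => simpa using hv
  | succ n ih => rw [pow_succ']; exact transposeMap_mem_stableSpace ξ _ ih

theorem exists_norm_transposeMap_pow_le (ξ : A → List A) :
    ∃ K ρ : ℝ, 0 ≤ K ∧ 0 < ρ ∧ ρ < 1 ∧ ∀ v ∈ stableSpace ξ, ∀ k : ℕ,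
      ‖(transposeMap ξ ^ k) v‖ ≤ K * ρ ^ k * ‖v‖ := by
  let L := ((transposeMap ξ).restrict (transposeMap_mem_stableSpace ξ)).toContinuousLinearMap
  have hL : ∀ (k : ℕ) (v : stableSpace ξ), ((L ^ k) v : A → ℝ) = (transposeMap ξ ^ k) v := by
    intro k v
    induction k with
    | zero => simp
    | succ k ih =>
      rw [pow_succ', pow_succ', Module.End.mul_apply, ← ih]
      rfl
  obtain ⟨K, ρ, hK, hρ, hρ1, h⟩ := exists_norm_pow_le L (fun v => by
    rw [tendsto_subtype_rng]
    simp only [hL]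
    exact v.2.1)
  refine ⟨K, ρ, hK, hρ, hρ1, fun v hv k => ?_⟩
  have := (L ^ k).le_of_opNorm_le (h k) ⟨v, hv⟩
  rwa [Submodule.coe_norm, Submodule.coe_norm, hL] at this

/-- The sums of a vector of `E^s` along the words of the language are bounded. -/
theorem exists_abs_wordSum_le (ξ : A → List A) :
    ∃ C : ℝ, 0 ≤ C ∧ ∀ v ∈ stableSpace ξ, ∀ u ∈ language ξ, |wordSum v u| ≤ C * ‖v‖ := by
  obtain ⟨K, ρ, hK, hρ, hρ1, h⟩ := exists_norm_transposeMap_pow_le ξ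
  obtain ⟨m, hm⟩ := exists_length_le ξ
  -- Desubstitute one level at a time: `u` is `ξ(w)` between two words of length at most `m`, and by
  -- duality `ξ(w)` contributes the sum of `M_ξᵗ v` along `w`. The `+ 1` covers the single letter of
  -- level `0`.
  have key : ∀ (n : ℕ) (b : A) (u : List A), u <:+: iter ξ n b → ∀ v : A → ℝ,
      |wordSum v u| ≤ (2 * m + 1) * ∑ k ∈ Finset.range (n + 1), ‖(transposeMap ξ ^ k) v‖ := by
    intro n b
    induction n with
    | zero =>
      intro u hu v
      have h1 := abs_wordSum_le v u
      have h2 : (u.length : ℝ) ≤ 2 * m + 1 := by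
        have : u.length ≤ 1 := hu.length_le
        exact_mod_cast (show u.length ≤ 2 * m + 1 by omega)
      simp only [zero_add, Finset.range_one, Finset.sum_singleton, pow_zero, Module.End.one_apply]
      exact h1.trans (by gcongr)
    | succ n ih =>
      intro u hu v
      rw [add_comm, iter_add, iter_one] at hu
      obtain ⟨s, w, p, rfl, hw, hs, hp⟩ := exists_eq_of_infix_flatMap hm hu
      have h1 := ih w hw (transposeMap ξ v)
      have h2 := abs_wordSum_le v s
      have h3 := abs_wordSum_le v p
      have h4 : (s.length : ℝ) * ‖v‖ ≤ m * ‖v‖ := by gcongr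
      have h5 : (p.length : ℝ) * ‖v‖ ≤ m * ‖v‖ := by gcongr
      rw [Finset.sum_range_succ', wordSum_append, wordSum_append, wordSum_flatMap]
      simp only [pow_succ, Module.End.mul_apply, pow_zero, Module.End.one_apply] at h1 ⊢
      have h6 := abs_add_le (wordSum v s + wordSum (transposeMap ξ v) w) (wordSum v p)
      have h7 := abs_add_le (wordSum v s) (wordSum (transposeMap ξ v) w)
      have h8 := norm_nonneg v
      rw [mul_add]
      linarith
  refine ⟨(2 * m + 1) * (K * (1 - ρ)⁻¹), by have := sub_pos.2 hρ1; positivity, ?_⟩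
  rintro v hv u ⟨n, b, hu⟩
  refine (key n b u hu v).trans ?_
  rw [mul_assoc]
  gcongr
  calc ∑ k ∈ Finset.range (n + 1), ‖(transposeMap ξ ^ k) v‖
      ≤ ∑ k ∈ Finset.range (n + 1), K * ‖v‖ * ρ ^ k :=
        Finset.sum_le_sum fun k _ => (h v hv k).trans (le_of_eq (by ring))
    _ = K * ‖v‖ * ∑ k ∈ Finset.range (n + 1), ρ ^ k := by rw [Finset.mul_sum]
    _ ≤ K * ‖v‖ * (1 - ρ)⁻¹ := by
        gcongr
        rw [← tsum_geometric_of_lt_one hρ.le hρ1]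
        exact (summable_geometric_of_lt_one hρ.le hρ1).sum_le_tsum _ fun _ _ => by positivity
    _ = K * (1 - ρ)⁻¹ * ‖v‖ := by ring

end WordSum

/-! ### Suprema of bounded sums solve the cohomological equation -/

section Transfer

variable {A : Type*} {ξ : A → List A}

/-- For sums bounded along the language, a word realising almost the largest absolute value of
the sums forces the sums to be almost maximal wherever it occurs. -/
theorem exists_almost_max {v : A → ℝ} {C : ℝ} (hC : ∀ u ∈ language ξ, |wordSum v u| ≤ C)
    (hne : (language ξ).Nonempty) {ε : ℝ} (hε : 0 < ε) :
    ∃ u ∈ language ξ, ∃ o ≤ u.length, ∀ x ∈ Omega ξ, ∀ p : ℕ, factor x p u.length = u →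
      ∀ n, wordSum v (factor x 0 n) ≤ wordSum v (factor x 0 (p + o)) + ε := by
  have hbdd : BddAbove ((fun u => |wordSum v u|) '' language ξ) :=
    ⟨C, by rintro _ ⟨u, hu, rfl⟩; exact hC u hu⟩
  obtain ⟨_, ⟨u, hu, rfl⟩, hlt⟩ := exists_lt_of_lt_csSup (hne.image _)
    (sub_lt_self (sSup ((fun u => |wordSum v u|) '' language ξ)) hε)
  set c := sSup ((fun u => |wordSum v u|) '' language ξ) with hc
  have hadd : ∀ (x : ℤ → A) (n m : ℕ), wordSum v (factor x 0 (n + m))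
      = wordSum v (factor x 0 n) + wordSum v (factor x n m) := fun x n m => by
    rw [factor_add, wordSum_append, zero_add]
  have hle : ∀ x ∈ Omega ξ, ∀ n q : ℕ,
      wordSum v (factor x 0 n) ≤ wordSum v (factor x 0 q) + c := by
    intro x hx n q
    have h : ∀ (i : ℤ) (l : ℕ), |wordSum v (factor x i l)| ≤ c := fun i l =>
      le_csSup hbdd ⟨_, hx i l, rfl⟩
    rcases le_total q n with hqn | hqn
    · obtain ⟨m, rfl⟩ := Nat.exists_eq_add_of_le hqn
      rw [hadd]
      linarith [le_abs_self (wordSum v (factor x q m)), h q m]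
    · obtain ⟨m, rfl⟩ := Nat.exists_eq_add_of_le hqn
      rw [hadd]
      linarith [neg_abs_le (wordSum v (factor x n m)), h n m]
  simp only at hlt
  -- Along `u` the partial sums vary by almost `c`, the largest variation possible. If they
  -- increase, their value at the right end of `u` is almost maximal; if they decrease, their value
  -- at its left end is, whence `o = 0`.
  rcases le_total 0 (wordSum v u) with hs | hs
  · refine ⟨u, hu, u.length, le_rfl, fun x hx p hp n => ?_⟩
    rw [abs_of_nonneg hs] at hlt
    rw [hadd, hp]
    linarith [hle x hx n p]
  · refine ⟨u, hu, 0, Nat.zero_le _, fun x hx p hp n => ?_⟩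
    rw [abs_of_nonpos hs] at hlt
    have := hle x hx n (p + u.length)
    rw [hadd, hp] at this
    rw [add_zero]
    linarith

/-- The supremum of the sums of `v` along the prefixes of the right half of a sequence. -/
noncomputable def supSum (v : A → ℝ) (x : ℤ → A) : ℝ := ⨆ n : ℕ, wordSum v (factor x 0 n)

section

variable {v : A → ℝ} {C : ℝ} {x : ℤ → A}

theorem wordSum_le_supSum (hC : ∀ u ∈ language ξ, |wordSum v u| ≤ C) (hx : x ∈ Omega ξ) (n : ℕ) :
    wordSum v (factor x 0 n) ≤ supSum v x :=
  le_ciSup (f := fun n : ℕ => wordSum v (factor x 0 n))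
    ⟨C, by rintro _ ⟨n, rfl⟩; exact (le_abs_self _).trans (hC _ (hx 0 n))⟩ n

theorem supSum_nonneg (hC : ∀ u ∈ language ξ, |wordSum v u| ≤ C) (hx : x ∈ Omega ξ) :
    0 ≤ supSum v x := by simpa using wordSum_le_supSum hC hx 0

theorem supSum_le (hC : ∀ u ∈ language ξ, |wordSum v u| ≤ C) (hx : x ∈ Omega ξ) :
    supSum v x ≤ C :=
  ciSup_le fun n => (le_abs_self _).trans (hC _ (hx 0 n))

variable [Fintype A] [DecidableEq A]

/-- Shifting discards only the empty prefix. This does not change the supremum, since an almost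
maximizing word recurs and the supremum is approached at positive times as well. -/
theorem supSum_shiftZ (hprim : (incidence ξ).IsPrimitive)
    (hC : ∀ u ∈ language ξ, |wordSum v u| ≤ C) (hx : x ∈ Omega ξ) :
    supSum v (shiftZ 1 x) = supSum v x - v (x 0) := by
  have hadd : ∀ n : ℕ, wordSum v (factor x 0 (n + 1))
      = v (x 0) + wordSum v (factor (shiftZ 1 x) 0 n) := fun n => by
    rw [factor_shiftZ, add_comm n 1, factor_add, wordSum_append]
    simp [factor_eq_map]
  apply le_antisymm
  · refine ciSup_le fun n => ?_
    linarith [hadd n, wordSum_le_supSum hC hx (n + 1)]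
  · rw [sub_le_iff_le_add]
    refine le_of_forall_pos_le_add fun ε hε => ciSup_le fun n => ?_
    obtain ⟨u, hu, o, ho, h⟩ := exists_almost_max hC ⟨_, hx 0 0⟩ hε
    obtain ⟨R, hR⟩ := exists_gap hprim hu
    obtain ⟨k, -, hk⟩ := hR x hx 1
    rw [show (1 + (k : ℤ)) = ((1 + k : ℕ) : ℤ) by push_cast; ring] at hk
    have h1 := h x hx (1 + k) hk n
    rw [show 1 + k + o = k + o + 1 by ring, hadd] at h1
    linarith [wordSum_le_supSum hC (shiftZ_mem_Omega hx 1) (k + o)]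

/-- An almost maximizing word found at place `k` in `x` is also at place `k` in every nearby point,
and the sums up to that place coincide. Both suprema are thus within `ε / 2` above the same number.
-/
theorem continuousOn_supSum [TopologicalSpace A] [DiscreteTopology A]
    (hprim : (incidence ξ).IsPrimitive) (hC : ∀ u ∈ language ξ, |wordSum v u| ≤ C) :
    ContinuousOn (supSum v) (Omega ξ) := by
  intro x hx
  rw [ContinuousWithinAt, Metric.tendsto_nhds]
  intro ε hε
  obtain ⟨u, hu, o, ho, h⟩ := exists_almost_max hC ⟨_, hx 0 0⟩ (half_pos hε)
  obtain ⟨R, hR⟩ := exists_gap hprim hu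
  obtain ⟨k, -, hk⟩ := hR x hx 0
  rw [zero_add] at hk
  filter_upwards [nhdsWithin_le_nhds (((IsLocallyConstant.iff_eventually_eq _).1
    (isLocallyConstant_factor (A := A) 0 (k + u.length))) x), self_mem_nhdsWithin] with y hy hyΩ
  have e1 : factor y 0 (k + o) = factor x 0 (k + o) :=
    factor_eq_iff.2 fun i hi => factor_eq_iff.1 hy i (by omega)
  have e2 : factor y k u.length = u := by
    rw [← hk, length_factor]
    exact factor_eq_iff.2 fun i hi => by
      have := factor_eq_iff.1 hy (k + i) (by omega)
      push_cast at this
      simpa using this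
  have a1 := wordSum_le_supSum hC hx (k + o)
  have a2 := wordSum_le_supSum hC hyΩ (k + o)
  have a3 : supSum v x ≤ _ := ciSup_le (h x hx k hk)
  have a4 : supSum v y ≤ _ := ciSup_le (h y hyΩ k e2)
  rw [e1] at a2 a4
  rw [Real.dist_eq, abs_lt]
  constructor <;> linarith

end

end Transfer

/-! ### Transfer functions compatible with the substitution -/

section Transfer

variable {A : Type*} {ξ : A → List A}

theorem apply_shiftZ_natCast {f : (ℤ → A) → ℝ} {v : A → ℝ}
    (h : ∀ x ∈ Omega ξ, f (shiftZ 1 x) = f x - v (x 0)) {x : ℤ → A} (hx : x ∈ Omega ξ) (n : ℕ) :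
    f (shiftZ n x) = f x - wordSum v (factor x 0 n) := by
  induction n with
  | zero => simp
  | succ n ih =>
    have := h _ (shiftZ_mem_Omega hx n)
    rw [shiftZ_shiftZ, ih] at this
    rw [show ((n + 1 : ℕ) : ℤ) = 1 + n by push_cast; ring, this, factor_succ]
    simp; ring

variable [Fintype A] [DecidableEq A]

theorem apply_seqMap_iterate_shiftZ (hξ : ∀ a, ξ a ≠ []) {f : (ℤ → A) → ℝ} {v : A → ℝ}
    (h : ∀ x ∈ Omega ξ, f (shiftZ 1 x) = f x - v (x 0)) {x : ℤ → A} (hx : x ∈ Omega ξ) (n : ℕ) :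
    f ((seqMap ξ)^[n] (shiftZ 1 x)) = f ((seqMap ξ)^[n] x) - (transposeMap ξ ^ n) v (x 0) := by
  rw [seqMap_iterate_shiftZ hξ, show (1 : ℤ) = (1 : ℕ) from rfl, cut_natCast,
    apply_shiftZ_natCast h (seqMap_iterate_mem_Omega hξ n hx),
    (isConcat_seqMap_iterate hξ n x).factor_zero, wordSum_flatMap_iter]
  simp [factor_eq_map]

variable [TopologicalSpace A]

/-- A solution, for all vectors of `E^s`, of the cohomological equation over the subshift,
compatible with the action of the substitution. -/
structure IsTransfer (ξ : A → List A) (F : (A → ℝ) → (ℤ → A) → ℝ) (C : ℝ) : Prop where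
  nonneg : 0 ≤ C
  continuousOn : ∀ v ∈ stableSpace ξ, ContinuousOn (F v) (Omega ξ)
  shift : ∀ v ∈ stableSpace ξ, ∀ x ∈ Omega ξ, F v (shiftZ 1 x) = F v x - v (x 0)
  abs_le : ∀ v ∈ stableSpace ξ, ∀ x ∈ Omega ξ, |F v x| ≤ C * ‖v‖
  seqMap : ∀ v ∈ stableSpace ξ, ∀ x ∈ Omega ξ, F v (seqMap ξ x) = F (transposeMap ξ v) x
  add : ∀ v ∈ stableSpace ξ, ∀ w ∈ stableSpace ξ, ∀ x ∈ Omega ξ, F (v + w) x = F v x + F w x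
  smul : ∀ c : ℝ, ∀ v ∈ stableSpace ξ, ∀ x ∈ Omega ξ, F (c • v) x = c * F v x

/-- `supSum v` satisfies linearity in `v` and compatibility with `ξ` only up to constants.
Subtracting its limit along the points `ξⁿ(y₀)` removes all these constants together. -/
theorem exists_isTransfer [DiscreteTopology A] (hprim : (incidence ξ).IsPrimitive)
    (hξ : ∀ a, ξ a ≠ []) (hne : (Omega ξ).Nonempty) : ∃ F C, IsTransfer ξ F C := by
  obtain ⟨y₀, hy₀⟩ := hne
  obtain ⟨C, hC0, hC⟩ := exists_abs_wordSum_le ξ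
  obtain ⟨K, ρ, hK, hρ, hρ1, hdec⟩ := exists_norm_transposeMap_pow_le ξ
  have hΨ := fun n {y} hy => seqMap_iterate_mem_Omega (ξ := ξ) (y := y) hξ n hy
  have hshift := fun v hv x hx => supSum_shiftZ (v := v) (x := x) hprim (hC v hv) hx
  have hcont := fun v hv => continuousOn_supSum (v := v) hprim (hC v hv)
  -- Both functions have the same increments under the shift, so their difference is constant. Hence
  -- `supSum v ∘ ξⁿ` oscillates no more than `supSum (Mⁿ v)`, which decays geometrically: the
  -- sequence defining `c v` is Cauchy.
  have hconst : ∀ v ∈ stableSpace ξ, ∀ n : ℕ, ∀ x ∈ Omega ξ, ∀ y ∈ Omega ξ,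
      supSum v ((seqMap ξ)^[n] x) - supSum ((transposeMap ξ ^ n) v) x
        = supSum v ((seqMap ξ)^[n] y) - supSum ((transposeMap ξ ^ n) v) y := by
    intro v hv n x hx y hy
    have hTv := transposeMap_pow_mem_stableSpace hv n
    refine eq_of_shift_invariant (ξ := ξ) hprim (f := fun x =>
      supSum v ((seqMap ξ)^[n] x) - supSum ((transposeMap ξ ^ n) v) x) ?_ ?_ hx hy
    · exact ((hcont v hv).comp (continuous_seqMap_iterate n).continuousOn
        fun z hz => hΨ n hz).sub (hcont _ hTv)
    · intro z hz
      rw [apply_seqMap_iterate_shiftZ hξ (hshift v hv) hz, hshift _ hTv z hz]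
      ring
  have hosc : ∀ v ∈ stableSpace ξ, ∀ n : ℕ, ∀ x ∈ Omega ξ, ∀ y ∈ Omega ξ,
      |supSum v ((seqMap ξ)^[n] x) - supSum v ((seqMap ξ)^[n] y)|
        ≤ C * (K * ρ ^ n * ‖v‖) := by
    intro v hv n x hx y hy
    have hTv := transposeMap_pow_mem_stableSpace hv n
    have h1 : C * ‖(transposeMap ξ ^ n) v‖ ≤ C * (K * ρ ^ n * ‖v‖) := by
      gcongr; exact hdec v hv n
    have h2 := hconst v hv n x hx y hy
    have h3 := supSum_nonneg (hC _ hTv) hx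
    have h4 := supSum_nonneg (hC _ hTv) hy
    have h5 := supSum_le (hC _ hTv) hx
    have h6 := supSum_le (hC _ hTv) hy
    rw [abs_le]
    constructor <;> linarith
  have hlim : ∀ v ∈ stableSpace ξ, ∃ c,
      Tendsto (fun n => supSum v ((seqMap ξ)^[n] y₀)) atTop (𝓝 c) := by
    intro v hv
    refine cauchySeq_tendsto_of_complete
      (cauchySeq_of_le_geometric ρ (C * (K * ‖v‖)) hρ1 fun n => ?_)
    have := hosc v hv n y₀ hy₀ _ (hΨ 1 hy₀)
    rw [← Function.iterate_add_apply] at this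
    rw [Real.dist_eq]
    exact this.trans (le_of_eq (by ring))
  choose! c hc using hlim
  -- A continuous invariant function is constant, and its value can be read as a limit along
  -- `ξⁿ(y₀)`. It is applied to the defect of each identity to be proved.
  have hzero : ∀ {f : (ℤ → A) → ℝ}, ContinuousOn f (Omega ξ) →
      (∀ x ∈ Omega ξ, f (shiftZ 1 x) = f x) → ∀ {l : ℝ},
      Tendsto (fun n => f ((seqMap ξ)^[n] y₀)) atTop (𝓝 l) → ∀ x ∈ Omega ξ, f x = l := by
    intro f hf hS l hl x hx
    refine tendsto_nhds_unique (hl.congr fun n => ?_) tendsto_const_nhds |>.symm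
    exact eq_of_shift_invariant hprim hf hS (hΨ n hy₀) hx
  refine ⟨fun v x => supSum v x - c v, C, hC0, ?_, ?_, ?_, ?_, ?_, ?_⟩
  · exact fun v hv => (hcont v hv).sub continuousOn_const
  · intro v hv x hx
    rw [hshift v hv x hx]; ring
  · intro v hv x hx
    have h1 := supSum_nonneg (hC v hv) hx
    have h2 := supSum_le (hC v hv) hx
    have h3 : 0 ≤ c v := ge_of_tendsto' (hc v hv) fun n => supSum_nonneg (hC v hv) (hΨ n hy₀)
    have h4 : c v ≤ C * ‖v‖ := le_of_tendsto' (hc v hv) fun n => supSum_le (hC v hv) (hΨ n hy₀)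
    rw [abs_le]
    constructor <;> linarith
  · intro v hv x hx
    have hTv := transposeMap_mem_stableSpace ξ v hv
    have := hzero (f := fun x => supSum v (SubstShift.seqMap ξ x) - supSum (transposeMap ξ v) x)
      (((hcont v hv).comp continuous_seqMap.continuousOn fun z hz => hΨ 1 hz).sub (hcont _ hTv))
      (fun z hz => by
        have := apply_seqMap_iterate_shiftZ hξ (hshift v hv) hz 1
        simp only [Function.iterate_one, pow_one] at this
        simp only [this, hshift _ hTv z hz]
        ring)
      (l := c v - c (transposeMap ξ v)) (by
        refine Tendsto.sub ?_ (hc _ hTv)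
        refine ((tendsto_add_atTop_iff_nat 1).2 (hc v hv)).congr fun n => ?_
        rw [Function.iterate_succ_apply']) x hx
    linarith
  · intro v hv w hw x hx
    have hvw := add_mem hv hw
    have := hzero (f := fun x => supSum (v + w) x - (supSum v x + supSum w x))
      ((hcont _ hvw).sub ((hcont v hv).add (hcont w hw)))
      (fun z hz => by
        simp only [hshift _ hvw z hz, hshift _ hv z hz, hshift _ hw z hz, Pi.add_apply]
        ring)
      ((hc _ hvw).sub ((hc v hv).add (hc w hw))) x hx
    linarith
  · intro r v hv x hx
    have hrv := (stableSpace ξ).smul_mem r hv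
    have := hzero (f := fun x => supSum (r • v) x - r * supSum v x)
      ((hcont _ hrv).sub (continuousOn_const.mul (hcont v hv)))
      (fun z hz => by
        simp only [hshift _ hrv z hz, hshift _ hv z hz, Pi.smul_apply, smul_eq_mul]
        ring)
      ((hc _ hrv).sub ((hc v hv).const_mul r)) x hx
    linarith

namespace IsTransfer

variable {F : (A → ℝ) → (ℤ → A) → ℝ} {C : ℝ}

theorem shift_natCast (hF : IsTransfer ξ F C) {v : A → ℝ} (hv : v ∈ stableSpace ξ) {x : ℤ → A}
    (hx : x ∈ Omega ξ) (n : ℕ) : F v (shiftZ n x) = F v x - wordSum v (factor x 0 n) :=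
  apply_shiftZ_natCast (hF.shift v hv) hx n

theorem seqMap_iterate (hF : IsTransfer ξ F C) (hξ : ∀ a, ξ a ≠ []) {v : A → ℝ}
    (hv : v ∈ stableSpace ξ) {x : ℤ → A} (hx : x ∈ Omega ξ) (n : ℕ) :
    F v ((SubstShift.seqMap ξ)^[n] x) = F ((transposeMap ξ ^ n) v) x := by
  induction n generalizing v with
  | zero => simp
  | succ n ih =>
    rw [Function.iterate_succ_apply', hF.seqMap v hv _ (seqMap_iterate_mem_Omega hξ n hx),
      ih (transposeMap_mem_stableSpace ξ v hv), pow_succ]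
    rfl

theorem sum (hF : IsTransfer ξ F C) {ι : Type*} (s : Finset ι) (c : ι → ℝ) (w : ι → A → ℝ)
    (hw : ∀ i, w i ∈ stableSpace ξ) {x : ℤ → A} (hx : x ∈ Omega ξ) :
    F (∑ i ∈ s, c i • w i) x = ∑ i ∈ s, c i * F (w i) x := by
  classical
  induction s using Finset.induction_on with
  | empty =>
    have := hF.smul 0 0 (zero_mem _) x hx
    simpa using this
  | insert i s hi ih =>
    rw [Finset.sum_insert hi, Finset.sum_insert hi,
      hF.add _ ((stableSpace ξ).smul_mem _ (hw i)) _
        (sum_mem fun j _ => (stableSpace ξ).smul_mem _ (hw j)) x hx,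
      hF.smul _ _ (hw i) x hx, ih]

end IsTransfer

end Transfer

/-! ### Integrality and linear independence of the vectors `v(i)` -/

section Splitting

variable {A : Type*} {ξ : A → List A}

theorem exists_int_wordSum {w : A → ℝ} (hw : ∀ a, ∃ z : ℤ, w a = z) (u : List A) :
    ∃ z : ℤ, wordSum w u = z := by
  induction u with
  | nil => exact ⟨0, by simp⟩
  | cons a u ih =>
    obtain ⟨z, hz⟩ := hw a
    obtain ⟨y, hy⟩ := ih
    exact ⟨z + y, by simp [hz, hy]⟩

variable [Fintype A] [DecidableEq A]

theorem transposeMap_pow_one_apply (m : ℕ) (a : A) :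
    (transposeMap ξ ^ m) (fun _ => 1) a = (iter ξ m a).length := by
  rw [transposeMap_pow_apply, wordSum_one]

theorem IsSplitting.exists_int {n : ℕ} {α : Fin n → ℝ} {v : Fin n → A → ℝ}
    (h : IsSplitting ξ α v) : ∃ (m : ℕ) (z : Fin n → A → ℤ), ∀ i a,
      (transposeMap ξ ^ m) (v i) a = α i * (iter ξ m a).length - z i a := by
  choose hv w hw m hm using h
  have key : ∀ i a, ∃ z : ℤ, (transposeMap ξ ^ (∑ j, m j)) (w i) a = z := by
    intro i a
    have hle : m i ≤ ∑ j, m j := Finset.single_le_sum (fun _ _ => Nat.zero_le _) (Finset.mem_univ i)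
    obtain ⟨r, hr⟩ := Nat.exists_eq_add_of_le' hle
    rw [hr, pow_add, Module.End.mul_apply, transposeMap_pow_apply]
    exact exists_int_wordSum (hm i) _
  choose z hz using key
  refine ⟨∑ j, m j, z, fun i a => ?_⟩
  have hvi : v i = α i • (fun _ => (1 : ℝ)) - w i := by
    funext b; simp [hw i b]
  rw [hvi, map_sub, map_smul, Pi.sub_apply, Pi.smul_apply, transposeMap_pow_one_apply, hz,
    smul_eq_mul]

/-- The powers of `M_ξᵗ` send `(1, …, 1)` to vectors of word lengths, which are at least `1` and so
cannot be contracted. -/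
theorem eq_zero_of_smul_one_mem [Nonempty A] (hξ : ∀ a, ξ a ≠ []) {m : ℕ} {s : ℝ}
    (h : s • (transposeMap ξ ^ m) (fun _ => 1) ∈ stableSpace ξ) : s = 0 := by
  obtain ⟨a⟩ := ‹Nonempty A›
  have h1 := (tendsto_pi_nhds.1 h.1 a).norm
  simp only [map_smul, ← Module.End.mul_apply, ← pow_add, Pi.smul_apply,
    transposeMap_pow_one_apply, Pi.zero_apply, norm_zero] at h1
  refine norm_le_zero_iff.1 (ge_of_tendsto' h1 fun k => ?_)
  rw [norm_smul]
  have h2 : 1 ≤ (iter ξ (k + m) a).length := List.length_pos_iff.2 (iter_ne_nil hξ _ a)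
  have h3 : (1 : ℝ) ≤ ‖((iter ξ (k + m) a).length : ℝ)‖ := by
    rw [Real.norm_natCast]; exact_mod_cast h2
  exact le_mul_of_one_le_right (norm_nonneg s) h3

/-- Frequencies that are rationally independent of `1` give linearly independent vectors. -/
theorem IsSplitting.linearIndependent [Nonempty A] (hξ : ∀ a, ξ a ≠ []) {n : ℕ} {α : Fin n → ℝ}
    {v : Fin n → A → ℝ} (h : IsSplitting ξ α v)
    (hindep : LinearIndependent ℚ (fun o : Option (Fin n) => o.elim (1 : ℝ) α)) :
    LinearIndependent ℝ v := by
  obtain ⟨m, z, hz⟩ := h.exists_int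
  rw [Fintype.linearIndependent_iff] at hindep ⊢
  intro c hc i
  -- A real relation between the `v j` is tested against all `ℚ`-linear forms `φ` on `ℝ`. Each turns
  -- it into a relation with rational coefficients `q j`, which makes `∑ q j • M^m (v j)` a multiple
  -- of the vector of lengths. That multiple lies in `E^s`, hence vanishes, and the rational
  -- independence of `1` and the `α j` gives `q = 0`.
  rw [← Module.forall_dual_apply_eq_zero_iff ℚ]
  intro φ
  let q : Fin n → ℚ := fun j => φ (c j)
  let q₀ : ℚ := φ (∑ j, c j * α j)
  have h1 : ∀ a, (∑ j, c j * α j) * (iter ξ m a).length = ∑ j, c j * z j a := by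
    intro a
    have h2 := congrFun (congrArg (transposeMap ξ ^ m) hc) a
    simp only [map_sum, map_smul, Finset.sum_apply, Pi.smul_apply, hz, smul_eq_mul, mul_sub,
      Finset.sum_sub_distrib, map_zero, Pi.zero_apply, sub_eq_zero] at h2
    rw [← h2, Finset.sum_mul]
    exact Finset.sum_congr rfl fun j _ => by ring
  have h3 : ∀ a, q₀ * ((iter ξ m a).length : ℚ) = ∑ j, q j * (z j a : ℚ) := by
    intro a
    have h4 := congrArg φ (h1 a)
    have e1 : (∑ j, c j * α j) * ((iter ξ m a).length : ℝ)
        = ((iter ξ m a).length : ℚ) • (∑ j, c j * α j) := by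
      rw [Rat.smul_def]; push_cast; ring
    have e2 : ∀ j, c j * (z j a : ℝ) = (z j a : ℚ) • c j := fun j => by
      rw [Rat.smul_def]; push_cast; ring
    have e3 : φ (∑ j, c j * z j a) = ∑ j, (z j a : ℚ) * φ (c j) := by
      rw [map_sum]
      exact Finset.sum_congr rfl fun j _ => by rw [e2, map_smul, smul_eq_mul]
    rw [e1, map_smul, e3, smul_eq_mul] at h4
    rw [mul_comm]
    refine h4.trans (Finset.sum_congr rfl fun j _ => mul_comm _ _)
  have h5 : (∑ j, (q j : ℝ) * α j) - q₀ = 0 := by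
    refine eq_zero_of_smul_one_mem (ξ := ξ) (m := m) hξ ?_
    have e : ((∑ j, (q j : ℝ) * α j) - q₀) • (transposeMap ξ ^ m) (fun _ => 1)
        = ∑ j, (q j : ℝ) • (transposeMap ξ ^ m) (v j) := by
      funext a
      have h6 : (q₀ : ℝ) * ((iter ξ m a).length : ℝ) = ∑ j, (q j : ℝ) * (z j a : ℝ) := by
        exact_mod_cast h3 a
      simp only [Pi.smul_apply, smul_eq_mul, transposeMap_pow_one_apply, Finset.sum_apply, hz,
        sub_mul, h6, mul_sub, Finset.sum_sub_distrib, Finset.sum_mul, mul_assoc]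
    rw [e]
    exact sum_mem fun j _ => (stableSpace ξ).smul_mem _
      (transposeMap_pow_mem_stableSpace (h j).1 m)
  have h7 := hindep (fun o => o.elim (-q₀) q) (by
    rw [Fintype.sum_option]
    simp only [Option.elim_none, Option.elim_some, Rat.smul_def]
    push_cast
    linarith) (some i)
  exact h7

/-- The matrix of `M_ξᵗ` on `E^s` in a basis. -/
theorem exists_matrix_stableSpace {n : ℕ} {v : Fin n → A → ℝ}
    (hdim : Module.finrank ℝ (stableSpace ξ) = n) (hv : ∀ i, v i ∈ stableSpace ξ)
    (hli : LinearIndependent ℝ v) :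
    ∃ H : Matrix (Fin n) (Fin n) ℝ, H.det = stableDet ξ ∧
      ∀ i, transposeMap ξ (v i) = ∑ j, H i j • v j := by
  let v' : Fin n → stableSpace ξ := fun i => ⟨v i, hv i⟩
  have hli' : LinearIndependent ℝ v' :=
    LinearIndependent.of_comp (stableSpace ξ).subtype hli
  have hspan := hli'.span_eq_top_of_card_eq_finrank' (by rw [hdim, Fintype.card_fin])
  let b := Module.Basis.mk hli' hspan.ge
  have hb : ∀ i, b i = v' i := fun i => by simp [b]
  let f := (transposeMap ξ).restrict (transposeMap_mem_stableSpace ξ)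
  refine ⟨(LinearMap.toMatrix b b f).transpose, ?_, fun i => ?_⟩
  · rw [Matrix.det_transpose, LinearMap.det_toMatrix]
    rfl
  · have h := b.sum_repr (f (b i))
    have h' := congrArg (stableSpace ξ).subtype h
    simp only [map_sum, map_smul, hb] at h'
    exact h'.symm.trans (Finset.sum_congr rfl fun j _ => by
      simp [LinearMap.toMatrix_apply, hb, v'])

end Splitting

/-! ### Measures on the torus and suspensions over a rotation -/

section Torus

variable {n : ℕ}

/-- The projection to the torus. -/
def torusMk (y : Fin n → ℝ) : UnitAddTorus (Fin n) := fun i => (y i : UnitAddCircle)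

theorem continuous_torusMk : Continuous (torusMk (n := n)) :=
  continuous_pi fun i => (AddCircle.continuous_mk' 1).comp (continuous_apply i)

theorem mFourier_torusMk (k : Fin n → ℤ) (y : Fin n → ℝ) :
    UnitAddTorus.mFourier k (torusMk y)
      = Complex.exp (2 * Real.pi * Complex.I * (∑ i, k i * y i : ℝ)) := by
  simp only [UnitAddTorus.mFourier, torusMk, ContinuousMap.coe_mk, fourier_coe_apply]
  rw [← Complex.exp_sum]
  congr 1
  push_cast
  rw [Finset.mul_sum]
  exact Finset.sum_congr rfl fun i _ => by rw [div_one]; ring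

/-- A finite measure on the torus is determined by its Fourier coefficients. -/
theorem torus_measure_ext {μ ν : Measure (UnitAddTorus (Fin n))} [IsFiniteMeasure μ]
    [IsFiniteMeasure ν] (h : ∀ k : Fin n → ℤ, ∫ t, UnitAddTorus.mFourier k t ∂μ
      = ∫ t, UnitAddTorus.mFourier k t ∂ν) : μ = ν := by
  have hint : ∀ (ρ : Measure (UnitAddTorus (Fin n))) [IsFiniteMeasure ρ]
      (f : C(UnitAddTorus (Fin n), ℂ)), Integrable f ρ := fun ρ _ f =>
    Integrable.of_bound f.continuous.aestronglyMeasurable ‖f‖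
      (Eventually.of_forall fun t => f.norm_coe_le_norm t)
  have hcont : ∀ (ρ : Measure (UnitAddTorus (Fin n))) [IsFiniteMeasure ρ],
      Continuous fun f : C(UnitAddTorus (Fin n), ℂ) => ∫ t, f t ∂ρ := by
    intro ρ _
    refine LipschitzWith.continuous (K := (ρ.real Set.univ).toNNReal)
      (LipschitzWith.of_dist_le_mul fun f g => ?_)
    rw [dist_eq_norm, dist_eq_norm, ← integral_sub (hint ρ f) (hint ρ g), 
      Real.coe_toNNReal _ measureReal_nonneg, mul_comm]
    exact norm_integral_le_of_norm_le_const
      (Eventually.of_forall fun t => (f - g).norm_coe_le_norm t)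
  -- Integration is continuous for the uniform norm and the trigonometric polynomials are dense.
  have hcl : ∀ f : C(UnitAddTorus (Fin n), ℂ), ∫ t, f t ∂μ = ∫ t, f t ∂ν := by
    intro f
    have hf : f ∈ (Submodule.span ℂ
        (Set.range (UnitAddTorus.mFourier (d := Fin n)))).topologicalClosure := by
      rw [UnitAddTorus.span_mFourier_closure_eq_top]; trivial
    refine closure_minimal (t := {f : C(UnitAddTorus (Fin n), ℂ) | ∫ t, f t ∂μ = ∫ t, f t ∂ν})
      ?_ (isClosed_eq (hcont μ) (hcont ν)) hf
    intro f hf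
    induction hf using Submodule.span_induction with
    | mem f hf => obtain ⟨k, rfl⟩ := hf; exact h k
    | zero => simp
    | add f g _ _ hf hg =>
      simp only [Set.mem_ofPred_eq, ContinuousMap.add_apply] at *
      rw [integral_add (hint μ f) (hint μ g), integral_add (hint ν f) (hint ν g), hf, hg]
    | smul c f _ hf =>
      simp only [Set.mem_ofPred_eq, ContinuousMap.smul_apply] at *
      rw [integral_smul, integral_smul, hf]
  refine ext_of_forall_integral_eq_of_IsFiniteMeasure fun f => ?_
  have := hcl ⟨fun t => (f t : ℂ), Complex.continuous_ofReal.comp f.continuous⟩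
  simp only [ContinuousMap.coe_mk] at this
  rw [integral_complex_ofReal, integral_complex_ofReal] at this
  exact_mod_cast this

/-- The uniform measure on the torus. -/
noncomputable def torusMeasure (n : ℕ) : Measure (UnitAddTorus (Fin n)) :=
  (volume.restrict (Set.univ.pi fun _ : Fin n => Set.Ioc (0 : ℝ) 1)).map torusMk

theorem volume_restrict_cube :
    (volume.restrict (Set.univ.pi fun _ : Fin n => Set.Ioc (0 : ℝ) 1))
      = Measure.pi fun _ : Fin n => (volume.restrict (Set.Ioc (0 : ℝ) 1)) := by
  rw [volume_pi, Measure.restrict_pi_pi]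

instance : IsProbabilityMeasure (volume.restrict (Set.Ioc (0 : ℝ) 1)) := ⟨by simp⟩

instance : IsProbabilityMeasure (torusMeasure n) := by
  unfold torusMeasure
  rw [volume_restrict_cube]
  exact Measure.isProbabilityMeasure_map continuous_torusMk.aemeasurable

theorem integral_mFourier_torusMeasure {k : Fin n → ℤ} (hk : k ≠ 0) :
    ∫ t, UnitAddTorus.mFourier k t ∂(torusMeasure n) = 0 := by
  obtain ⟨i, hi⟩ := Function.ne_iff.1 hk
  rw [torusMeasure, integral_map continuous_torusMk.aemeasurable
    (UnitAddTorus.mFourier k).continuous.aestronglyMeasurable, volume_restrict_cube]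
  simp only [UnitAddTorus.mFourier, torusMk, ContinuousMap.coe_mk]
  rw [integral_fintype_prod_eq_prod (fun i (t : ℝ) => fourier (k i) (t : UnitAddCircle))]
  refine Finset.prod_eq_zero (Finset.mem_univ i) ?_
  rw [← intervalIntegral.integral_of_le zero_le_one]
  have hc : (2 * Real.pi * Complex.I * k i : ℂ) ≠ 0 := by
    have : (k i : ℂ) ≠ 0 := by exact_mod_cast hi
    simp [Real.pi_ne_zero, Complex.I_ne_zero, this]
  have := integral_exp_mul_complex (a := 0) (b := 1) hc
  simp only [fourier_coe_apply, Complex.ofReal_one, div_one, this]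
  rw [div_eq_zero_iff]
  left
  rw [sub_eq_zero, Complex.ofReal_zero, mul_zero, Complex.exp_zero, mul_one, Complex.exp_eq_one_iff]
  exact ⟨k i, by ring⟩

/-- A measurable set of the torus is negligible if its preimage in the space is. -/
theorem exists_measurableSet_torus {N : Set (Fin n → ℝ)} (hN : volume N = 0) :
    ∃ P : Set (UnitAddTorus (Fin n)), MeasurableSet P ∧ torusMeasure n P = 0 ∧
      N ⊆ torusMk ⁻¹' P := by
  let N₁ := toMeasurable volume N
  -- The union of all integral translates is periodic, hence the preimage of a subset of the torus.
  let N₂ : Set (Fin n → ℝ) := ⋃ z : Fin n → ℤ, (fun y => y + fun i => (z i : ℝ)) ⁻¹' N₁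
  have h1 : MeasurableSet N₂ := MeasurableSet.iUnion fun z =>
    (measurable_add_const _) (measurableSet_toMeasurable _ _)
  have h2 : volume N₂ = 0 := by
    refine measure_iUnion_null fun z => ?_
    rw [measure_preimage_add_right, measure_toMeasurable, hN]
  have hper : ∀ (y : Fin n → ℝ) (z : Fin n → ℤ), (y + fun i => (z i : ℝ)) ∈ N₂ → y ∈ N₂ := by
    intro y z hy
    obtain ⟨w, hw⟩ := Set.mem_iUnion.1 hy
    refine Set.mem_iUnion.2 ⟨z + w, ?_⟩
    rw [Set.mem_preimage] at hw ⊢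
    convert hw using 1
    funext i; simp; ring
  let lift : UnitAddTorus (Fin n) → Fin n → ℝ :=
    fun t i => (AddCircle.measurableEquivIoc (1 : ℝ) 0 (t i) : ℝ)
  have hlift : Measurable lift := measurable_pi_lambda _ fun i =>
    measurable_subtype_coe.comp
      ((AddCircle.measurableEquivIoc (1 : ℝ) 0).measurable.comp (measurable_pi_apply i))
  have hz : ∀ y : Fin n → ℝ, ∃ z : Fin n → ℤ, y = lift (torusMk y) + fun i => (z i : ℝ) := by
    intro y
    have : ∀ i, ∃ z : ℤ, y i = lift (torusMk y) i + z := by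
      intro i
      have e : ((lift (torusMk y) i : ℝ) : UnitAddCircle) = (y i : UnitAddCircle) :=
        AddCircle.coe_equivIoc (p := (1 : ℝ)) (a := 0) (y := (y i : UnitAddCircle))
      rw [← sub_eq_zero, ← AddCircle.coe_sub, AddCircle.coe_eq_zero_iff] at e
      obtain ⟨z, hz⟩ := e
      refine ⟨-z, ?_⟩
      rw [zsmul_one] at hz
      push_cast; linarith
    choose z hz using this
    exact ⟨z, funext hz⟩
  have hmem : ∀ y, torusMk y ∈ lift ⁻¹' N₂ ↔ y ∈ N₂ := by
    intro y
    obtain ⟨z, hz⟩ := hz y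
    constructor
    · intro h
      refine hper y (-z) ?_
      have : y + (fun i => (((-z) i : ℤ) : ℝ)) = lift (torusMk y) := by
        conv_lhs => rw [hz]
        funext i; simp
      rw [this]; exact h
    · intro h
      rw [hz] at h
      exact hper _ _ h
  refine ⟨lift ⁻¹' N₂, hlift h1, ?_, ?_⟩
  · rw [torusMeasure, Measure.map_apply continuous_torusMk.measurable (hlift h1)]
    have : torusMk ⁻¹' (lift ⁻¹' N₂) = N₂ := Set.ext hmem
    rw [this]
    exact le_antisymm ((Measure.restrict_apply_le _ _).trans h2.le) zero_le
  · intro y hy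
    exact (hmem y).2 (Set.mem_iUnion.2 ⟨0, by
      simp only [Pi.zero_apply, Int.cast_zero, Set.mem_preimage]
      convert subset_toMeasurable volume N hy using 1
      funext i; simp⟩)

/-- A map which is equivariant, modulo integral vectors, between a system seen as the first return
system of a suspension and a totally irrational rotation has an absolutely continuous law. -/
theorem measure_preimage_eq_zero_of_rotation {X : Type*} [MeasurableSpace X] {μ : Measure X}
    [IsFiniteMeasure μ] {T : X → X} (hT : MeasurePreserving T μ μ) {g : X → Fin n → ℝ}
    (hg : Measurable g) {h : X → ℕ} (hh : Measurable h) {m : ℕ} (hle : ∀ x, h x ≤ m)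
    (hpos : ∀ x, 0 < h x) {α : Fin n → ℝ}
    (hα : ∀ k : Fin n → ℤ, k ≠ 0 → ∀ z : ℤ, ∑ i, k i * α i ≠ z)
    (hcoc : ∀ x i, ∃ z : ℤ, g (T x) i = g x i - h x * α i + z)
    {N : Set (Fin n → ℝ)} (hN : volume N = 0) : μ (g ⁻¹' N) = 0 := by
  let s : ℕ → Set X := fun j => {x | j < h x}
  have hs : ∀ j, MeasurableSet (s j) := fun j => hh (measurableSet_Ioi (a := j))
  let G : ℕ → X → UnitAddTorus (Fin n) := fun j x => torusMk (g x - (j : ℝ) • α)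
  have hG : ∀ j, Measurable (G j) := fun j =>
    continuous_torusMk.measurable.comp (hg.sub measurable_const)
  -- `ν` is the law, on the torus, of the map induced by `g` on the suspension of height `h`:
  -- climbing one floor subtracts `α`, and `hcoc` says that leaving the top floor is consistent with
  -- `g ∘ T`. Total irrationality then forces `ν` to be uniform.
  let ν : Measure (UnitAddTorus (Fin n)) :=
    ∑ j ∈ Finset.range m, (μ.restrict (s j)).map (G j)
  have hν : ν = ν Set.univ • torusMeasure n := by
    have hfin : IsFiniteMeasure (ν Set.univ • torusMeasure n) :=
      ⟨by simp [measure_lt_top ν Set.univ]⟩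
    refine torus_measure_ext fun k => ?_
    rw [integral_smul_measure]
    by_cases hk : k = 0
    · subst hk
      simp [UnitAddTorus.mFourier_zero, Measure.real]
    rw [integral_mFourier_torusMeasure hk, smul_zero]
    let e : (Fin n → ℝ) → ℂ := fun y => Complex.exp (2 * Real.pi * Complex.I * (∑ i, k i * y i : ℝ))
    have he : ∀ y, UnitAddTorus.mFourier k (torusMk y) = e y := mFourier_torusMk k
    have hadd : ∀ y y', e (y + y') = e y * e y' := fun y y' => by
      simp only [e, ← Complex.exp_add, Pi.add_apply, mul_add, Finset.sum_add_distrib,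
        Complex.ofReal_add]
    have hpow : ∀ j : ℕ, e (-((j : ℝ) • α)) = e (-α) ^ j := fun j => by
      simp only [e, ← Complex.exp_nat_mul]
      congr 1
      have : ∑ i, (k i : ℝ) * (-((j : ℝ) • α)) i = j * ∑ i, (k i : ℝ) * (-α) i := by
        rw [Finset.mul_sum]
        exact Finset.sum_congr rfl fun i _ => by simp; ring
      rw [this]; push_cast; ring
    have hint : ∀ z : Fin n → ℤ, e (fun i => (z i : ℝ)) = 1 := fun z => by
      rw [Complex.exp_eq_one_iff]
      exact ⟨∑ i, k i * z i, by push_cast; ring⟩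
    have hne : e (-α) - 1 ≠ 0 := by
      intro h0
      rw [sub_eq_zero, Complex.exp_eq_one_iff] at h0
      obtain ⟨z, hz⟩ := h0
      have h1 : (2 * Real.pi * Complex.I : ℂ) ≠ 0 := by
        simp [Real.pi_ne_zero, Complex.I_ne_zero]
      rw [mul_comm (z : ℂ)] at hz
      have h2 := mul_left_cancel₀ h1 hz
      have h3 : ∑ i, (k i : ℝ) * (-α) i = z := by exact_mod_cast h2
      refine hα k hk (-z) ?_
      push_cast
      rw [← h3, ← Finset.sum_neg_distrib]
      exact Finset.sum_congr rfl fun i _ => by simp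
    have hem : Continuous e := by fun_prop
    have hnorm : ∀ y, ‖e y‖ = 1 := fun y => by
      simp only [e]
      rw [show (2 * Real.pi * Complex.I * (∑ i, k i * y i : ℝ) : ℂ)
        = ((2 * Real.pi * ∑ i, k i * y i : ℝ) : ℂ) * Complex.I by push_cast; ring]
      exact Complex.norm_exp_ofReal_mul_I _
    have hTe : ∀ x, e (g (T x)) = e (g x) * e (-α) ^ h x := fun x => by
      choose z hz using hcoc x
      have : g (T x) = g x + (-((h x : ℝ) • α)) + fun i => (z i : ℝ) := by
        funext i
        simp only [hz i, Pi.add_apply, Pi.neg_apply, Pi.smul_apply, smul_eq_mul]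
        ring
      rw [this, hadd, hadd, hint, hpow, mul_one]
    have hI : ∀ f : X → ℂ, Measurable f → (∀ x, ‖f x‖ ≤ 1) → Integrable f μ := fun f hf hb =>
      Integrable.of_bound hf.aestronglyMeasurable 1 (Eventually.of_forall hb)
    have hterm : ∀ j, ∫ t, UnitAddTorus.mFourier k t ∂((μ.restrict (s j)).map (G j))
        = ∫ x, (s j).indicator (fun x => e (g x) * e (-α) ^ j) x ∂μ := fun j => by
      rw [integral_map (hG j).aemeasurable
        (UnitAddTorus.mFourier k).continuous.aestronglyMeasurable, integral_indicator (hs j)]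
      refine integral_congr_ae (Eventually.of_forall fun x => ?_)
      simp only [G, he, sub_eq_add_neg, hadd, hpow]
    have hmeas : ∀ j, Measurable ((s j).indicator fun x => e (g x) * e (-α) ^ j) := fun j =>
      ((hem.measurable.comp hg).mul measurable_const).indicator (hs j)
    have hbd : ∀ j x, ‖(s j).indicator (fun x => e (g x) * e (-α) ^ j) x‖ ≤ 1 := fun j x => by
      refine (norm_indicator_le_norm_self _ _).trans ?_
      rw [norm_mul, norm_pow, hnorm, hnorm, one_pow, mul_one]
    have hsum : ∀ x, ∑ j ∈ Finset.range m, (s j).indicator (fun x => e (g x) * e (-α) ^ j) x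
        = e (g x) * ∑ j ∈ Finset.range (h x), e (-α) ^ j := fun x => by
      rw [Finset.mul_sum, ← Finset.sum_subset (Finset.range_subset_range.2 (hle x))]
      · exact Finset.sum_congr rfl fun j hj =>
          Set.indicator_of_mem (show x ∈ s j from Finset.mem_range.1 hj) _
      · intro j _ hj
        exact Set.indicator_of_notMem (fun hx : x ∈ s j => hj (Finset.mem_range.2 hx)) _
    have hJ : ∫ t, UnitAddTorus.mFourier k t ∂ν
        = ∫ x, e (g x) * ∑ j ∈ Finset.range (h x), e (-α) ^ j ∂μ := by
      rw [integral_finsetSum_measure]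
      · simp only [hterm]
        rw [← integral_finsetSum _ fun j _ => hI _ (hmeas j) (hbd j)]
        simp only [hsum]
      · intro j _
        exact Integrable.of_bound (UnitAddTorus.mFourier k).continuous.aestronglyMeasurable 1
          (Eventually.of_forall fun t => ((UnitAddTorus.mFourier k).norm_coe_le_norm t).trans
            UnitAddTorus.mFourier_norm.le)
    -- The geometric sum over the floors telescopes to `e (g (T x)) - e (g x)`, whose integral
    -- vanishes by invariance of `μ`.
    have hzero : (∫ t, UnitAddTorus.mFourier k t ∂ν) * (e (-α) - 1) = 0 := by
      rw [hJ, ← integral_mul_const]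
      have : ∀ x, (e (g x) * ∑ j ∈ Finset.range (h x), e (-α) ^ j) * (e (-α) - 1)
          = e (g (T x)) - e (g x) := fun x => by
        rw [mul_assoc, geom_sum_mul, hTe]; ring
      simp only [this]
      have i1 : Integrable (fun x => e (g x)) μ :=
        hI _ (hem.measurable.comp hg) fun x => (hnorm _).le
      have i2 : Integrable (fun x => e (g (T x))) μ :=
        hI _ (hem.measurable.comp (hg.comp hT.measurable)) fun x => (hnorm _).le
      rw [integral_sub i2 i1]
      have h2 : ∫ x, e (g x) ∂(μ.map T) = ∫ x, e (g (T x)) ∂μ :=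
        integral_map hT.aemeasurable (hem.measurable.comp hg).aestronglyMeasurable
      rw [← h2, hT.map_eq, sub_self]
    exact (mul_eq_zero.1 hzero).resolve_right hne
  obtain ⟨P, hP, hP0, hNP⟩ := exists_measurableSet_torus hN
  have h1 : ν P = 0 := by rw [hν]; simp [hP0]
  rcases Nat.eq_zero_or_pos m with hm | hm
  · have : g ⁻¹' N = ∅ := Set.eq_empty_of_forall_notMem fun x _ => by
      have := hle x; have := hpos x; omega
    simp [this]
  -- The bottom floor is all of `X`, so the law of `g` modulo integers is dominated by `ν`.
  have h2 : (μ.restrict (s 0)).map (G 0) P = 0 := by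
    rw [Measure.finsetSum_apply, Finset.sum_eq_zero_iff] at h1
    exact h1 0 (Finset.mem_range.2 hm)
  have h3 : s 0 = Set.univ := Set.eq_univ_of_forall hpos
  rw [h3, Measure.restrict_univ, Measure.map_apply (hG 0) hP] at h2
  refine measure_mono_null (fun x hx => ?_) h2
  have := hNP hx
  simpa [G] using this

end Torus

/-! ### Absolute continuity of the law of `vecF` -/

section AbsolutelyContinuous

variable {A : Type*}

/-- The vector of the values of `F` at finitely many vectors. -/
def vecF (F : (A → ℝ) → (ℤ → A) → ℝ) {n : ℕ} (v : Fin n → A → ℝ) (x : ℤ → A) : Fin n → ℝ :=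
  fun i => F (v i) x

/-- The vector of the sums of finitely many vectors along a word. -/
def vecSum {n : ℕ} (v : Fin n → A → ℝ) (u : List A) : Fin n → ℝ := fun i => wordSum (v i) u

variable [Fintype A] [DecidableEq A] [TopologicalSpace A] {ξ : A → List A}
  {F : (A → ℝ) → (ℤ → A) → ℝ} {C : ℝ} {n : ℕ} {v : Fin n → A → ℝ}
  {H : Matrix (Fin n) (Fin n) ℝ}

omit [TopologicalSpace A] in
theorem transposeMap_pow_eq_sum (hH : ∀ i, transposeMap ξ (v i) = ∑ j, H i j • v j) (m : ℕ)
    (i : Fin n) : (transposeMap ξ ^ m) (v i) = ∑ j, (H ^ m) i j • v j := by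
  induction m generalizing i with
  | zero => simp [Matrix.one_apply]
  | succ m ih =>
    rw [pow_succ', Module.End.mul_apply, ih, map_sum]
    simp only [map_smul, hH, Finset.smul_sum, pow_succ, Matrix.mul_apply, Finset.sum_smul,
      smul_smul]
    rw [Finset.sum_comm]

theorem IsTransfer.vecF_seqMap (hF : IsTransfer ξ F C) (hξ : ∀ a, ξ a ≠ [])
    (hv : ∀ i, v i ∈ stableSpace ξ) (hH : ∀ i, transposeMap ξ (v i) = ∑ j, H i j • v j)
    {x : ℤ → A} (hx : x ∈ Omega ξ) (m : ℕ) :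
    vecF F v ((SubstShift.seqMap ξ)^[m] x) = (H ^ m).mulVec (vecF F v x) := by
  funext i
  simp only [vecF]
  rw [hF.seqMap_iterate hξ (hv i) hx, transposeMap_pow_eq_sum hH, hF.sum _ _ _ hv hx]
  rfl

theorem IsTransfer.vecF_shiftZ (hF : IsTransfer ξ F C) (hv : ∀ i, v i ∈ stableSpace ξ)
    {x : ℤ → A} (hx : x ∈ Omega ξ) (k : ℕ) :
    vecF F v (SubstShift.shiftZ k x) = vecF F v x - vecSum v (factor x 0 k) := by
  funext i
  exact hF.shift_natCast (hv i) hx k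

theorem IsTransfer.continuousOn_vecF (hF : IsTransfer ξ F C) (hv : ∀ i, v i ∈ stableSpace ξ) :
    ContinuousOn (vecF F v) (Omega ξ) :=
  continuousOn_pi.2 fun i => hF.continuousOn _ (hv i)

omit [Fintype A] [DecidableEq A] [TopologicalSpace A] in
theorem sum_intCast_mul_ne {α : Fin n → ℝ}
    (hindep : LinearIndependent ℚ (fun o : Option (Fin n) => o.elim (1 : ℝ) α)) {k : Fin n → ℤ}
    (hk : k ≠ 0) (z : ℤ) : ∑ i, k i * α i ≠ z := by
  intro h
  rw [Fintype.linearIndependent_iff] at hindep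
  refine hk (funext fun i => ?_)
  have := hindep (fun o => o.elim (-z : ℚ) fun i => (k i : ℚ)) (by
    rw [Fintype.sum_option]
    simp only [Option.elim_none, Option.elim_some, Rat.smul_def]
    push_cast
    rw [h]; ring) (some i)
  simpa using this

/-- The coordinates of `M^m v(i)` are `α i |ξᵐ(a)|` up to integers, so `H ^ m` applied to `vecF` is
equivariant over the suspension of height `|ξᵐ(x 0)|`. The null set `N` is replaced by its image
under `H ^ m`, again null. -/
theorem IsTransfer.measure_vecF_preimage_eq_zero [DiscreteTopology A] [MeasurableSpace A]
    [MeasurableSingletonClass A] (hF : IsTransfer ξ F C) (hξ : ∀ a, ξ a ≠ [])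
    {μ : Measure (Omega ξ)} [IsProbabilityMeasure μ]
    (hμ : MeasurePreserving (shiftOmega ξ) μ μ) {α : Fin n → ℝ} (hv : IsSplitting ξ α v)
    (hindep : LinearIndependent ℚ (fun o : Option (Fin n) => o.elim (1 : ℝ) α))
    (hH : ∀ i, transposeMap ξ (v i) = ∑ j, H i j • v j) {N : Set (Fin n → ℝ)}
    (hN : volume N = 0) : μ {x | vecF F v x ∈ N} = 0 := by
  have hvs : ∀ i, v i ∈ stableSpace ξ := fun i => (hv i).1
  obtain ⟨m, z, hz⟩ := hv.exists_int
  obtain ⟨r, hr⟩ := exists_length_le (iter ξ m)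
  let g : Omega ξ → Fin n → ℝ := fun x => (H ^ m).mulVec (vecF F v x)
  have hcont : Continuous fun x : Omega ξ => vecF F v x :=
    continuousOn_iff_continuous_domRestrict.1 (hF.continuousOn_vecF hvs)
  have hg : Measurable g :=
    ((Matrix.mulVecLin (H ^ m)).continuous_of_finiteDimensional.comp hcont).measurable
  have hg' : ∀ (x : Omega ξ) i, g x i = F ((transposeMap ξ ^ m) (v i)) x := fun x i => by
    rw [transposeMap_pow_eq_sum hH, hF.sum _ _ _ hvs x.2]
    rfl
  have h0 : volume ((H ^ m).mulVecLin '' N) = 0 := by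
    rw [Measure.addHaar_image_linearMap, hN, mul_zero]
  refine measure_mono_null (fun x hx => ?_) (measure_preimage_eq_zero_of_rotation hμ hg
    (h := fun x => (iter ξ m (x.1 0)).length) ?_ (fun x => hr _)
    (fun x => List.length_pos_iff.2 (iter_ne_nil hξ m _))
    (fun k hk => sum_intCast_mul_ne hindep hk) ?_ h0)
  · exact ⟨_, hx, rfl⟩
  · exact (Measurable.of_discrete (f := fun a => (iter ξ m a).length)).comp
      ((measurable_pi_apply 0).comp measurable_subtype_coe)
  · intro x i
    refine ⟨z i (x.1 0), ?_⟩
    rw [hg', hg']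
    have := hF.shift _ (transposeMap_pow_mem_stableSpace (hvs i) m) x x.2
    change F _ (SubstShift.shiftZ 1 x) = _
    rw [this, hz]
    ring

end AbsolutelyContinuous

/-! ### Almost periods of length `|ξⁿ(b)|` -/

section Eigenvalue

variable {A : Type*} {ξ : A → List A}

theorem coe_shiftOmega_iterate (j : ℕ) (x : Omega ξ) :
    ((shiftOmega ξ)^[j] x : ℤ → A) = shiftZ j x := by
  induction j with
  | zero => simp
  | succ j ih =>
    rw [Function.iterate_succ_apply']
    change shiftZ 1 ((shiftOmega ξ)^[j] x : ℤ → A) = _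
    rw [ih, shiftZ_shiftZ]
    congr 1; push_cast; ring

/-- Uniform continuity: counterexamples for all `L` would accumulate, by compactness, at a pair of
equal points. -/
theorem exists_agree_imp_norm_sub_le [Finite A] [TopologicalSpace A] [DiscreteTopology A]
    {g : Omega ξ → ℂ} (hg : Continuous g) {ε : ℝ} (hε : 0 < ε) :
    ∃ L : ℕ, ∀ x y : Omega ξ, (∀ i : ℤ, -L ≤ i → i ≤ L → x.1 i = y.1 i) → ‖g x - g y‖ ≤ ε := by
  have : CompactSpace (Omega ξ) := isCompact_iff_compactSpace.1 isCompact_Omega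
  by_contra! hcon
  let K : ℕ → Set (Omega ξ × Omega ξ) := fun L =>
    {p | (∀ i : ℤ, -L ≤ i → i ≤ L → p.1.1 i = p.2.1 i) ∧ ε ≤ ‖g p.1 - g p.2‖}
  have hK : ∀ L, IsClosed (K L) := by
    intro L
    refine IsClosed.inter ?_ (isClosed_le continuous_const
      ((hg.comp continuous_fst).sub (hg.comp continuous_snd)).norm)
    have : {p : Omega ξ × Omega ξ | ∀ i : ℤ, -L ≤ i → i ≤ L → p.1.1 i = p.2.1 i}
        = ⋂ (i : ℤ) (_ : -(L : ℤ) ≤ i) (_ : i ≤ L), {p | p.1.1 i = p.2.1 i} := by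
      ext p; simp
    change IsClosed {p : Omega ξ × Omega ξ | ∀ i : ℤ, -L ≤ i → i ≤ L → p.1.1 i = p.2.1 i}
    rw [this]
    refine isClosed_iInter fun i => isClosed_iInter fun _ => isClosed_iInter fun _ => ?_
    exact isClosed_eq ((continuous_apply i).comp (continuous_subtype_val.comp continuous_fst))
      ((continuous_apply i).comp (continuous_subtype_val.comp continuous_snd))
  obtain ⟨p, hp⟩ := IsCompact.nonempty_iInter_of_sequence_nonempty_isCompact_isClosed K
    (fun L p hp => ⟨fun i h1 h2 => hp.1 i (by push_cast; omega) (by push_cast; omega), hp.2⟩)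
    (fun L => by
      obtain ⟨x, y, h1, h2⟩ := hcon L
      exact ⟨(x, y), h1, h2.le⟩) (hK 0).isCompact hK
  rw [Set.mem_iInter] at hp
  have heq : p.1 = p.2 := Subtype.ext (funext fun i => (hp i.natAbs).1 i (by omega) (by omega))
  have := (hp 0).2
  rw [heq, sub_self, norm_zero] at this
  linarith

variable [Fintype A] [DecidableEq A]

/-- By primitivity `ξⁿ(l)` contains every `ξⁿ⁻ᵏ(c)`, and `ξⁿ⁺¹(a)` consists of `|ξᵏ⁺¹(a)|` such
words, a number bounded independently of `n`. -/
theorem exists_length_iter_le (hprim : (incidence ξ).IsPrimitive) (l : A) :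
    ∃ B : ℕ, ∀ᶠ n in atTop, ∀ a, (iter ξ (n + 1) a).length ≤ B * (iter ξ n l).length := by
  obtain ⟨k, hk⟩ := exists_forall_mem_iter hprim
  obtain ⟨B, hB⟩ := exists_length_le (iter ξ (k + 1))
  refine ⟨B, ?_⟩
  filter_upwards [eventually_ge_atTop k] with n hn a
  obtain ⟨r, rfl⟩ := Nat.exists_eq_add_of_le' hn
  have h1 : ∀ c, (iter ξ r c).length ≤ (iter ξ (r + k) l).length := by
    intro c
    obtain ⟨s, t, h⟩ := List.append_of_mem (hk c l)
    rw [iter_add, h]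
    simp; omega
  have h2 : ∀ u : List A, (u.flatMap (iter ξ r)).length
      ≤ u.length * (iter ξ (r + k) l).length := by
    intro u
    induction u with
    | nil => simp
    | cons c u ih =>
      have := h1 c
      rw [List.flatMap_cons, List.length_append, List.length_cons, add_mul]
      omega
  rw [add_assoc, iter_add]
  exact (h2 _).trans (Nat.mul_le_mul_right _ (hB a))

/-- The places where a point agrees on a large window with its shift by `|ξⁿ⁺¹(b)|` have a lower
density bounded from below. -/
theorem exists_card_agree [TopologicalSpace A] [DiscreteTopology A]
    (hprim : (incidence ξ).IsPrimitive) (hsub : IsSubstitution ξ)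
    (hproper : IsProper ξ) (b : A) :
    ∃ D : ℕ, ∀ L : ℕ, ∀ᶠ n in atTop, ∃ R κ : ℕ, 0 < κ ∧ R ≤ D * κ ∧ ∀ x ∈ Omega ξ,
      ∃ p : ℕ, ∀ j ∈ Finset.Ico p (p + κ), j < R ∧ ∀ i : ℤ, -L ≤ i → i ≤ L →
        x (i + j) = x (i + (j + (iter ξ (n + 1) b).length)) := by
  have hξ := hproper.ne_nil
  obtain ⟨⟨l, hl⟩, -⟩ := hproper
  obtain ⟨B, hB⟩ := exists_length_iter_le hprim l
  obtain ⟨r, hr⟩ := exists_gap hprim (singleton_mem_language (ξ := ξ) b)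
  refine ⟨2 * ((r + 2) * B), fun L => ?_⟩
  -- With `q = |ξⁿ(l)|` this yields `q ≤ 2 * (q - 2 * L)`: in a matching stretch of length `q`, at
  -- least half of the places are centres of matching windows of radius `L`.
  have hlim : ∀ᶠ n in atTop, 4 * L + 1 ≤ (iter ξ n l).length :=
    (hsub.2 l).eventually_ge_atTop (4 * L + 1)
  filter_upwards [hB, hlim] with n hn hq
  set q := (iter ξ n l).length with hqdef
  refine ⟨(r + 2) * (B * q), q - 2 * L, by omega, ?_, fun x hx => ?_⟩
  · calc (r + 2) * (B * q) = ((r + 2) * B) * q := by ring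
      _ ≤ ((r + 2) * B) * (2 * (q - 2 * L)) := Nat.mul_le_mul_left _ (by omega)
      _ = _ := by ring
  obtain ⟨y, hy, k, hk, rfl⟩ := exists_eq_shiftZ_seqMap hprim hξ (n + 1) hx
  obtain ⟨s, hs, hsb⟩ := hr y hy 1
  simp only [List.length_singleton] at hs hsb
  have hyb : y (1 + s) = b := by simpa [factor_eq_map] using hsb
  have hz := isConcat_seqMap_iterate hξ (n + 1) y
  set z := (seqMap ξ)^[n + 1] y with hzdef
  set c := cut (iter ξ (n + 1)) y with hc
  -- Every `ξ(a)` begins with `l`, so every block `ξⁿ⁺¹(y i)` begins with `ξⁿ(l)`. A block `ξⁿ⁺¹(b)`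
  -- and its successor therefore begin with the same `q` letters, at distance `|ξⁿ⁺¹(b)|`.
  have hpre : ∀ i : ℤ, ∀ t : ℕ, t < q → some (z (c i + t)) = (iter ξ n l)[t]? := by
    intro i t ht
    obtain ⟨w, hw⟩ : ∃ w, ξ (y i) = l :: w := by
      have := hl (y i)
      cases h : ξ (y i) with
      | nil => simp [h] at this
      | cons a w => simp [h] at this; exact ⟨w, by rw [this]⟩
    have e : iter ξ (n + 1) (y i) = iter ξ n l ++ w.flatMap (iter ξ n) := by
      rw [iter_add, iter_one, hw, List.flatMap_cons]
    have hlen : t < (iter ξ (n + 1) (y i)).length := by rw [e, List.length_append]; omega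
    change some (z (cut (iter ξ (n + 1)) y i + t)) = _
    have h1 := hz.apply_eq (i := i) (p := cut (iter ξ (n + 1)) y i + t) (by omega) (by
      rw [cut_add_one]; omega)
    rw [← h1, e, show (cut (iter ξ (n + 1)) y i + (t : ℤ)
        - cut (iter ξ (n + 1)) y i).toNat = t by omega,
      List.getElem?_append_left (by omega)]
  have hmono := cut_strictMono (iter_ne_nil hξ (n + 1)) y
  have hc1 : c 1 = (iter ξ (n + 1) (y 0)).length := by
    have := cut_add_one (iter ξ (n + 1)) y 0
    simpa using this
  have hcs : c 1 ≤ c (1 + s) := hmono.monotone (by omega)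
  have hcub : ∀ j : ℕ, c j ≤ j * (B * q : ℕ) := by
    intro j
    induction j with
    | zero => simp [hc]
    | succ j ih =>
      have e := cut_add_one (iter ξ (n + 1)) y j
      have h2 := hn (y j)
      have h3 : ((j + 1 : ℕ) : ℤ) * ((B * q : ℕ) : ℤ) = j * ((B * q : ℕ) : ℤ) + (B * q : ℕ) := by
        push_cast; ring
      rw [h3]
      change cut _ y ((j : ℤ) + 1) ≤ _
      rw [e]
      have h4 : (((iter ξ (n + 1) (y j)).length : ℕ) : ℤ) ≤ ((B * q : ℕ) : ℤ) := by
        exact_mod_cast h2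
      change c j + _ ≤ _
      omega
  have hstep : c (1 + s + 1) = c (1 + s) + (iter ξ (n + 1) b).length := by
    rw [hc, cut_add_one, hyb]
  have hqle : q ≤ (iter ξ (n + 1) b).length := by
    have := hl b
    cases h : ξ b with
    | nil => simp [h] at this
    | cons a w =>
      simp [h] at this
      rw [iter_add, iter_one, h, this, List.flatMap_cons, List.length_append]
      omega
  have hbound : c (1 + s + 1) ≤ ((r + 2) * (B * q) : ℕ) := by
    have h2 := hcub (1 + s + 1)
    have h3 : (1 + s + 1) * (B * q) ≤ (r + 2) * (B * q) := Nat.mul_le_mul_right _ (by omega)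
    have h4 : (((1 + s + 1) * (B * q) : ℕ) : ℤ) ≤ ((r + 2) * (B * q) : ℕ) := by exact_mod_cast h3
    push_cast at h2 h4 ⊢
    linarith
  refine ⟨(c (1 + s) - k).toNat + L, fun j hj => ?_⟩
  rw [Finset.mem_Ico] at hj
  refine ⟨?_, fun i hi1 hi2 => ?_⟩
  · zify at hbound ⊢
    omega
  · obtain ⟨t, ht⟩ : ∃ t : ℕ, (t : ℤ) = i + j + k - c (1 + s) :=
      ⟨(i + j + k - c (1 + s)).toNat, by omega⟩
    have htq : t < q := by omega
    have h1 := hpre (1 + s) t htq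
    have h2 := hpre (1 + s + 1) t htq
    rw [← h2, hstep] at h1
    simp only [shiftZ_apply]
    have h3 := Option.some.inj h1
    rw [show i + (j : ℤ) + k = c (1 + s) + t by omega,
      show i + ((j : ℤ) + ((iter ξ (n + 1) b).length : ℤ)) + k
        = c (1 + s) + ((iter ξ (n + 1) b).length : ℤ) + t by omega]
    exact h3

end Eigenvalue

/-! ### Convergence of the powers of an eigenvalue along the lengths -/

section Eigenvalue

variable {A : Type*} {ξ : A → List A}

theorem integral_comp_eq {X G : Type*} [MeasurableSpace X] [NormedAddCommGroup G]
    [NormedSpace ℝ G] {μ : Measure X} {S : X → X} (hS : MeasurePreserving S μ μ) {g : X → G}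
    (hg : AEStronglyMeasurable g μ) : ∫ x, g (S x) ∂μ = ∫ x, g x ∂μ := by
  have := integral_map hS.aemeasurable (f := g) (by rwa [hS.map_eq])
  rw [← this, hS.map_eq]

/-- Every orbit segment of length `R` meets `E` at least `κ` times. Averaging along it, with `φ`
constant on orbits, shows that `E` carries at least the fraction `κ / R` of the integral of `φ`. -/
theorem integral_mul_card_le {X : Type*} [MeasurableSpace X] {μ : Measure X}
    {S : X → X} (hS : MeasurePreserving S μ μ) {φ : X → ℝ} (hφ : Integrable φ μ)
    (hφ0 : ∀ x, 0 ≤ φ x) (hinv : ∀ᵐ x ∂μ, φ (S x) = φ x) {E : Set X} (hE : MeasurableSet E)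
    {R κ : ℕ} (h : ∀ x, ∃ p : ℕ, ∀ j ∈ Finset.Ico p (p + κ), j < R ∧ S^[j] x ∈ E) :
    κ * ∫ x, φ x ∂μ ≤ R * ∫ x in E, φ x ∂μ := by
  have hinv' : ∀ j : ℕ, ∀ᵐ x ∂μ, φ (S^[j] x) = φ x := by
    intro j
    induction j with
    | zero => simp
    | succ j ih =>
      filter_upwards [ih, (hS.iterate j).quasiMeasurePreserving.ae hinv] with x h1 h2
      rw [Function.iterate_succ_apply', h2, h1]
  have hint : Integrable (E.indicator φ) μ := hφ.indicator hE
  have hj : ∀ j : ℕ, ∫ x, E.indicator φ (S^[j] x) ∂μ = ∫ x in E, φ x ∂μ := fun j => by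
    rw [← integral_indicator hE]
    exact integral_comp_eq (hS.iterate j) hint.aestronglyMeasurable
  have hij : ∀ j, Integrable (fun x => E.indicator φ (S^[j] x)) μ := fun j =>
    (hS.iterate j).integrable_comp_of_integrable hint
  calc κ * ∫ x, φ x ∂μ = ∫ x, κ * φ x ∂μ := (integral_const_mul _ _).symm
    _ ≤ ∫ x, ∑ j ∈ Finset.range R, E.indicator φ (S^[j] x) ∂μ := by
        refine integral_mono_ae (hφ.const_mul _) (integrable_finsetSum _ fun j _ => hij j) ?_
        filter_upwards [ae_all_iff.2 hinv'] with x hx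
        obtain ⟨p, hp⟩ := h x
        calc (κ : ℝ) * φ x = ∑ j ∈ Finset.Ico p (p + κ), φ x := by simp
          _ = ∑ j ∈ Finset.Ico p (p + κ), E.indicator φ (S^[j] x) :=
              Finset.sum_congr rfl fun j hj => by
                rw [Set.indicator_of_mem (hp j hj).2, hx j]
          _ ≤ _ := Finset.sum_le_sum_of_subset_of_nonneg
              (fun j hj => Finset.mem_range.2 (hp j hj).1)
              fun j _ _ => Set.indicator_nonneg (fun x _ => hφ0 x) _
    _ = R * ∫ x in E, φ x ∂μ := by
        rw [integral_finsetSum _ fun j _ => hij j]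
        simp [hj]

/-- The eigenvalues of the subshift satisfy Host's condition on the lengths of the words
`ξⁿ(b)`. -/
theorem IsSystemEigenvalue.tendsto_pow_length [Fintype A] [DecidableEq A] [TopologicalSpace A]
    [DiscreteTopology A] [MeasurableSpace A] [MeasurableSingletonClass A]
    (hprim : (incidence ξ).IsPrimitive) (hsub : IsSubstitution ξ) (hproper : IsProper ξ)
    {μ : Measure (Omega ξ)} [IsProbabilityMeasure μ]
    (hμ : MeasurePreserving (shiftOmega ξ) μ μ) {c : ℂ} (hc : ‖c‖ = 1)
    (h : IsSystemEigenvalue μ (shiftOmega ξ) c) (b : A) :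
    Tendsto (fun n => c ^ (iter ξ n b).length) atTop (𝓝 1) := by
  obtain ⟨f, hf2, hf0, hfc⟩ := h
  have hf : Integrable f μ := hf2.integrable (by norm_num)
  have hφinv : ∀ᵐ x ∂μ, ‖f (shiftOmega ξ x)‖ = ‖f x‖ := by
    filter_upwards [hfc] with x hx
    rw [hx, norm_mul, hc, one_mul]
  have hI : 0 < ∫ x, ‖f x‖ ∂μ := by
    rw [integral_pos_iff_support_of_nonneg (fun x => norm_nonneg _) hf.norm]
    rw [pos_iff_ne_zero]
    intro h0
    refine hf0 ?_
    rw [Filter.EventuallyEq, ae_iff]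
    simpa [Function.support] using h0
  have hfc' : ∀ j : ℕ, ∀ᵐ x ∂μ, f ((shiftOmega ξ)^[j] x) = c ^ j * f x := by
    intro j
    induction j with
    | zero => simp
    | succ j ih =>
      filter_upwards [ih, (hμ.iterate j).quasiMeasurePreserving.ae hfc] with x h1 h2
      rw [Function.iterate_succ_apply', h2, h1, pow_succ']; ring
  obtain ⟨D, hD⟩ := exists_card_agree hprim hsub hproper b
  rw [← tendsto_add_atTop_iff_nat 1, Metric.tendsto_nhds]
  intro δ hδ
  set I := ∫ x, ‖f x‖ ∂μ with hIdef
  -- On the set `E` of points agreeing with their shift by `ℓ` on a large window, a continuous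
  -- approximation `g` of `f` hardly changes under that shift, while `f` is multiplied by `c ^ ℓ`.
  -- The total error is `3 * ε`, and `E` carries at least `1 / D` of `I`; this choice makes `D * (3
  -- * ε) < δ * I`.
  set ε : ℝ := δ * I / (3 * (D + 1)) with hε
  have hε0 : 0 < ε := by positivity
  obtain ⟨g, hg, hgi⟩ := hf.exists_boundedContinuous_integral_sub_le hε0
  obtain ⟨L, hL⟩ := exists_agree_imp_norm_sub_le g.continuous hε0
  filter_upwards [hD L] with n ⟨R, κ, hκ, hRκ, hx⟩
  set ℓ := (iter ξ (n + 1) b).length with hℓ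
  let E : Set (Omega ξ) := {x | ∀ i : ℤ, -L ≤ i → i ≤ L → x.1 i = x.1 (i + ℓ)}
  have hE : MeasurableSet E := by
    have : E = ⋂ (i : ℤ) (_ : -(L : ℤ) ≤ i) (_ : i ≤ L), {x : Omega ξ | x.1 i = x.1 (i + ℓ)} := by
      ext p; simp [E]
    rw [this]
    refine MeasurableSet.iInter fun i => MeasurableSet.iInter fun _ => MeasurableSet.iInter fun _ =>
      ?_
    exact measurableSet_eq_fun ((measurable_pi_apply i).comp measurable_subtype_coe)
      ((measurable_pi_apply (i + (ℓ : ℤ))).comp measurable_subtype_coe)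
  have h1 : κ * I ≤ R * ∫ x in E, ‖f x‖ ∂μ := by
    refine integral_mul_card_le hμ hf.norm (fun x => norm_nonneg _) hφinv hE fun x => ?_
    obtain ⟨p, hp⟩ := hx x x.2
    refine ⟨p, fun j hj => ⟨(hp j hj).1, fun i h1 h2 => ?_⟩⟩
    rw [coe_shiftOmega_iterate, shiftZ_apply, shiftZ_apply]
    exact ((hp j hj).2 i h1 h2).trans (congrArg x.1 (by ring))
  have hEpos : 0 ≤ ∫ x in E, ‖f x‖ ∂μ := integral_nonneg fun x => norm_nonneg _
  have h2 : I ≤ D * ∫ x in E, ‖f x‖ ∂μ := by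
    have h3 : (R : ℝ) ≤ D * κ := by exact_mod_cast hRκ
    have h4 : (0 : ℝ) < κ := by exact_mod_cast hκ
    have h5 : (R : ℝ) * ∫ x in E, ‖f x‖ ∂μ ≤ (D * κ) * ∫ x in E, ‖f x‖ ∂μ := by gcongr
    refine le_of_mul_le_mul_left (h1.trans (h5.trans (le_of_eq ?_))) h4
    ring
  let S := (shiftOmega ξ)^[ℓ]
  have hS : MeasurePreserving S μ μ := hμ.iterate ℓ
  have hfg : Integrable (fun x => ‖f x - g x‖) μ := (hf.sub hgi).norm
  have hfgS : Integrable (fun x => ‖f (S x) - g (S x)‖) μ :=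
    hS.integrable_comp_of_integrable hfg
  have h3 : ‖c ^ ℓ - 1‖ * ∫ x in E, ‖f x‖ ∂μ ≤ 3 * ε := by
    rw [← integral_const_mul]
    calc ∫ x in E, ‖c ^ ℓ - 1‖ * ‖f x‖ ∂μ
        ≤ ∫ x in E, (‖f (S x) - g (S x)‖ + ε + ‖f x - g x‖) ∂μ := by
          refine integral_mono_ae (hf.norm.const_mul _).integrableOn
            ((hfgS.add (integrable_const ε)).add hfg).integrableOn ?_
          filter_upwards [ae_restrict_of_ae (hfc' ℓ), ae_restrict_mem hE] with x h4 h5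
          have h6 : ‖g (S x) - g x‖ ≤ ε := hL _ _ fun i a1 a2 => by
            rw [coe_shiftOmega_iterate, shiftZ_apply, (h5 i a1 a2)]
          have h7 : (c ^ ℓ - 1) * f x
              = (f (S x) - g (S x)) + (g (S x) - g x) - (f x - g x) := by
            change f (S x) = _ at h4
            rw [h4]; ring
          rw [← norm_mul, h7]
          refine (norm_sub_le _ _).trans ?_
          gcongr
          exact (norm_add_le _ _).trans (by gcongr)
      _ ≤ ∫ x, (‖f (S x) - g (S x)‖ + ε + ‖f x - g x‖) ∂μ :=
          setIntegral_le_integral ((hfgS.add (integrable_const ε)).add hfg)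
            (Eventually.of_forall fun x => by positivity)
      _ = ∫ x, ‖f (S x) - g (S x)‖ ∂μ + ε + ∫ x, ‖f x - g x‖ ∂μ := by
          have hS2 : Integrable (fun x => ‖f (S x) - g (S x)‖ + ε) μ :=
            hfgS.add (integrable_const ε)
          rw [integral_add hS2 hfg,
            integral_add hfgS (integrable_const ε)]
          simp
      _ ≤ 3 * ε := by
          have := integral_comp_eq hS hfg.aestronglyMeasurable
          rw [this]
          linarith
  rw [dist_eq_norm]
  have h4 : ‖c ^ ℓ - 1‖ * I ≤ D * (3 * ε) :=
    calc ‖c ^ ℓ - 1‖ * I ≤ ‖c ^ ℓ - 1‖ * (D * ∫ x in E, ‖f x‖ ∂μ) := by gcongr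
      _ = D * (‖c ^ ℓ - 1‖ * ∫ x in E, ‖f x‖ ∂μ) := by ring
      _ ≤ D * (3 * ε) := by gcongr
  have h5 : (D : ℝ) * (3 * ε) < δ * I := by
    have : (D : ℝ) * (3 * ε) = δ * I * (D / (D + 1)) := by rw [hε]; field_simp
    rw [this]
    refine mul_lt_of_lt_one_right (by positivity) ?_
    rw [div_lt_one (by positivity)]
    linarith
  exact lt_of_mul_lt_mul_right (h4.trans_lt h5) hI.le

end Eigenvalue

/-! ### Existence of the vectors `v(i)` -/

section ExistsSplitting

/-- Jordan's inequality for the sine, after replacing `t` by its signed distance to the nearest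
integer. -/
theorem four_mul_abs_sub_round_le (t : ℝ) :
    4 * |t - round t| ≤ ‖Complex.exp (2 * Real.pi * Complex.I * t) - 1‖ := by
  set s := t - round t with hs
  have h1 : Complex.exp (2 * Real.pi * Complex.I * t)
      = Complex.exp (Complex.I * ((2 * Real.pi * s : ℝ) : ℂ)) := by
    rw [Complex.exp_eq_exp_iff_exists_int]
    exact ⟨round t, by rw [hs]; push_cast; ring⟩
  have h2 : |s| ≤ 1 / 2 := abs_sub_round t
  have h3 := Real.mul_abs_le_abs_sin (x := Real.pi * s) (by
    rw [abs_mul, abs_of_pos Real.pi_pos]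
    nlinarith [Real.pi_pos])
  rw [h1, Complex.norm_exp_I_mul_ofReal_sub_one, Real.norm_eq_abs, abs_mul, abs_two,
    show 2 * Real.pi * s / 2 = Real.pi * s by ring]
  rw [abs_mul, abs_of_pos Real.pi_pos, ← mul_assoc, div_mul_cancel₀ _ Real.pi_ne_zero] at h3
  linarith

theorem norm_exp_two_pi_I_mul (t : ℝ) : ‖Complex.exp (2 * Real.pi * Complex.I * t)‖ = 1 := by
  rw [show (2 * Real.pi * Complex.I * t : ℂ) = ((2 * Real.pi * t : ℝ) : ℂ) * Complex.I by
    push_cast; ring]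
  exact Complex.norm_exp_ofReal_mul_I _

variable {A : Type*} [Fintype A] [DecidableEq A] {ξ : A → List A}

/-- On the contracted space, the ranges of the powers of `M_ξᵗ` decrease to `E^s`. -/
theorem exists_mem_stableSpace_pow_eq {e : A → ℝ} (he : e ∈ contracted ξ) (m : ℕ) :
    ∃ N, ∃ v ∈ stableSpace ξ, (transposeMap ξ ^ (m + N)) v = (transposeMap ξ ^ N) e := by
  have hmem : ∀ v ∈ contracted ξ, transposeMap ξ v ∈ contracted ξ := by
    intro v hv
    have h : Tendsto (fun k : ℕ => (transposeMap ξ ^ (k + 1)) v) atTop (𝓝 0) :=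
      (tendsto_add_atTop_iff_nat 1).2 hv
    refine h.congr fun k => ?_
    rw [pow_succ]; rfl
  let f := (transposeMap ξ).restrict hmem
  have hf : ∀ (k : ℕ) (v : contracted ξ), ((f ^ k) v : A → ℝ) = (transposeMap ξ ^ k) v := by
    intro k v
    induction k with
    | zero => simp
    | succ k ih =>
      rw [pow_succ', pow_succ', Module.End.mul_apply, Module.End.mul_apply, ← ih]
      rfl
  -- From exponent `N` on the ranges are stationary, so `f ^ N` maps into the stable range. Writing
  -- `f ^ N e` as `f ^ (m + N) (f ^ N u)` puts the preimage `f ^ N u` inside `E^s`.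
  obtain ⟨N, hN⟩ := eventually_atTop.1 f.eventually_iInf_range_pow_eq
  have hr : ∀ k ≥ N, LinearMap.range (f ^ k) = LinearMap.range (f ^ N) := fun k hk => by
    rw [← hN k hk, ← hN N le_rfl]
  have h1 : (f ^ N) ⟨e, he⟩ ∈ LinearMap.range (f ^ (m + N + N)) := by
    rw [hr _ (by omega)]
    exact ⟨_, rfl⟩
  obtain ⟨u, hu⟩ := h1
  refine ⟨N, ((f ^ N) u : contracted ξ), ⟨((f ^ N) u).2, ?_⟩, ?_⟩
  · rw [SetLike.mem_coe, Submodule.mem_iInf]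
    intro k
    have h2 : (f ^ N) u ∈ LinearMap.range (f ^ (N + k)) := by
      rw [hr _ (by omega)]
      exact ⟨u, rfl⟩
    obtain ⟨w, hw⟩ := h2
    rw [← hw, add_comm, hf, pow_add]
    exact ⟨_, rfl⟩
  · have h3 := congrArg (Subtype.val) hu
    rw [pow_add, Module.End.mul_apply, hf, hf N ⟨e, he⟩] at h3
    exact h3

/-- The rounding errors `ε n` of the vectors `α |ξⁿ(b)|` tend to `0` and are eventually an orbit of
`M_ξᵗ`, hence contracted. Pulling one of them back into `E^s` yields `v`; the remainder becomes a
vector of nearest integers under a power of `M_ξᵗ`. -/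
theorem exists_splitting_of_tendsto {α : ℝ}
    (h : ∀ b, Tendsto (fun n => Complex.exp (2 * Real.pi * Complex.I * α) ^ (iter ξ n b).length)
      atTop (𝓝 1)) :
    ∃ v ∈ stableSpace ξ, ∃ w : A → ℝ, (∀ a, α = v a + w a) ∧
      ∃ m : ℕ, ∀ a, ∃ z : ℤ, (transposeMap ξ ^ m) w a = z := by
  let t : ℕ → A → ℝ := fun n b => α * (iter ξ n b).length
  let ε : ℕ → A → ℝ := fun n b => t n b - round (t n b)
  have hε : Tendsto ε atTop (𝓝 0) := by
    rw [tendsto_pi_nhds]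
    intro b
    have h1 : Tendsto (fun n => ‖Complex.exp (2 * Real.pi * Complex.I * α)
        ^ (iter ξ n b).length - 1‖ / 4) atTop (𝓝 0) := by
      have := ((h b).sub_const 1).norm.div_const 4
      simpa using this
    refine squeeze_zero_norm (fun n => ?_) h1
    have h2 := four_mul_abs_sub_round_le (t n b)
    rw [show (2 * Real.pi * Complex.I * (t n b : ℝ) : ℂ)
      = ((iter ξ n b).length : ℕ) * (2 * Real.pi * Complex.I * α) by
        simp only [t]; push_cast; ring, Complex.exp_nat_mul] at h2
    rw [Real.norm_eq_abs]
    simp only [ε]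
    linarith
  have ht : ∀ n, t n = α • (transposeMap ξ ^ n) (fun _ => 1) := fun n => by
    funext b
    simp [t, transposeMap_pow_one_apply]
  have htT : ∀ n, transposeMap ξ (t n) = t (n + 1) := fun n => by
    rw [ht, ht, map_smul, pow_succ']; rfl
  have hdiff : ∀ n b, ∃ z : ℤ, transposeMap ξ (ε n) b - ε (n + 1) b = z := by
    intro n b
    obtain ⟨z, hz⟩ := exists_int_wordSum (w := fun a => (round (t n a) : ℝ))
      (fun a => ⟨_, rfl⟩) (ξ b)
    refine ⟨round (t (n + 1) b) - z, ?_⟩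
    have e1 : ε n = t n - fun a => (round (t n a) : ℝ) := rfl
    rw [e1, map_sub, htT, Pi.sub_apply, transposeMap_apply, hz]
    simp only [ε]
    push_cast; ring
  have hlim : Tendsto (fun n => transposeMap ξ (ε n) - ε (n + 1)) atTop (𝓝 0) := by
    have h1 : Continuous (transposeMap ξ) := (transposeMap ξ).continuous_of_finiteDimensional
    have h2 := (h1.tendsto 0).comp hε
    rw [map_zero] at h2
    have h3 := h2.sub ((tendsto_add_atTop_iff_nat 1).2 hε)
    rwa [sub_zero] at h3
  -- The difference has integer entries and tends to `0`.
  have hev : ∀ᶠ n in atTop, transposeMap ξ (ε n) = ε (n + 1) := by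
    have h1 : ∀ᶠ n in atTop, ∀ b, |transposeMap ξ (ε n) b - ε (n + 1) b| < 1 := by
      refine eventually_all.2 fun b => ?_
      have := (tendsto_pi_nhds.1 hlim b).abs
      simp only [Pi.zero_apply, abs_zero, Pi.sub_apply] at this
      exact this.eventually_lt_const one_pos
    filter_upwards [h1] with n hn
    funext b
    obtain ⟨z, hz⟩ := hdiff n b
    have h2 := hn b
    rw [hz] at h2
    have h3 : z = 0 := Int.abs_lt_one_iff.1 (by exact_mod_cast h2)
    rw [h3, Int.cast_zero, sub_eq_zero] at hz
    exact hz
  obtain ⟨m, hm⟩ := eventually_atTop.1 hev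
  have hpow : ∀ k, (transposeMap ξ ^ k) (ε m) = ε (m + k) := by
    intro k
    induction k with
    | zero => simp
    | succ k ih => rw [pow_succ', Module.End.mul_apply, ih, hm _ (by omega), add_assoc]
  have hcon : ε m ∈ contracted ξ := by
    change Tendsto (fun k : ℕ => (transposeMap ξ ^ k) (ε m)) atTop (𝓝 0)
    simp only [hpow]
    exact hε.comp (tendsto_atTop_mono (fun k => Nat.le_add_left k m) tendsto_id)
  obtain ⟨N, v, hv, hvN⟩ := exists_mem_stableSpace_pow_eq hcon m
  refine ⟨v, hv, fun a => α - v a, fun a => by ring, m + N, fun a => ⟨round (t (m + N) a), ?_⟩⟩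
  have e : (fun a => α - v a) = α • (fun _ => (1 : ℝ)) - v := by funext a; simp
  rw [e, map_sub, map_smul, ← ht, hvN, hpow]
  simp [ε]

end ExistsSplitting

/-! ### Subinvariant vectors of primitive matrices -/

section Perron

variable {A : Type*} [Fintype A] [DecidableEq A]

/-- A matrix all of whose complex eigenvalues have modulus less than `b` has its powers bounded by
those of `b`. -/
theorem eventually_abs_mulVec_le {M : Matrix A A ℝ} {b : ℝ} (hb0 : 0 < b)
    (hb : ∀ z ∈ spectrum ℂ (M.map (algebraMap ℝ ℂ)), ‖z‖ < b) (r : A → ℝ) (a : A) :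
    ∃ K : ℝ, ∀ᶠ n : ℕ in atTop, |((M ^ n).mulVec r) a| ≤ K * b ^ n := by
  let _ : NormedRing (Matrix A A ℂ) := Matrix.linftyOpNormedRing
  let _ : NormedAlgebra ℂ (Matrix A A ℂ) := Matrix.linftyOpNormedAlgebra
  have : Nonempty A := ⟨a⟩
  set Mc := M.map (algebraMap ℝ ℂ) with hMc
  have : CompleteSpace (Matrix A A ℂ) := FiniteDimensional.complete ℂ _
  have hrad : spectralRadius ℂ Mc < ENNReal.ofReal b := by
    obtain ⟨z, hz, hz'⟩ := spectrum.exists_nnnorm_eq_spectralRadius Mc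
    rw [← hz', ENNReal.ofReal, ENNReal.coe_lt_coe, ← NNReal.coe_lt_coe,
      Real.coe_toNNReal _ hb0.le]
    exact hb z hz
  have hev :=
    (spectrum.pow_norm_pow_one_div_tendsto_nhds_spectralRadius Mc).eventually_lt_const hrad
  refine ⟨‖fun a => (r a : ℂ)‖, ?_⟩
  filter_upwards [hev, eventually_gt_atTop 0] with n hn hn0
  rw [ENNReal.ofReal_lt_ofReal_iff hb0] at hn
  have h1 : ‖Mc ^ n‖ ≤ b ^ n := by
    have := pow_le_pow_left₀ (by positivity) hn.le n
    rwa [one_div, Real.rpow_inv_natCast_pow (norm_nonneg _) hn0.ne'] at this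
  have h2 : (Mc ^ n).mulVec (fun a => (r a : ℂ)) a = (((M ^ n).mulVec r a : ℝ) : ℂ) := by
    rw [hMc, ← Matrix.map_pow]
    simp [Matrix.mulVec, dotProduct]
  calc |((M ^ n).mulVec r) a| = ‖(Mc ^ n).mulVec (fun a => (r a : ℂ)) a‖ := by
        rw [h2, Complex.norm_real, Real.norm_eq_abs]
    _ ≤ ‖(Mc ^ n).mulVec (fun a => (r a : ℂ))‖ := norm_le_pi_norm _ a
    _ ≤ ‖Mc ^ n‖ * ‖fun a => (r a : ℂ)‖ := Matrix.linfty_opNorm_mulVec _ _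
    _ ≤ _ := by rw [mul_comm]; gcongr

theorem mulVec_mono {A : Type*} [Fintype A] {M : Matrix A A ℝ} (hM : ∀ i j, 0 ≤ M i j)
    {r s : A → ℝ} (h : r ≤ s) :
    M.mulVec r ≤ M.mulVec s := fun a =>
  Finset.sum_le_sum fun b _ => mul_le_mul_of_nonneg_left (h b) (hM a b)

/-- A nonnegative vector which is subinvariant for a primitive matrix and its spectral radius is
invariant. -/
theorem mulVec_eq_smul_of_le {M : Matrix A A ℝ} (hM : M.IsPrimitive) {β : ℝ} (hβ : 0 < β)
    (hspec : ∀ z ∈ spectrum ℂ (M.map (algebraMap ℝ ℂ)), ‖z‖ ≤ β) {r : A → ℝ} (hr : 0 ≤ r)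
    (h : β • r ≤ M.mulVec r) : M.mulVec r = β • r := by
  by_contra hne
  obtain ⟨k, -, hk⟩ := hM.exists_pos_pow
  set δ := M.mulVec r - β • r with hδ
  have hδ0 : 0 ≤ δ := sub_nonneg.2 h
  obtain ⟨c, hc⟩ : ∃ c, 0 < δ c := by
    by_contra! hcon
    refine hne (sub_eq_zero.1 (funext fun a => le_antisymm (hcon a) (hδ0 a)))
  have hpos : ∀ s : A → ℝ, 0 ≤ s → ∀ c, 0 < s c → ∀ a, 0 < (M ^ k).mulVec s a := by
    intro s hs c hc a
    refine Finset.sum_pos' (fun b _ => mul_nonneg (hk a b).le (hs b))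
      ⟨c, Finset.mem_univ c, mul_pos (hk a c) hc⟩
  have hδ' := hpos δ hδ0 c hc
  obtain ⟨c', hc'⟩ : ∃ c', 0 < r c' := by
    by_contra! hcon
    have : r = 0 := funext fun a => le_antisymm (hcon a) (hr a)
    simp [hδ, this] at hc
  set r' := (M ^ k).mulVec r with hr'
  have hr'0 := hpos r hr c' hc'
  have : Nonempty A := ⟨c⟩
  obtain ⟨a₀, ha₀⟩ := Finite.exists_min fun a => (M ^ k).mulVec δ a / r' a
  set ε := (M ^ k).mulVec δ a₀ / r' a₀ with hε
  have hε0 : 0 < ε := div_pos (hδ' _) (hr'0 _)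
  -- If the inequality were strict at one coordinate, the positive matrix `M ^ k` would make it
  -- strict everywhere. Then `M ^ n` would grow at least like `(β + ε) ^ n` on `r'`, whereas the
  -- spectral radius allows only `(β + ε / 2) ^ n`.
  have hstep : (β + ε) • r' ≤ M.mulVec r' := by
    intro a
    have h1 : M.mulVec r' = (M ^ k).mulVec δ + β • r' := by
      rw [hδ, Matrix.mulVec_sub, Matrix.mulVec_smul, hr', Matrix.mulVec_mulVec,
        Matrix.mulVec_mulVec, ← pow_succ', ← pow_succ, sub_add_cancel]
    have h2 := ha₀ a
    rw [le_div_iff₀ (hr'0 a)] at h2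
    rw [h1]
    simp only [Pi.smul_apply, Pi.add_apply, smul_eq_mul, add_mul]
    linarith
  have hpow : ∀ n : ℕ, (β + ε) ^ n • r' ≤ (M ^ n).mulVec r' := by
    intro n
    induction n with
    | zero => simp
    | succ n ih =>
      rw [pow_succ' M, ← Matrix.mulVec_mulVec]
      refine le_trans ?_ (mulVec_mono hM.nonneg ih)
      rw [Matrix.mulVec_smul, pow_succ, mul_smul]
      exact smul_le_smul_of_nonneg_left hstep (by positivity)
  obtain ⟨K, hK⟩ := eventually_abs_mulVec_le (b := β + ε / 2) (by positivity)
    (fun z hz => (hspec z hz).trans_lt (by linarith)) r' c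
  have hq : 1 < (β + ε) / (β + ε / 2) := by
    rw [one_lt_div (by positivity)]; linarith
  have hlim := (tendsto_pow_atTop_atTop_of_one_lt hq).eventually_gt_atTop (K / r' c)
  obtain ⟨n, hn1, hn2⟩ := (hK.and hlim).exists
  have h1 := (hpow n c).trans ((le_abs_self _).trans hn1)
  rw [div_pow, lt_div_iff₀ (by positivity), div_mul_eq_mul_div, div_lt_iff₀ (hr'0 c)] at hn2
  simp only [Pi.smul_apply, smul_eq_mul] at h1
  linarith

theorem norm_le_of_mem_spectrum {ξ : A → List A} {β : ℝ} (hβ : IsPerronNumber ξ β) (hβ0 : 0 < β)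
    {z : ℂ} (hz : z ∈ spectrum ℂ ((incidence ξ).map (algebraMap ℝ ℂ))) : ‖z‖ ≤ β := by
  rw [Matrix.mem_spectrum_iff_isRoot_charpoly, Matrix.charpoly_map] at hz
  by_cases h : z = β
  · rw [h, Complex.norm_real, Real.norm_eq_abs, abs_of_pos hβ0]
  · exact (hβ.2 z hz h).le

end Perron

/-! ### Tiles, their subdivision and disjointness in measure -/

section Tiles

/-- An overlap of positive measure would be counted twice in the sum, making it exceed the measure
of the union. -/
theorem measure_inter_eq_zero_of_sum_le {X ι : Type*} [MeasurableSpace X] {μ : Measure X}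
    [DecidableEq ι] {s : Finset ι} {f : ι → Set X} (hf : ∀ i ∈ s, MeasurableSet (f i))
    (hfin : ∀ i ∈ s, μ (f i) ≠ ⊤) (h : ∑ i ∈ s, μ (f i) ≤ μ (⋃ i ∈ s, f i)) {i j : ι} (hi : i ∈ s)
    (hj : j ∈ s) (hij : i ≠ j) : μ (f i ∩ f j) = 0 := by
  have hj' : j ∈ s.erase i := Finset.mem_erase.2 ⟨hij.symm, hj⟩
  have hsum : ∑ k ∈ s, μ (f k) = μ (f i) + (μ (f j) + ∑ k ∈ (s.erase i).erase j, μ (f k)) := by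
    rw [Finset.add_sum_erase _ (fun k => μ (f k)) hj', Finset.add_sum_erase _ (fun k => μ (f k)) hi]
  have hU : ⋃ k ∈ s, f k ⊆ (f i ∪ f j) ∪ ⋃ k ∈ (s.erase i).erase j, f k := by
    intro x hx
    simp only [Set.mem_iUnion, exists_prop] at hx
    obtain ⟨k, hk, hxk⟩ := hx
    by_cases h1 : k = i
    · exact Or.inl (Or.inl (h1 ▸ hxk))
    by_cases h2 : k = j
    · exact Or.inl (Or.inr (h2 ▸ hxk))
    · exact Or.inr (Set.mem_biUnion (Finset.mem_coe.2 (Finset.mem_erase.2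
        ⟨h2, Finset.mem_erase.2 ⟨h1, hk⟩⟩)) hxk)
  have hUle : μ (⋃ k ∈ s, f k) ≤ μ (f i ∪ f j) + ∑ k ∈ (s.erase i).erase j, μ (f k) :=
    (measure_mono hU).trans ((measure_union_le _ _).trans
      (by gcongr; exact measure_biUnion_finset_le _ _))
  have hinc := measure_union_add_inter (μ := μ) (f i) (hf j hj)
  have hUfin : μ (⋃ k ∈ s, f k) ≠ ⊤ :=
    ((measure_biUnion_finset_le s f).trans_lt (ENNReal.sum_lt_top.2 fun k hk =>
      (hfin k hk).lt_top)).ne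
  have key : μ (⋃ k ∈ s, f k) + μ (f i ∩ f j) ≤ μ (⋃ k ∈ s, f k) + 0 := by
    calc μ (⋃ k ∈ s, f k) + μ (f i ∩ f j)
        ≤ (μ (f i ∪ f j) + ∑ k ∈ (s.erase i).erase j, μ (f k)) + μ (f i ∩ f j) := by gcongr
      _ = (μ (f i ∪ f j) + μ (f i ∩ f j)) + ∑ k ∈ (s.erase i).erase j, μ (f k) := by ring
      _ = ∑ k ∈ s, μ (f k) := by rw [hinc, hsum, add_assoc]
      _ ≤ _ := by rw [add_zero]; exact h
  exact le_antisymm ((ENNReal.add_le_add_iff_left hUfin).1 key) zero_le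

variable {A : Type*} {ξ : A → List A} {F : (A → ℝ) → (ℤ → A) → ℝ} {n : ℕ} {v : Fin n → A → ℝ}
  {H : Matrix (Fin n) (Fin n) ℝ}

/-- The image of a cylinder. -/
def tile (ξ : A → List A) (F : (A → ℝ) → (ℤ → A) → ℝ) (v : Fin n → A → ℝ) (a : A) :
    Set (Fin n → ℝ) := vecF F v '' cyl ξ a

/-- The positions in the words `ξᵐ(b)`. -/
abbrev Pos (ξ : A → List A) (m : ℕ) : Type _ := Σ b, Fin (iter ξ m b).length

/-- The letter at a position in `ξᵐ(b)`. -/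
def Pos.letter {m : ℕ} (p : Pos ξ m) : A := (iter ξ m p.1)[p.2]

/-- The affine copies of the tiles that subdivide the tiles. -/
def subtile (ξ : A → List A) (F : (A → ℝ) → (ℤ → A) → ℝ) (v : Fin n → A → ℝ)
    (H : Matrix (Fin n) (Fin n) ℝ) (m : ℕ) (p : Pos ξ m) : Set (Fin n → ℝ) :=
  (fun y => (H ^ m).mulVec y - vecSum v ((iter ξ m p.1).take p.2)) '' tile ξ F v p.1

theorem volume_subtile (m : ℕ) (p : Pos ξ m) :
    volume (subtile ξ F v H m p) = ENNReal.ofReal (|H.det| ^ m) * volume (tile ξ F v p.1) := by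
  have : subtile ξ F v H m p = (fun y => y + -vecSum v ((iter ξ m p.1).take p.2)) ''
      ((H ^ m).mulVecLin '' tile ξ F v p.1) := by
    rw [Set.image_image]; rfl
  rw [this, Set.image_add_right, measure_preimage_add_right, Measure.addHaar_image_linearMap,
    ← Matrix.toLin'_apply', LinearMap.det_toLin', Matrix.det_pow, abs_pow]

variable [Fintype A] [DecidableEq A]

/-- Each occurrence of `a` in `ξᵐ(b)` contributes one copy of the tile of `b` with volume scaled by
`|det H| ^ m`, and the number of occurrences is the entry `(a, b)` of the `m`-th power of the
incidence matrix. -/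
theorem sum_volume_subtile (m : ℕ) (a : A) :
    ∑ p ∈ (Finset.univ.filter fun p : Pos ξ m => p.letter = a), volume.real (subtile ξ F v H m p)
      = |H.det| ^ m * (incidence ξ ^ m).mulVec (fun b => volume.real (tile ξ F v b)) a := by
  rw [Finset.sum_filter, Fintype.sum_sigma, Matrix.mulVec, dotProduct, Finset.mul_sum]
  refine Finset.sum_congr rfl fun b _ => ?_
  have hreal : ∀ p : Pos ξ m, volume.real (subtile ξ F v H m p)
      = |H.det| ^ m * volume.real (tile ξ F v p.1) := fun p => by
    rw [Measure.real, volume_subtile, ENNReal.toReal_mul,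
      ENNReal.toReal_ofReal (by positivity)]
    rfl
  simp only [hreal, Pos.letter]
  rw [incidence_pow_apply]
  have := Fin.sum_univ_fun_getElem (iter ξ m b)
    (fun c => if c = a then |H.det| ^ m * volume.real (tile ξ F v b) else 0)
  simp only [Fin.getElem_fin]
  rw [this]
  generalize iter ξ m b = l
  induction l with
  | nil => simp
  | cons c l ih =>
    rw [List.map_cons, List.sum_cons, ih, List.count_cons]
    by_cases hc : c = a
    · simp [hc]; ring
    · simp [hc]

variable [TopologicalSpace A] {C : ℝ}

theorem IsTransfer.vecF_shiftZ_seqMap (hF : IsTransfer ξ F C) (hξ : ∀ a, ξ a ≠ [])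
    (hv : ∀ i, v i ∈ stableSpace ξ) (hH : ∀ i, transposeMap ξ (v i) = ∑ j, H i j • v j)
    {y : ℤ → A} (hy : y ∈ Omega ξ) (m : ℕ) {k : ℕ} (hk : k < (iter ξ m (y 0)).length) :
    vecF F v (SubstShift.shiftZ k ((SubstShift.seqMap ξ)^[m] y))
        = (H ^ m).mulVec (vecF F v y) - vecSum v ((iter ξ m (y 0)).take k) ∧
      SubstShift.shiftZ k ((SubstShift.seqMap ξ)^[m] y) 0 = (iter ξ m (y 0))[k] := by
  have hz := isConcat_seqMap_iterate hξ m y 0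
  rw [cut_zero] at hz
  constructor
  · rw [hF.vecF_shiftZ hv (seqMap_iterate_mem_Omega hξ m hy), hF.vecF_seqMap hξ hv hH hy]
    congr 2
    rw [← hz]
    obtain ⟨r, hr⟩ := Nat.exists_eq_add_of_lt hk
    rw [hr, add_assoc, factor_add, List.take_left' (by simp)]
  · have h1 : (factor ((SubstShift.seqMap ξ)^[m] y) 0 (iter ξ m (y 0)).length)[k]?
        = (iter ξ m (y 0))[k]? := by rw [hz]
    rw [getElem?_factor _ _ _ _ hk, List.getElem?_eq_getElem hk] at h1
    simpa using Option.some.inj h1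

/-- The data under which the tiles are studied. -/
structure IsTiling (ξ : A → List A) (F : (A → ℝ) → (ℤ → A) → ℝ) (C : ℝ) (v : Fin n → A → ℝ)
    (H : Matrix (Fin n) (Fin n) ℝ) (β : ℝ) : Prop where
  isTransfer : IsTransfer ξ F C
  mem : ∀ i, v i ∈ stableSpace ξ
  matrix : ∀ i, transposeMap ξ (v i) = ∑ j, H i j • v j
  prim : (incidence ξ).IsPrimitive
  ne_nil : ∀ a, ξ a ≠ []
  perron : IsPerronNumber ξ β
  pos : 0 < β
  det : β * |H.det| = 1

namespace IsTiling

variable {β : ℝ}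

theorem subtile_subset_tile (h : IsTiling ξ F C v H β) {m : ℕ} (p : Pos ξ m) :
    subtile ξ F v H m p ⊆ tile ξ F v p.letter := by
  obtain ⟨b, k, hk⟩ := p
  rintro _ ⟨_, ⟨y, ⟨hy, rfl⟩, rfl⟩, rfl⟩
  obtain ⟨h1, h2⟩ := h.isTransfer.vecF_shiftZ_seqMap h.ne_nil h.mem h.matrix hy m hk
  exact ⟨_, ⟨shiftZ_mem_Omega (seqMap_iterate_mem_Omega h.ne_nil m hy) k, h2⟩, h1⟩

theorem det_ne_zero (h : IsTiling ξ F C v H β) : H.det ≠ 0 := fun h0 => by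
  have := h.det
  simp [h0] at this

theorem volume_eq_zero_of_image (h : IsTiling ξ F C v H β) {s : Set (Fin n → ℝ)}
    (hs : volume (H.mulVecLin '' s) = 0) : volume s = 0 := by
  rw [Measure.addHaar_image_linearMap, ← Matrix.toLin'_apply', LinearMap.det_toLin',
    mul_eq_zero] at hs
  refine hs.resolve_left ?_
  simpa using h.det_ne_zero

variable [DiscreteTopology A]

/-- Every point of the subshift occupies some position in a word `ξᵐ(b)`, and the two equivariance
rules of `F` turn this position into an affine copy of the tile of `b`. -/
theorem tile_subset_iUnion (h : IsTiling ξ F C v H β) (m : ℕ) (a : A) :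
    tile ξ F v a ⊆ ⋃ p ∈ (Finset.univ.filter fun p : Pos ξ m => p.letter = a),
      subtile ξ F v H m p := by
  rintro _ ⟨x, ⟨hx, rfl⟩, rfl⟩
  obtain ⟨y, hy, k, hk, rfl⟩ := exists_eq_shiftZ_seqMap h.prim h.ne_nil m hx
  obtain ⟨h1, h2⟩ := h.isTransfer.vecF_shiftZ_seqMap h.ne_nil h.mem h.matrix hy m hk
  refine Set.mem_biUnion (x := (⟨y 0, k, hk⟩ : Pos ξ m)) ?_ ⟨_, ⟨y, ⟨hy, rfl⟩, rfl⟩, h1.symm⟩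
  simp only [Finset.coe_filter, Finset.mem_univ, true_and, Set.mem_ofPred_eq]
  exact h2.symm

theorem isCompact_tile (h : IsTiling ξ F C v H β) (a : A) : IsCompact (tile ξ F v a) :=
  (isCompact_cyl a).image_of_continuousOn
    ((h.isTransfer.continuousOn_vecF h.mem).mono fun _ hx => hx.1)

theorem isCompact_subtile (h : IsTiling ξ F C v H β) {m : ℕ} (p : Pos ξ m) :
    IsCompact (subtile ξ F v H m p) :=
  (h.isCompact_tile p.1).image
    (((H ^ m).mulVecLin.continuous_of_finiteDimensional).sub continuous_const)

/-- Subadditivity over the subdivision, with `β |det H| = 1`, makes the vector of volumes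
subinvariant for the Perron number; primitivity upgrades this to an eigenvector equation. -/
theorem mulVec_volume_tile (h : IsTiling ξ F C v H β) :
    (incidence ξ).mulVec (fun b => volume.real (tile ξ F v b))
      = β • fun b => volume.real (tile ξ F v b) := by
  refine mulVec_eq_smul_of_le h.prim h.pos
    (fun z hz => norm_le_of_mem_spectrum h.perron h.pos hz) (fun b => measureReal_nonneg) ?_
  intro a
  have h1 := measureReal_mono (μ := volume) (h.tile_subset_iUnion 1 a)
    ((measure_biUnion_finset_le _ _).trans_lt (ENNReal.sum_lt_top.2 fun p _ =>
      (h.isCompact_subtile p).measure_lt_top)).ne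
  have h2 := h1.trans (measureReal_biUnion_finset_le _ _)
  rw [sum_volume_subtile 1 a, pow_one, pow_one] at h2
  have h3 := mul_le_mul_of_nonneg_left h2 h.pos.le
  rwa [← mul_assoc, h.det, one_mul] at h3

theorem mulVec_pow_volume_tile (h : IsTiling ξ F C v H β) (m : ℕ) :
    (incidence ξ ^ m).mulVec (fun b => volume.real (tile ξ F v b))
      = β ^ m • fun b => volume.real (tile ξ F v b) := by
  induction m with
  | zero => simp
  | succ m ih =>
    rw [pow_succ, ← Matrix.mulVec_mulVec, h.mulVec_volume_tile, Matrix.mulVec_smul, ih, smul_smul,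
      ← pow_succ']

/-- The pieces of the subdivision of one tile are disjoint in measure. -/
theorem volume_subtile_inter_of_letter_eq (h : IsTiling ξ F C v H β) {m : ℕ} {p q : Pos ξ m}
    (hpq : p ≠ q) (hl : p.letter = q.letter) :
    volume (subtile ξ F v H m p ∩ subtile ξ F v H m q) = 0 := by
  classical
  refine measure_inter_eq_zero_of_sum_le
    (s := Finset.univ.filter fun p : Pos ξ m => p.letter = q.letter)
    (fun p _ => (h.isCompact_subtile p).measurableSet)
    (fun p _ => (h.isCompact_subtile p).measure_lt_top.ne) ?_ (by simp [hl]) (by simp) hpq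
  refine le_trans ?_ (measure_mono (h.tile_subset_iUnion m q.letter))
  -- The scaling factors `|det H| ^ m` and `β ^ m` cancel, so the volumes of the pieces add up
  -- exactly to that of the tile.
  have h1 := sum_volume_subtile (ξ := ξ) (F := F) (v := v) (H := H) m q.letter
  rw [h.mulVec_pow_volume_tile, Pi.smul_apply, smul_eq_mul, ← mul_assoc, ← mul_pow,
    mul_comm |H.det|, h.det, one_pow, one_mul] at h1
  rw [← ENNReal.toReal_le_toReal (ENNReal.sum_lt_top.2 fun p _ =>
    (h.isCompact_subtile p).measure_lt_top).ne (h.isCompact_tile _).measure_lt_top.ne,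
    ENNReal.toReal_sum fun p _ => (h.isCompact_subtile p).measure_lt_top.ne]
  exact h1.le

/-- The tiles are disjoint in measure, since the words `ξ(b)` begin with the same letter. -/
theorem volume_tile_inter (h : IsTiling ξ F C v H β) (hproper : IsProper ξ) {a b : A}
    (hab : a ≠ b) : volume (tile ξ F v a ∩ tile ξ F v b) = 0 := by
  obtain ⟨⟨l, hl⟩, -⟩ := hproper
  have hlen : ∀ c, 0 < (iter ξ 1 c).length := fun c => List.length_pos_iff.2 (by
    rw [iter_one]; exact h.ne_nil c)
  -- At the first position there is no translation: the images under `H` of the tiles of `a` and `b`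
  -- are two distinct pieces of the tile of the common letter `l`.
  let p : A → Pos ξ 1 := fun c => ⟨c, 0, hlen c⟩
  have hp : ∀ c, (p c).letter = l := fun c => by
    have h1 := hl c
    rw [List.head?_eq_getElem?] at h1
    have h2 : (iter ξ 1 c)[0]? = some l := by rw [iter_one]; exact h1
    rw [List.getElem?_eq_getElem (hlen c)] at h2
    exact Option.some.inj h2
  refine h.volume_eq_zero_of_image (measure_mono_null ?_
    (h.volume_subtile_inter_of_letter_eq (m := 1) (p := p a) (q := p b)
      (fun e => hab (congrArg Sigma.fst e)) (by rw [hp, hp])))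
  rintro _ ⟨y, ⟨ha, hb⟩, rfl⟩
  exact ⟨⟨y, ha, by simp [p]; rfl⟩, ⟨y, hb, by simp [p]; rfl⟩⟩

/-- The translated tiles are disjoint in measure, since the words `ξ(b)` end with the same
letter. -/
theorem volume_tile_sub_inter (h : IsTiling ξ F C v H β) (hproper : IsProper ξ) {a b : A}
    (hab : a ≠ b) : volume {y | y + vecSum v [a] ∈ tile ξ F v a ∧
      y + vecSum v [b] ∈ tile ξ F v b} = 0 := by
  obtain ⟨-, ⟨l, hl⟩⟩ := hproper
  have hlen : ∀ c, (iter ξ 1 c).length - 1 < (iter ξ 1 c).length := fun c => by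
    have : 0 < (iter ξ 1 c).length := List.length_pos_iff.2 (by rw [iter_one]; exact h.ne_nil c)
    omega
  let p : A → Pos ξ 1 := fun c => ⟨c, _, hlen c⟩
  have hp : ∀ c, (p c).letter = l := fun c => by
    have h1 := hl c
    rw [List.getLast?_eq_getElem?] at h1
    have h2 : (iter ξ 1 c)[(iter ξ 1 c).length - 1]? = some l := by rw [iter_one]; exact h1
    rw [List.getElem?_eq_getElem (hlen c)] at h2
    exact Option.some.inj h2
  -- The sum over `ξ(c)` splits as prefix plus last letter `l`. Hence `H y + vecSum v [l]` lies in
  -- the last piece attached to `a` and in the one attached to `b`, two distinct pieces of the tile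
  -- of `l`.
  have htake : ∀ c, H.mulVec (vecSum v [c])
      = vecSum v ((iter ξ 1 c).take ((iter ξ 1 c).length - 1)) + vecSum v [l] := fun c => by
    have h1 : (iter ξ 1 c).take ((iter ξ 1 c).length - 1) ++ [l] = ξ c := by
      have h2 := List.take_append_getElem (hlen c)
      have h3 : (iter ξ 1 c)[(iter ξ 1 c).length - 1]'(hlen c) = l := hp c
      rw [h3] at h2
      rw [h2, iter_one, Nat.sub_add_cancel (List.length_pos_iff.2 (h.ne_nil c)), List.take_length]
    funext i
    simp only [Pi.add_apply, vecSum]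
    rw [← wordSum_append, h1, ← transposeMap_apply, h.matrix]
    simp [Matrix.mulVec, dotProduct, vecSum]
  refine h.volume_eq_zero_of_image ?_
  rw [← measure_preimage_add_right volume (-vecSum v [l])]
  refine measure_mono_null ?_
    (h.volume_subtile_inter_of_letter_eq (m := 1) (p := p a) (q := p b)
      (fun e => hab (congrArg Sigma.fst e)) (by rw [hp, hp]))
  rintro z ⟨y, ⟨ha, hb⟩, hz⟩
  have hz' : z = H.mulVec y + vecSum v [l] := by
    rw [Matrix.mulVecLin_apply] at hz
    rw [hz]; simp
  have key : ∀ c, (H ^ 1).mulVec (y + vecSum v [c])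
      - vecSum v ((iter ξ 1 c).take ((iter ξ 1 c).length - 1)) = z := fun c => by
    rw [pow_one, Matrix.mulVec_add, htake, hz']; abel
  exact ⟨⟨_, ha, key a⟩, ⟨_, hb, key b⟩⟩

/-- The pieces of the subdivision of all tiles are disjoint in measure. -/
theorem volume_subtile_inter (h : IsTiling ξ F C v H β) (hproper : IsProper ξ) {m : ℕ}
    {p q : Pos ξ m} (hpq : p ≠ q) : volume (subtile ξ F v H m p ∩ subtile ξ F v H m q) = 0 := by
  by_cases hl : p.letter = q.letter
  · exact h.volume_subtile_inter_of_letter_eq hpq hl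
  · exact measure_mono_null
      (Set.inter_subset_inter (h.subtile_subset_tile p) (h.subtile_subset_tile q))
      (h.volume_tile_inter hproper hl)

end IsTiling

end Tiles

/-! ### Injectivity of `vecF` almost everywhere -/

section Injective

variable {A : Type*} {ξ : A → List A} {F : (A → ℝ) → (ℤ → A) → ℝ} {n : ℕ} {v : Fin n → A → ℝ}
  {H : Matrix (Fin n) (Fin n) ℝ} [Fintype A] [DecidableEq A] [TopologicalSpace A] {C β : ℝ}
  [DiscreteTopology A] [MeasurableSpace A] [MeasurableSingletonClass A]

/-- For a backward shift by `k`, the preimage under the `k`-th iterate of `S` is the set already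
known to be null, and preimages under `S` keep their measure. Measurability, hence the superset
`N'`, is needed there. -/
theorem IsTransfer.measure_vecF_shiftZ_eq_zero (hF : IsTransfer ξ F C)
    (hv : ∀ i, v i ∈ stableSpace ξ) {μ : Measure (Omega ξ)}
    (hμ : MeasurePreserving (shiftOmega ξ) μ μ)
    (hac : ∀ N : Set (Fin n → ℝ), volume N = 0 → μ {x | vecF F v x ∈ N} = 0)
    {N : Set (Fin n → ℝ)} (hN : volume N = 0) (j : ℤ) :
    μ {x | vecF F v (shiftZ j x) ∈ N} = 0 := by
  obtain ⟨N', hNN, hm, hN'⟩ := exists_measurable_superset_of_null hN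
  refine measure_mono_null (t := {x : Omega ξ | vecF F v (SubstShift.shiftZ j x) ∈ N'})
    (fun x hx => hNN hx) ?_
  obtain ⟨k, rfl | rfl⟩ := Int.eq_nat_or_neg j
  · have := (hμ.iterate k).quasiMeasurePreserving.preimage_null (hac N' hN')
    refine measure_mono_null (fun x hx => ?_) this
    simp only [Set.mem_preimage, Set.mem_ofPred_eq, coe_shiftOmega_iterate]
    exact hx
  · have hcont : Continuous fun x : Omega ξ => vecF F v (SubstShift.shiftZ (-(k : ℤ)) x) :=
      (hF.continuousOn_vecF hv).comp_continuous
        ((continuous_shiftZ _).comp continuous_subtype_val)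
        fun x => shiftZ_mem_Omega x.2 _
    have h0 := (hμ.iterate k).measure_preimage (hcont.measurable hm).nullMeasurableSet
    refine Eq.trans h0.symm ?_
    refine measure_mono_null (fun x hx => ?_) (hac N' hN')
    simpa [coe_shiftOmega_iterate, shiftZ_shiftZ] using hx

/-- The map `vecF` is one-to-one off a null set. -/
theorem IsTiling.exists_injOn (h : IsTiling ξ F C v H β) (hproper : IsProper ξ)
    {μ : Measure (Omega ξ)} (hμ : MeasurePreserving (shiftOmega ξ) μ μ)
    (hac : ∀ N : Set (Fin n → ℝ), volume N = 0 → μ {x | vecF F v x ∈ N} = 0) :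
    ∃ N : Set (Omega ξ), μ N = 0 ∧ Set.InjOn (fun x : Omega ξ => vecF F v x) Nᶜ := by
  have hF := h.isTransfer
  let P : Set (Fin n → ℝ) := ⋃ a, ⋃ b, ⋃ _ : a ≠ b, tile ξ F v a ∩ tile ξ F v b
  let Q : Set (Fin n → ℝ) := ⋃ a, ⋃ b, ⋃ _ : a ≠ b, {y | y + vecSum v [a] ∈ tile ξ F v a ∧
      y + vecSum v [b] ∈ tile ξ F v b}
  have hP : volume P = 0 := by
    simp only [P, measure_iUnion_null_iff]
    exact fun a b hab => h.volume_tile_inter hproper hab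
  have hQ : volume Q = 0 := by
    simp only [Q, measure_iUnion_null_iff]
    exact fun a b hab => h.volume_tile_sub_inter hproper hab
  -- Off `P` the value of `vecF` determines the letter `x 0`, and off `Q` it determines `x (-1)`.
  -- Imposing this at every shift lets the equality `vecF x = vecF y` propagate in both directions.
  let N : Set (Omega ξ) := ⋃ j : ℤ, {x | vecF F v (SubstShift.shiftZ j x) ∈ P ∪ Q}
  refine ⟨N, ?_, ?_⟩
  · simp only [N, measure_iUnion_null_iff]
    exact hF.measure_vecF_shiftZ_eq_zero h.mem hμ hac (measure_union_null hP hQ)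
  have hstep : ∀ x ∈ Omega ξ, vecF F v (SubstShift.shiftZ 1 x) = vecF F v x - vecSum v [x 0] :=
    fun x hx => by
      have := hF.vecF_shiftZ h.mem hx 1
      simpa [factor] using this
  have hmem : ∀ x ∈ Omega ξ, vecF F v x ∈ tile ξ F v (x 0) := fun x hx => ⟨x, ⟨hx, rfl⟩, rfl⟩
  rintro ⟨x, hx⟩ hxN ⟨y, hy⟩ hyN hxy
  simp only [N, Set.mem_compl_iff, Set.mem_iUnion, not_exists] at hxN
  change vecF F v x = vecF F v y at hxy
  have heq : ∀ j : ℤ, vecF F v (SubstShift.shiftZ j x) = vecF F v (SubstShift.shiftZ j y) →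
      x j = y j := by
    intro j hj
    by_contra hne
    refine hxN j (Or.inl ?_)
    have h1 := hmem _ (shiftZ_mem_Omega hx j)
    have h2 := hmem _ (shiftZ_mem_Omega hy j)
    simp only [shiftZ_apply, zero_add] at h1 h2
    exact Set.mem_iUnion.2 ⟨x j, Set.mem_iUnion.2 ⟨y j, Set.mem_iUnion.2 ⟨hne, h1, hj ▸ h2⟩⟩⟩
  have hall : ∀ j : ℤ, vecF F v (SubstShift.shiftZ j x) = vecF F v (SubstShift.shiftZ j y) := by
    intro j
    induction j using Int.induction_on with
    | zero => simpa using hxy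
    | succ j ih =>
      have h1 := hstep _ (shiftZ_mem_Omega hx j)
      have h2 := hstep _ (shiftZ_mem_Omega hy j)
      simp only [shiftZ_shiftZ, shiftZ_apply, zero_add] at h1 h2
      rw [add_comm, h1, h2, ih, heq _ ih]
    | pred j ih =>
      have h1 := hstep _ (shiftZ_mem_Omega hx (-(j : ℤ) - 1))
      have h2 := hstep _ (shiftZ_mem_Omega hy (-(j : ℤ) - 1))
      simp only [shiftZ_shiftZ, shiftZ_apply, zero_add, add_sub_cancel] at h1 h2
      have h3 := hmem _ (shiftZ_mem_Omega hx (-(j : ℤ) - 1))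
      have h4 := hmem _ (shiftZ_mem_Omega hy (-(j : ℤ) - 1))
      simp only [shiftZ_apply, zero_add] at h3 h4
      rw [eq_sub_iff_add_eq] at h1 h2
      rw [← h1] at h3 ⊢
      rw [← h2, ← ih] at h4
      rw [← h2, ← ih]
      congr 2
      by_contra hne
      refine hxN (-(j : ℤ)) (Or.inr ?_)
      refine Set.mem_iUnion.2 ⟨_, Set.mem_iUnion.2 ⟨_, Set.mem_iUnion.2
        ⟨fun e => hne (by rw [e]), h3, h4⟩⟩⟩
  exact Subtype.ext (funext fun j => heq j (hall j))

end Injective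

/-! ### Common cuts of two decompositions -/

section CommonCut

variable {A : Type*} {ξ : A → List A} {F : (A → ℝ) → (ℤ → A) → ℝ} {n : ℕ} {v : Fin n → A → ℝ}
  {H : Matrix (Fin n) (Fin n) ℝ} [Fintype A] [DecidableEq A] [TopologicalSpace A] {C β : ℝ}
  [DiscreteTopology A] [MeasurableSpace A]

/-- Two decompositions of a sequence of the subshift into words `ξᵐ(b)` have a cutting point
in common. -/
theorem IsTiling.exists_common_cut (h : IsTiling ξ F C v H β) (hproper : IsProper ξ)
    {μ : Measure (Omega ξ)} [IsProbabilityMeasure μ]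
    (hac : ∀ N : Set (Fin n → ℝ), volume N = 0 → μ {x | vecF F v x ∈ N} = 0) (m : ℕ)
    {y y' : ℤ → A} (hy : y ∈ Omega ξ) (hy' : y' ∈ Omega ξ) {j : ℤ}
    (hj : shiftZ j ((seqMap ξ)^[m] y) = (seqMap ξ)^[m] y') :
    ∃ p q : ℤ, cut (iter ξ m) y p = j + cut (iter ξ m) y' q := by
  let G : Pos ξ m → Set (ℤ → A) := fun p =>
    (fun y => SubstShift.shiftZ (p.2 : ℕ) ((seqMap ξ)^[m] y)) '' cyl ξ p.1
  have hGc : ∀ p, IsClosed (G p) := fun p =>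
    ((isCompact_cyl p.1).image ((continuous_shiftZ _).comp
      (continuous_seqMap_iterate m))).isClosed
  -- `D` is the closed set of points having two different positions in words `ξᵐ(b)`. Its image
  -- under `vecF` lies in intersections of distinct pieces, so absolute continuity prevents `D` from
  -- containing the subshift.
  let D : Set (ℤ → A) := ⋃ p, ⋃ q, ⋃ _ : p ≠ q, G p ∩ G q
  have hDc : IsClosed D := isClosed_iUnion_of_finite fun p => isClosed_iUnion_of_finite fun q =>
    isClosed_iUnion_of_finite fun _ => (hGc p).inter (hGc q)
  have hGsub : ∀ p, ∀ x ∈ G p, vecF F v x ∈ subtile ξ F v H m p := by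
    rintro p _ ⟨y, ⟨hy, h0⟩, rfl⟩
    refine ⟨vecF F v y, ⟨y, ⟨hy, h0⟩, rfl⟩, ?_⟩
    have hk : (p.2 : ℕ) < (iter ξ m (y 0)).length := by rw [h0]; exact p.2.2
    rw [(h.isTransfer.vecF_shiftZ_seqMap h.ne_nil h.mem h.matrix hy m hk).1, h0]
  have hD : ¬ Omega ξ ⊆ D := by
    intro hsub
    have h1 : μ Set.univ = 0 := by
      refine measure_mono_null (t := ⋃ p, ⋃ q, ⋃ _ : p ≠ q, {x : Omega ξ | vecF F v x ∈
        subtile ξ F v H m p ∩ subtile ξ F v H m q}) (fun x _ => ?_) ?_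
      · have := hsub x.2
        simp only [D, Set.mem_iUnion] at this ⊢
        obtain ⟨p, q, hpq, hp, hq⟩ := this
        exact ⟨p, q, hpq, hGsub p _ hp, hGsub q _ hq⟩
      · simp only [measure_iUnion_null_iff]
        exact fun p q hpq => hac _ (h.volume_subtile_inter hproper hpq)
    exact IsProbabilityMeasure.ne_zero μ (Measure.measure_univ_eq_zero.1 h1)
  have hzΩ : (seqMap ξ)^[m] y' ∈ Omega ξ := seqMap_iterate_mem_Omega h.ne_nil m hy'
  set z := (seqMap ξ)^[m] y' with hz
  -- By minimality the forward orbit of `z` leaves `D`. At that moment the two decompositions give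
  -- the same block and the same offset, so the left ends of the two blocks coincide.
  obtain ⟨t, ht⟩ : ∃ t : ℕ, SubstShift.shiftZ t z ∉ D := by
    by_contra! hall
    refine hD (fun x hx => ?_)
    have hK : IsClosed {x : ℤ → A | ∀ t : ℕ, SubstShift.shiftZ t x ∈ D} := by
      simp only [Set.ofPred_forall]
      exact isClosed_iInter fun t => hDc.preimage (continuous_shiftZ _)
    have := Omega_subset_of_isClosed h.prim hK ⟨z, hall, hzΩ⟩ (fun x hx t => by
      rw [shiftZ_shiftZ]
      exact_mod_cast hx.1 (t + 1)) hx
    simpa using this 0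
  have hparse : ∀ w ∈ Omega ξ, ∀ r : ℤ, ∃ (i : ℤ) (p : Pos ξ m),
      r = cut (iter ξ m) w i + (p.2 : ℕ) ∧ SubstShift.shiftZ r ((seqMap ξ)^[m] w) ∈ G p := by
    intro w hw r
    obtain ⟨i, hi1, hi2⟩ := exists_cut_le_lt (iter_ne_nil h.ne_nil m) w r
    obtain ⟨k, hk⟩ := Int.eq_ofNat_of_zero_le (sub_nonneg.2 hi1)
    have hk' : k < (iter ξ m (w i)).length := by
      rw [cut_add_one] at hi2
      omega
    refine ⟨i, ⟨w i, k, hk'⟩, by simp; omega, SubstShift.shiftZ i w,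
      ⟨shiftZ_mem_Omega hw i, by simp⟩, ?_⟩
    simp only
    rw [seqMap_iterate_shiftZ h.ne_nil, shiftZ_shiftZ]
    congr 1
    omega
  obtain ⟨i, p, hp, hpG⟩ := hparse y hy (t + j)
  obtain ⟨i', p', hp', hpG'⟩ := hparse y' hy' t
  rw [← shiftZ_shiftZ, hj] at hpG
  have hpp : p = p' := by
    by_contra hne
    exact ht (Set.mem_iUnion.2 ⟨p, Set.mem_iUnion.2 ⟨p', Set.mem_iUnion.2 ⟨hne, hpG, hpG'⟩⟩⟩)
  subst hpp
  exact ⟨i, i', by omega⟩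

end CommonCut

/-! ### Elementary morphisms -/

section Elementary

variable {A B : Type*} {c : ℕ}

/-- A morphism of free monoids is elementary if it does not factor through a free monoid on
fewer letters. -/
def IsElementary (α : Fin c → List B) : Prop :=
  ∀ c' < c, ∀ (γ : Fin c → List (Fin c')) (α' : Fin c' → List B),
    ¬ ∀ x, α x = (γ x).flatMap α'

/-- Two words one of which is a prefix of the other. -/
def Comparable (p q : List B) : Prop := p <+: q ∨ q <+: p

theorem Comparable.symm {p q : List B} (h : Comparable p q) : Comparable q p := Or.symm h

theorem Comparable.of_append {p q s t : List B} (h : Comparable (p ++ s) (q ++ t)) :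
    Comparable p q := by
  rcases h with h | h
  · exact List.prefix_or_prefix_of_prefix ((List.prefix_append p s).trans h)
      (List.prefix_append q t)
  · exact List.prefix_or_prefix_of_prefix (List.prefix_append p s)
      ((List.prefix_append q t).trans h)

theorem Comparable.append_left {p q s : List B} (h : Comparable (s ++ p) (s ++ q)) :
    Comparable p q := by
  simpa [Comparable, List.prefix_append_right_inj] using h

theorem flatMap_reverse_comp (σ : A → List B) (u : List A) :
    u.reverse.flatMap (fun x => (σ x).reverse) = (u.flatMap σ).reverse := by
  induction u with
  | nil => rfl
  | cons a u ih => simp [List.flatMap_append, ih]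

variable {α : Fin c → List B}

theorem IsElementary.not_factor (h : IsElementary α) {C' : Type*} [Fintype C']
    (hcard : Fintype.card C' < c) (γ : Fin c → List C') (α' : C' → List B) :
    ¬ ∀ x, α x = (γ x).flatMap α' := by
  intro hx
  refine h _ hcard (fun x => (γ x).map (Fintype.equivFin C')) (α' ∘ (Fintype.equivFin C').symm) ?_
  intro x
  rw [hx x, List.flatMap_map]
  simp

theorem IsElementary.reverse (h : IsElementary α) : IsElementary fun x => (α x).reverse := by
  intro c' hc' γ α' hx
  refine h c' hc' (fun x => (γ x).reverse) (fun x => (α' x).reverse) fun x => ?_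
  rw [flatMap_reverse_comp, ← hx, List.reverse_reverse]

theorem card_subtype_ne_lt (a : Fin c) : Fintype.card {x // x ≠ a} < c := by
  conv_rhs => rw [← Fintype.card_fin c]
  exact Fintype.card_subtype_lt (x := a) (by simp)

theorem IsElementary.ne_nil (h : IsElementary α) (a : Fin c) : α a ≠ [] := by
  intro ha
  refine h.not_factor (card_subtype_ne_lt a)
    (fun x => if hx : x = a then [] else [⟨x, hx⟩]) (fun x => α x) fun x => ?_
  by_cases hx : x = a
  · simp [hx, ha]
  · simp [hx]

/-- Elementary morphisms have a bounded delay. -/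
theorem IsElementary.exists_delay (h : IsElementary α) :
    ∃ n : ℕ, ∀ (a a' : Fin c) (t t' : List (Fin c)), n ≤ t.length → n ≤ t'.length →
      Comparable ((a :: t).flatMap α) ((a' :: t').flatMap α) → a = a' := by
  obtain ⟨N, hN⟩ : ∃ N, ∑ x, (α x).length ≤ N := ⟨_, le_rfl⟩
  induction N using Nat.strong_induction_on generalizing α with
  | _ N ih =>
  have core : ∀ a a' : Fin c, a ≠ a' → (α a).length ≤ (α a').length → ∃ n : ℕ,
      ∀ t t' : List (Fin c), n ≤ t.length → n ≤ t'.length →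
        ¬ Comparable ((a :: t).flatMap α) ((a' :: t').flatMap α) := by
    intro a a' hne hlen
    by_cases hpre : α a <+: α a'
    swap
    · refine ⟨0, fun t t' _ _ hc => hpre ?_⟩
      simp only [List.flatMap_cons] at hc
      rcases hc.of_append with hc | hc
      · exact hc
      · rw [hc.eq_of_length_le hlen]
    obtain ⟨w, hw⟩ := hpre
    -- With `α a' = α a ++ w`, the morphism factors as `γ` followed by `α'`, where `α'` sends `a'`
    -- to the shorter word `w`. It remains elementary and has smaller total length, which drives the
    -- induction.
    let γ : Fin c → List (Fin c) := fun x => if x = a' then [a, a'] else [x]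
    let α' : Fin c → List B := Function.update α a' w
    have hfac : ∀ x, α x = (γ x).flatMap α' := by
      intro x
      by_cases hx : x = a'
      · simp [γ, α', hx, hne, hw]
      · simp [γ, α', hx]
    have helem : IsElementary α' := by
      intro c' hc' γ' α'' h'
      refine h c' hc' (fun x => (γ x).flatMap γ') α'' fun x => ?_
      rw [hfac, List.flatMap_assoc]
      exact congrArg (fun f => (γ x).flatMap f) (funext h')
    have hsum : ∑ x, (α' x).length < ∑ x, (α x).length := by
      have hle : (α' a').length < (α a').length := by
        have := List.length_pos_iff.2 (h.ne_nil a)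
        simp only [α', Function.update_self, ← hw, List.length_append]
        omega
      refine Finset.sum_lt_sum (fun x _ => ?_) ⟨a', Finset.mem_univ _, hle⟩
      by_cases hx : x = a'
      · rw [hx]; exact hle.le
      · simp [α', hx]
    obtain ⟨n, hn⟩ := ih _ (hsum.trans_le hN) helem le_rfl
    have hγlen : ∀ s : List (Fin c), s.length ≤ (s.flatMap γ).length := by
      intro s
      induction s with
      | nil => simp
      | cons x s ihs =>
        rw [List.flatMap_cons, List.length_append, List.length_cons]
        have : 1 ≤ (γ x).length := by
          by_cases hx : x = a' <;> simp [γ, hx]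
        omega
    refine ⟨n + 1, fun t t' ht ht' hc => ?_⟩
    have hfl : ∀ s : List (Fin c), s.flatMap α = (s.flatMap γ).flatMap α' := fun s => by
      rw [List.flatMap_assoc]
      simp only [← hfac]
    rw [hfl, hfl] at hc
    have hγa : γ a = [a] := by simp [γ, hne]
    have hγa' : γ a' = [a, a'] := by simp [γ]
    rw [List.flatMap_cons, List.flatMap_cons, hγa, hγa', List.flatMap_append, List.cons_append,
      List.flatMap_cons, List.flatMap_cons, List.flatMap_nil, List.append_nil] at hc
    have hc' := hc.append_left
    rcases t with - | ⟨b, s⟩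
    · simp at ht
    -- No word `γ b` begins with `a'`. After cancelling the image of `a`, the two sides thus begin
    -- with different letters `x` and `a'`, against the delay of `α'`. The `n + 1` ensures that `t`
    -- has a first letter `b`.
    obtain ⟨x, r, hxr, hx⟩ : ∃ x r, γ b = x :: r ∧ x ≠ a' := by
      by_cases hb : b = a'
      · exact ⟨a, [a'], by simp [γ, hb], hne⟩
      · exact ⟨b, [], by simp [γ, hb], hb⟩
    rw [List.flatMap_cons, hxr, List.cons_append] at hc'
    refine hx (hn x a' _ _ ?_ ?_ hc')
    · have := hγlen s
      simp only [List.length_cons, List.length_append] at ht ⊢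
      omega
    · have := hγlen t'
      exact ht'.trans' (Nat.le_succ n) |>.trans this
  have pair : ∀ a a' : Fin c, ∃ n : ℕ, ∀ t t' : List (Fin c), n ≤ t.length → n ≤ t'.length →
        Comparable ((a :: t).flatMap α) ((a' :: t').flatMap α) → a = a' := by
    intro a a'
    by_cases hne : a = a'
    · exact ⟨0, fun _ _ _ _ _ => hne⟩
    rcases le_total (α a).length (α a').length with hl | hl
    · obtain ⟨n, hn⟩ := core a a' hne hl
      exact ⟨n, fun t t' ht ht' hc => (hn t t' ht ht' hc).elim⟩
    · obtain ⟨n, hn⟩ := core a' a (Ne.symm hne) hl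
      exact ⟨n, fun t t' ht ht' hc => (hn t' t ht' ht hc.symm).elim⟩
  choose n hn using pair
  refine ⟨∑ a, ∑ a', n a a', fun a a' t t' ht ht' hc => ?_⟩
  have hle : n a a' ≤ ∑ a, ∑ a', n a a' :=
    (Finset.single_le_sum (f := fun b => n a b) (fun _ _ => Nat.zero_le _)
      (Finset.mem_univ a')).trans (Finset.single_le_sum (f := fun a => ∑ a', n a a')
      (fun _ _ => Nat.zero_le _) (Finset.mem_univ a))
  exact hn a a' t t' (hle.trans ht) (hle.trans ht') hc

theorem comparable_factor (z : ℤ → B) (p : ℤ) (l m : ℕ) :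
    Comparable (factor z p l) (factor z p m) := by
  rcases le_total l m with h | h
  · obtain ⟨k, rfl⟩ := Nat.exists_eq_add_of_le h
    exact Or.inl (by rw [factor_add]; exact List.prefix_append _ _)
  · obtain ⟨k, rfl⟩ := Nat.exists_eq_add_of_le h
    exact Or.inr (by rw [factor_add]; exact List.prefix_append _ _)

theorem comparable_reverse_factor (z : ℤ → B) {p q : ℤ} {l m : ℕ} (h : p + l = q + m) :
    Comparable (factor z p l).reverse (factor z q m).reverse := by
  simp only [Comparable, List.reverse_prefix]
  rcases le_total l m with h' | h'
  · obtain ⟨k, rfl⟩ := Nat.exists_eq_add_of_le h'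
    refine Or.inl ?_
    rw [add_comm l k, factor_add, show q + (k : ℤ) = p by push_cast at h; omega]
    exact List.suffix_append _ _
  · obtain ⟨k, rfl⟩ := Nat.exists_eq_add_of_le h'
    refine Or.inr ?_
    rw [add_comm m k, factor_add, show p + (k : ℤ) = q by push_cast at h; omega]
    exact List.suffix_append _ _

theorem factor_eq_cons (y : ℤ → A) (i : ℤ) (l : ℕ) :
    factor y i (l + 1) = y i :: factor y (i + 1) l := by
  rw [add_comm, factor_add]
  simp [factor_eq_map]

/-- A two-sided sequence is determined by its image under an elementary morphism. -/
theorem IsElementary.eq_of_isConcat (h : IsElementary α) {u u' : ℤ → Fin c} {z : ℤ → B}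
    (hu : IsConcat α u z) (hu' : IsConcat α u' z) : u = u' := by
  obtain ⟨n, hn⟩ := h.exists_delay
  obtain ⟨m, hm⟩ := h.reverse.exists_delay
  -- Bounded delay read to the right propagates a common cut forwards; applied to the reversed
  -- morphism it propagates the cut backwards. The common cut at the origin starts both inductions.
  have hright : ∀ i, cut α u i = cut α u' i → u i = u' i := by
    intro i hi
    refine hn _ _ (factor u (i + 1) n) (factor u' (i + 1) n) (by simp) (by simp) ?_
    rw [← factor_eq_cons, ← factor_eq_cons, ← hu.factor_eq, ← hu'.factor_eq, hi]
    exact comparable_factor _ _ _ _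
  have hleft : ∀ i, cut α u (i + 1) = cut α u' (i + 1) → u i = u' i := by
    intro i hi
    refine hm _ _ (factor u (i - m) m).reverse (factor u' (i - m) m).reverse (by simp)
      (by simp) ?_
    have hr : ∀ w : ℤ → Fin c, w i :: (factor w (i - m) m).reverse
        = (factor w (i - m) (m + 1)).reverse := fun w => by
      rw [factor_succ, List.reverse_append, sub_add_cancel]
      rfl
    rw [hr, hr, flatMap_reverse_comp, flatMap_reverse_comp, ← hu.factor_eq, ← hu'.factor_eq]
    refine comparable_reverse_factor _ ?_
    rw [← cut_add_natCast, ← cut_add_natCast]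
    push_cast
    rw [show i - (m : ℤ) + (m + 1) = i + 1 by ring, hi]
  have hcut : ∀ i, cut α u i = cut α u' i := by
    intro i
    induction i using Int.induction_on with
    | zero => simp
    | succ i ih => rw [cut_add_one, cut_add_one, ih, hright _ ih]
    | pred i ih =>
      have h1 := cut_add_one α u (-(i : ℤ) - 1)
      have h2 := cut_add_one α u' (-(i : ℤ) - 1)
      rw [sub_add_cancel] at h1 h2
      have h3 := hleft (-(i : ℤ) - 1) (by rw [sub_add_cancel]; exact ih)
      rw [h3] at h1
      omega
  exact funext fun i => hright i (hcut i)

/-- If two decompositions have a cutting point in common, then they agree. -/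
theorem IsElementary.exists_eq_shiftZ (h : IsElementary α) {u u' : ℤ → Fin c} {z : ℤ → B} {j : ℤ}
    (hu : IsConcat α u z) (hu' : IsConcat α u' (shiftZ j z)) {p q : ℤ}
    (hpq : cut α u p = j + cut α u' q) : ∃ i, j = cut α u i ∧ u' = shiftZ i u := by
  have h1 := hu.shiftZ p
  have h2 := hu'.shiftZ q
  rw [shiftZ_shiftZ, add_comm, ← hpq] at h2
  have h3 := h.eq_of_isConcat h1 h2
  have h4 : u' = shiftZ (p - q) u := by
    have := congrArg (shiftZ (-q)) h3
    rw [shiftZ_shiftZ, shiftZ_shiftZ, neg_add_cancel, shiftZ_zero] at this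
    rw [← this]
    congr 1; ring
  refine ⟨p - q, ?_, h4⟩
  rw [h4, cut_shiftZ, add_sub_cancel] at hpq
  omega

end Elementary

/-! ### Recognizability from common cuts -/

section Recognizability

variable {A : Type*} {ξ : A → List A}

/-- `σ` is recognizable on `Y`. -/
def IsRecognizable {B C : Type*} (σ : C → List B) (Y : Set (ℤ → C)) : Prop :=
  ∀ y ∈ Y, ∀ y' ∈ Y, ∀ (z : ℤ → B) (j : ℤ), IsConcat σ y z → IsConcat σ y' (shiftZ j z) →
    ∃ i, j = cut σ y i ∧ y' = shiftZ i y

/-- Recognizability passes from one power to all the others. -/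
theorem isRecognizable_iter_of_exists (hξ : ∀ a, ξ a ≠ [])
    (h : ∃ N, 1 ≤ N ∧ IsRecognizable (iter ξ N) (Omega ξ)) (n : ℕ) :
    IsRecognizable (iter ξ n) (Omega ξ) := by
  obtain ⟨N, hN, hrec⟩ := h
  have comp : ∀ m n : ℕ, iter ξ (m + n) = fun a => (iter ξ n a).flatMap (iter ξ m) :=
    fun m n => funext fun a => iter_add m n a
  -- With `N = r + 1`, applying `ξʳ` to `z` turns decompositions into words `ξ(a)` into
  -- decompositions into words `ξᴺ(a)`; strict monotonicity of the cuts brings the conclusion back.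
  have hone : IsRecognizable (iter ξ 1) (Omega ξ) := by
    obtain ⟨r, rfl⟩ := Nat.exists_eq_add_of_le' hN
    intro y hy y' hy' z j hz hz'
    obtain ⟨x, hx⟩ := exists_isConcat (iter_ne_nil hξ r) z
    rw [comp] at hrec
    obtain ⟨i, hi, hyi⟩ := hrec y hy y' hy' x _ (hz.comp hx) (hz'.comp (hx.shiftZ j))
    rw [cut_comp hz] at hi
    exact ⟨i, (cut_strictMono (iter_ne_nil hξ r) z).injective hi, hyi⟩
  induction n with
  | zero =>
    intro y _ y' _ z j hz hz'
    have hcut : ∀ (w : ℤ → A) i, cut (iter ξ 0) w i = i := fun w i => by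
      have := cut_unique (σ := iter ξ 0) (y := w) (c := fun i => i) (fun i => by simp) i
      simpa using this.symm
    have hid : ∀ w w' : ℤ → A, IsConcat (iter ξ 0) w w' → w' = w := fun w w' h => funext fun i => by
      have := h i
      rw [hcut] at this
      simpa [factor_eq_map] using this
    refine ⟨j, (hcut _ _).symm, ?_⟩
    rw [← hid _ _ hz, ← hid _ _ hz']
  | succ n ih =>
    intro y hy y' hy' z j hz hz'
    rw [add_comm, comp] at hz hz' ⊢
    have hu := isConcat_seqMap_iterate hξ n y
    have hu' := isConcat_seqMap_iterate hξ n y'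
    have huΩ := seqMap_iterate_mem_Omega hξ n hy
    have huΩ' := seqMap_iterate_mem_Omega hξ n hy'
    generalize (seqMap ξ)^[n] y = u at *
    generalize (seqMap ξ)^[n] y' = u' at *
    have hne : ∀ a, (iter ξ n a).flatMap (iter ξ 1) ≠ [] := fun a => by
      rw [← iter_add]; exact iter_ne_nil hξ _ a
    obtain ⟨z₁, hz₁⟩ := exists_isConcat (iter_ne_nil hξ 1) u
    obtain ⟨z₁', hz₁'⟩ := exists_isConcat (iter_ne_nil hξ 1) u'
    have e1 := hz.unique hne (hu.comp hz₁)
    have e2 := hz'.unique hne (hu'.comp hz₁')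
    obtain ⟨i, hi, hui⟩ := hone u huΩ u' huΩ' z j (e1 ▸ hz₁) (e2 ▸ hz₁')
    obtain ⟨l, hl, hyl⟩ := ih y hy y' hy' u i hu (hui ▸ hu')
    exact ⟨l, by rw [cut_comp hu, ← hl, hi], hyl⟩

variable [Fintype A]

/-- A power of a substitution factors through an alphabet in such a way that both the second
factor and the product in the reverse order are elementary. -/
theorem exists_elementary (ξ : A → List A) : ∃ (N c : ℕ) (β : A → List (Fin c))
    (α : Fin c → List A), 1 ≤ N ∧ (∀ a, iter ξ N a = (β a).flatMap α) ∧ IsElementary α ∧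
      IsElementary fun x => (α x).flatMap β := by
  classical
  -- Take the smallest alphabet through which some positive power of `ξ` factors. A factorization of
  -- `α` through fewer letters would factor `ξᴺ` as well, and one of the reversed product would
  -- factor `ξ²ᴺ`, as that product sits in its middle.
  let P : ℕ → Prop := fun c => ∃ (N : ℕ) (β : A → List (Fin c)) (α : Fin c → List A),
    1 ≤ N ∧ ∀ a, iter ξ N a = (β a).flatMap α
  have hP : ∃ c, P c := by
    refine ⟨Fintype.card A, 1, fun a => (ξ a).map (Fintype.equivFin A),
      fun x => [(Fintype.equivFin A).symm x], le_rfl, fun a => ?_⟩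
    rw [iter_one, List.flatMap_map]
    simp
  obtain ⟨N, β, α, hN, h⟩ := Nat.find_spec hP
  refine ⟨N, Nat.find hP, β, α, hN, h, ?_, ?_⟩
  · intro c' hc' γ α' hx
    refine Nat.find_min hP hc' ⟨N, fun a => (β a).flatMap γ, α', hN, fun a => ?_⟩
    rw [h, List.flatMap_assoc]
    exact congrArg (fun f => (β a).flatMap f) (funext hx)
  · intro c' hc' γ α' hx
    refine Nat.find_min hP hc' ⟨N + N, fun a => (β a).flatMap γ, fun x => (α' x).flatMap α,
      by omega, fun a => ?_⟩
    have h1 : iter ξ N = fun a => (β a).flatMap α := funext h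
    have h2 : (fun x => (α x).flatMap β) = fun x => (γ x).flatMap α' := funext hx
    rw [iter_add, h1]
    calc ((β a).flatMap α).flatMap (fun a => (β a).flatMap α)
        = ((β a).flatMap fun x => (α x).flatMap β).flatMap α := by
          simp only [List.flatMap_assoc]
      _ = ((β a).flatMap γ).flatMap fun x => (α' x).flatMap α := by
          rw [h2]
          simp only [List.flatMap_assoc]

variable [DecidableEq A] [TopologicalSpace A] [DiscreteTopology A]

/-- If any two decompositions into the words `ξᵐ(b)` have a cutting point in common, then some
power of `ξ` is recognizable. -/
theorem exists_isRecognizable_iter (hprim : (incidence ξ).IsPrimitive) (hξ : ∀ a, ξ a ≠ [])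
    (hcut : ∀ (m : ℕ), ∀ y ∈ Omega ξ, ∀ y' ∈ Omega ξ, ∀ (z : ℤ → A) (j : ℤ),
      IsConcat (iter ξ m) y z → IsConcat (iter ξ m) y' (shiftZ j z) →
        ∃ p q : ℤ, cut (iter ξ m) y p = j + cut (iter ξ m) y' q) :
    ∃ N, 1 ≤ N ∧ IsRecognizable (iter ξ N) (Omega ξ) := by
  obtain ⟨N, c, β, α, hN, hfac, hα, hτ⟩ := exists_elementary ξ
  have hN1 : iter ξ N = fun a => (β a).flatMap α := funext hfac
  have hβ : ∀ a, β a ≠ [] := fun a h0 => iter_ne_nil hξ N a (by rw [hfac, h0]; rfl)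
  have hN2 : iter ξ (N + N) = fun a => ((β a).flatMap fun x => (α x).flatMap β).flatMap α := by
    funext a
    rw [iter_add, hN1]
    simp only [List.flatMap_assoc]
  let Y : Set (ℤ → Fin c) := {b | ∃ y ∈ Omega ξ, IsConcat β y b}
  have recα : IsRecognizable α Y := by
    rintro b ⟨y, hy, hb⟩ b' ⟨y', hy', hb'⟩ z j hz hz'
    obtain ⟨p, q, hpq⟩ := hcut N y hy y' hy' z j (by rw [hN1]; exact hb.comp hz)
      (by rw [hN1]; exact hb'.comp hz')
    rw [hN1, cut_comp hb, cut_comp hb'] at hpq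
    exact hα.exists_eq_shiftZ hz hz' hpq
  have recτ : IsRecognizable (fun x => (α x).flatMap β) Y := by
    rintro b ⟨y, hy, hb⟩ b' ⟨y', hy', hb'⟩ w j hw hw'
    obtain ⟨x, hx⟩ := exists_isConcat hα.ne_nil w
    have hx' := hx.shiftZ j
    obtain ⟨p, q, hpq⟩ := hcut (N + N) y hy y' hy' x (cut α w j)
      (by rw [hN2]; exact (hb.comp hw).comp hx) (by rw [hN2]; exact (hb'.comp hw').comp hx')
    rw [hN2, cut_comp (hb.comp hw), cut_comp (hb'.comp hw'), cut_comp hb, cut_comp hb',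
      cut_shiftZ, add_sub_cancel] at hpq
    have := (cut_strictMono hα.ne_nil w).injective hpq
    exact hτ.exists_eq_shiftZ hw hw' (this.trans (add_comm _ _))
  -- `β` itself need not be elementary. Up to shifts `y` is `α(t)` with `t = β(s)`, so
  -- decompositions by `β` are moved to decompositions by the elementary product of `α` and `β`,
  -- whose recognizability is `recτ`.
  have recβ : IsRecognizable β (Omega ξ) := by
    intro y hy y' hy' b j hb hb'
    obtain ⟨s, hs, k, -, rfl⟩ := exists_eq_shiftZ_seqMap hprim hξ N hy
    obtain ⟨s', hs', k', -, rfl⟩ := exists_eq_shiftZ_seqMap hprim hξ N hy'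
    have hx := isConcat_seqMap_iterate hξ N s
    have hx' := isConcat_seqMap_iterate hξ N s'
    generalize (seqMap ξ)^[N] s = x at *
    generalize (seqMap ξ)^[N] s' = x' at *
    rw [hN1] at hx hx'
    obtain ⟨t, ht⟩ := exists_isConcat hβ s
    obtain ⟨t', ht'⟩ := exists_isConcat hβ s'
    obtain ⟨x₁, hx₁⟩ := exists_isConcat hα.ne_nil t
    obtain ⟨x₁', hx₁'⟩ := exists_isConcat hα.ne_nil t'
    have hne : ∀ a, (β a).flatMap α ≠ [] := fun a => by rw [← hfac]; exact iter_ne_nil hξ N a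
    obtain rfl := hx.unique hne (ht.comp hx₁)
    obtain rfl := hx'.unique hne (ht'.comp hx₁')
    obtain ⟨w, hw⟩ := exists_isConcat hβ x
    obtain ⟨w', hw'⟩ := exists_isConcat hβ x'
    have e1 := hb.unique hβ (hw.shiftZ k)
    have e2 := hb'.unique hβ (hw'.shiftZ k')
    have e3 : w' = shiftZ (j + cut β x k - cut β x' k') w := by
      have := congrArg (shiftZ (-cut β x' k')) e2
      rw [e1, shiftZ_shiftZ, shiftZ_shiftZ, shiftZ_shiftZ, neg_add_cancel, shiftZ_zero] at this
      rw [← this]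
      congr 1; ring
    obtain ⟨i, hi, hti⟩ := recτ t ⟨s, hs, ht⟩ t' ⟨s', hs', ht'⟩ w _ (hx₁.comp hw)
      (by rw [← e3]; exact hx₁'.comp hw')
    have e4 : x' = shiftZ (cut α t i) x :=
      hx₁'.unique hα.ne_nil (by rw [hti]; exact hx₁.shiftZ i)
    refine ⟨k' + cut α t i - k, ?_, ?_⟩
    · rw [cut_comp hx₁] at hi
      rw [e4, cut_shiftZ] at hi
      rw [cut_shiftZ, sub_add_cancel]
      omega
    · rw [e4, shiftZ_shiftZ, shiftZ_shiftZ]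
      congr 1; ring
  refine ⟨N, hN, fun y hy y' hy' z j hz hz' => ?_⟩
  rw [hN1] at hz hz' ⊢
  obtain ⟨b, hb⟩ := exists_isConcat hβ y
  obtain ⟨b', hb'⟩ := exists_isConcat hβ y'
  have hne : ∀ a, (β a).flatMap α ≠ [] := fun a => by rw [← hfac]; exact iter_ne_nil hξ N a
  obtain ⟨z₁, hz₁⟩ := exists_isConcat hα.ne_nil b
  obtain ⟨z₁', hz₁'⟩ := exists_isConcat hα.ne_nil b'
  have e1 := hz.unique hne (hb.comp hz₁)
  have e2 := hz'.unique hne (hb'.comp hz₁')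
  obtain ⟨i, hi, hbi⟩ := recα b ⟨y, hy, hb⟩ b' ⟨y', hy', hb'⟩ z j (e1 ▸ hz₁) (e2 ▸ hz₁')
  obtain ⟨l, hl, hyl⟩ := recβ y hy y' hy' b i hb (hbi ▸ hb')
  exact ⟨l, by rw [cut_comp hb, ← hl, hi], hyl⟩

end Recognizability

/-! ### Recognizability of all powers of `ξ` -/

section Recognizable

variable {A : Type*} {ξ : A → List A} {F : (A → ℝ) → (ℤ → A) → ℝ} {n : ℕ} {v : Fin n → A → ℝ}
  {H : Matrix (Fin n) (Fin n) ℝ} [Fintype A] [DecidableEq A] [TopologicalSpace A] {C β : ℝ}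
  [DiscreteTopology A] [MeasurableSpace A]

theorem IsTiling.isRecognizable (h : IsTiling ξ F C v H β) (hproper : IsProper ξ)
    {μ : Measure (Omega ξ)} [IsProbabilityMeasure μ]
    (hac : ∀ N : Set (Fin n → ℝ), volume N = 0 → μ {x | vecF F v x ∈ N} = 0) (m : ℕ) :
    IsRecognizable (iter ξ m) (Omega ξ) := by
  refine isRecognizable_iter_of_exists h.ne_nil (exists_isRecognizable_iter h.prim h.ne_nil
    fun k y hy y' hy' z j hz hz' => ?_) m
  refine h.exists_common_cut hproper hac k hy hy' (j := j) ?_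
  rw [← hz.unique (iter_ne_nil h.ne_nil k) (isConcat_seqMap_iterate h.ne_nil k y)]
  exact hz'.unique (iter_ne_nil h.ne_nil k) (isConcat_seqMap_iterate h.ne_nil k y')

end Recognizable

/-! ### Telescoping of the series -/

section Series

variable {A : Type*} {ξ : A → List A}

theorem ncard_eq_count [DecidableEq A] (y : ℤ → A) (I : ℕ) (a : A) :
    Set.ncard {s : ℕ | s < I ∧ y s = a} = (factor y 0 I).count a := by
  have : {s : ℕ | s < I ∧ y s = a} = ↑((Finset.range I).filter fun s : ℕ => y s = a) := by
    ext s; simp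
  rw [this, Set.ncard_coe_finset]
  induction I with
  | zero => simp [factor_eq_map]
  | succ I ih =>
    have ih' := ih (by ext s; simp)
    rw [factor_succ, List.count_append, Finset.range_add_one, Finset.filter_insert, ← ih']
    by_cases h : y I = a
    · rw [if_pos h, Finset.card_insert_of_notMem (by simp)]
      simp [h]
    · rw [if_neg h]
      simp [h]

theorem entranceTime_le {k j : ℕ} {x : ℤ → A}
    (h : shiftZ j x ∈ (seqMap ξ)^[k - 1] '' Omega ξ) : entranceTime ξ k x ≤ j :=
  Nat.sInf_le (by simpa only [Set.mem_ofPred_eq, shift_iterate] using h)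

theorem entranceTime_one {x : ℤ → A} (hx : x ∈ Omega ξ) : entranceTime ξ 1 x = 0 :=
  Nat.le_zero.1 (entranceTime_le (by simpa using hx))

variable [Fintype A] [DecidableEq A] [TopologicalSpace A] [DiscreteTopology A]

theorem exists_shiftZ_entranceTime (hprim : (incidence ξ).IsPrimitive) (hξ : ∀ a, ξ a ≠ [])
    (k : ℕ) {x : ℤ → A} (hx : x ∈ Omega ξ) :
    ∃ y ∈ Omega ξ, (seqMap ξ)^[k - 1] y = shiftZ (entranceTime ξ k x) x := by
  have hne : {j : ℕ | shift^[j] x ∈ (seqMap ξ)^[k - 1] '' Omega ξ}.Nonempty := by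
    obtain ⟨y, hy, q, hq, rfl⟩ := exists_eq_shiftZ_seqMap hprim hξ (k - 1) hx
    refine ⟨(iter ξ (k - 1) (y 0)).length - q, shiftZ 1 y, shiftZ_mem_Omega hy 1, ?_⟩
    rw [seqMap_iterate_shiftZ hξ, shift_iterate, shiftZ_shiftZ]
    congr 1
    have := cut_add_one (iter ξ (k - 1)) y 0
    rw [cut_zero] at this
    rw [← zero_add (1 : ℤ), this]
    omega
  have := Nat.sInf_mem hne
  rw [Set.mem_ofPred_eq, shift_iterate] at this
  exact this

theorem entranceTime_le_succ (hprim : (incidence ξ).IsPrimitive) (hξ : ∀ a, ξ a ≠ [])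
    (k : ℕ) {x : ℤ → A} (hx : x ∈ Omega ξ) :
    entranceTime ξ (k + 1) x ≤ entranceTime ξ (k + 2) x := by
  obtain ⟨y, hy, h⟩ := exists_shiftZ_entranceTime hprim hξ (k + 2) hx
  refine entranceTime_le (h ▸ ⟨seqMap ξ y, seqMap_iterate_mem_Omega hξ 1 hy, ?_⟩)
  rw [← Function.iterate_succ_apply]
  rfl

/-- The points counted by `visitCount` are the cutting points of one decomposition. -/
theorem exists_visitCount_eq (hprim : (incidence ξ).IsPrimitive) (hξ : ∀ a, ξ a ≠ [])
    {k : ℕ} (hrec : IsRecognizable (iter ξ k) (Omega ξ)) {x : ℤ → A} (hx : x ∈ Omega ξ) :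
    ∃ y ∈ Omega ξ, ∃ y' ∈ Omega ξ, ∃ I : ℕ,
      (seqMap ξ)^[k] y = shiftZ (entranceTime ξ (k + 1) x) x ∧
      (seqMap ξ)^[k + 1] y' = shiftZ (entranceTime ξ (k + 2) x) x ∧
      seqMap ξ y' = shiftZ I y ∧
      ∀ a, visitCount ξ (k + 1) x a = (factor y 0 I).count a := by
  obtain ⟨y, hy, h1⟩ := exists_shiftZ_entranceTime hprim hξ (k + 1) hx
  obtain ⟨y', hy', h2⟩ := exists_shiftZ_entranceTime hprim hξ (k + 2) hx
  have hle := entranceTime_le_succ hprim hξ k hx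
  simp only [Nat.add_sub_cancel, show k + 2 - 1 = k + 1 from rfl] at h1 h2
  have hy₁ : seqMap ξ y' ∈ Omega ξ := seqMap_iterate_mem_Omega hξ 1 hy'
  have hz := isConcat_seqMap_iterate hξ k y
  have mono := cut_strictMono (iter_ne_nil hξ k) y
  -- Recognizability: every return of the orbit of `x` to the image of `ξᵏ` is a cut of the
  -- decomposition given by `y`. Visits to the images of the cylinders therefore count letters of
  -- `y` between two cuts.
  have hrel : ∀ (i : ℤ) (w : ℤ → A), w ∈ Omega ξ → (seqMap ξ)^[k] w = shiftZ i x →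
      ∃ s, i - entranceTime ξ (k + 1) x = cut (iter ξ k) y s ∧ w = shiftZ s y := by
    intro i w hw hwi
    refine hrec y hy w hw _ _ hz ?_
    have := isConcat_seqMap_iterate hξ k w
    rw [hwi] at this
    rwa [h1, shiftZ_shiftZ, sub_add_cancel]
  obtain ⟨I, hI, hyI⟩ := hrel (entranceTime ξ (k + 2) x) (seqMap ξ y') hy₁
    (by rw [← Function.iterate_succ_apply, h2])
  have hI0 : 0 ≤ I := by
    rw [← mono.le_iff_le, cut_zero, ← hI]
    omega
  lift I to ℕ using hI0
  refine ⟨y, hy, y', hy', I, h1, h2, hyI, fun a => ?_⟩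
  rw [← ncard_eq_count, visitCount]
  refine Eq.symm (Set.ncard_congr
    (fun s _ => (entranceTime ξ (k + 1) x + cut (iter ξ k) y s).toNat) ?_ ?_ ?_)
  · rintro s ⟨hs, rfl⟩
    have hs0 : 0 ≤ cut (iter ξ k) y s := by
      rw [← cut_zero (iter ξ k) y, mono.le_iff_le]; omega
    have hs1 : cut (iter ξ k) y s < cut (iter ξ k) y I := mono.lt_iff_lt.2 (by exact_mod_cast hs)
    refine ⟨by omega, by change _ < entranceTime ξ (k + 2) x; omega,
      shiftZ s y, ⟨shiftZ_mem_Omega hy s, by simp⟩, ?_⟩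
    rw [Nat.add_sub_cancel, seqMap_iterate_shiftZ hξ, h1, shift_iterate, shiftZ_shiftZ]
    congr 1
    omega
  · rintro s t ⟨hs, -⟩ ⟨ht, -⟩ hst
    have hs0 : 0 ≤ cut (iter ξ k) y s := by
      rw [← cut_zero (iter ξ k) y, mono.le_iff_le]; omega
    have ht0 : 0 ≤ cut (iter ξ k) y t := by
      rw [← cut_zero (iter ξ k) y, mono.le_iff_le]; omega
    have : cut (iter ξ k) y s = cut (iter ξ k) y t := by omega
    exact_mod_cast mono.injective this
  · rintro i ⟨hi1, hi2, w, ⟨hw, hw0⟩, hwi⟩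
    rw [Nat.add_sub_cancel, shift_iterate] at hwi
    obtain ⟨s, hs, hws⟩ := hrel i w hw hwi
    change i < entranceTime ξ (k + 2) x at hi2
    have hs0 : 0 ≤ s := by
      rw [← mono.le_iff_le, cut_zero, ← hs]; omega
    have hs1 : s < I := by
      rw [← mono.lt_iff_lt, ← hs, ← hI]; omega
    lift s to ℕ using hs0
    refine ⟨s, ⟨by exact_mod_cast hs1, ?_⟩, ?_⟩
    · rw [← hw0, hws]; simp
    · omega

variable {F : (A → ℝ) → (ℤ → A) → ℝ} {C : ℝ}

/-- The two entrance points are `ξᵏ(y)` and `ξᵏ(S^I y)`. Moving `ξᵏ` onto the vector leaves the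
variation of `F (M^(k+1) v)` from `y` to `S^I y`, a sum over the letters counted by `visitCount`.
The term of index `k + 1` involves only `ξᵏ`, which is why `M v` appears instead of `v`. -/
theorem IsTransfer.mapTerm_eq (hF : IsTransfer ξ F C) (hprim : (incidence ξ).IsPrimitive)
    (hξ : ∀ a, ξ a ≠ []) (hrec : ∀ k, IsRecognizable (iter ξ k) (Omega ξ)) {v : A → ℝ}
    (hv : v ∈ stableSpace ξ) (k : ℕ) {x : ℤ → A} (hx : x ∈ Omega ξ) :
    mapTerm ξ v (k + 1) x
      = F (transposeMap ξ v) (SubstShift.shiftZ (entranceTime ξ (k + 1) x) x)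
        - F (transposeMap ξ v) (SubstShift.shiftZ (entranceTime ξ (k + 2) x) x) := by
  obtain ⟨y, hy, y', hy', I, h1, h2, h3, h4⟩ := exists_visitCount_eq hprim hξ (hrec k) hx
  have hTv := transposeMap_mem_stableSpace ξ v hv
  have hTk := transposeMap_pow_mem_stableSpace hv (k + 1)
  have hpow : (transposeMap ξ ^ k) (transposeMap ξ v) = (transposeMap ξ ^ (k + 1)) v := by
    rw [pow_succ, Module.End.mul_apply]
  rw [← h1, ← h2, Function.iterate_succ_apply, hF.seqMap_iterate hξ hTv hy, h3,
    hF.seqMap_iterate hξ hTv (shiftZ_mem_Omega hy I), hpow, hF.shift_natCast hTk hy,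
    sub_sub_cancel, wordSum_eq_sum_count, mapTerm]
  simp only [h4]

theorem IsTransfer.sum_mapTerm_eq (hF : IsTransfer ξ F C) (hprim : (incidence ξ).IsPrimitive)
    (hξ : ∀ a, ξ a ≠ []) (hrec : ∀ k, IsRecognizable (iter ξ k) (Omega ξ)) {v : A → ℝ}
    (hv : v ∈ stableSpace ξ) (N : ℕ) {x : ℤ → A} (hx : x ∈ Omega ξ) :
    ∑ k ∈ Finset.range N, mapTerm ξ v (k + 1) x = F (transposeMap ξ v) x
      - F (transposeMap ξ v) (SubstShift.shiftZ (entranceTime ξ (N + 1) x) x) := by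
  induction N with
  | zero => simp [entranceTime_one hx]
  | succ N ih =>
    rw [Finset.sum_range_succ, ih, hF.mapTerm_eq hprim hξ hrec hv N hx]
    ring

theorem IsTransfer.abs_shiftZ_entranceTime_le (hF : IsTransfer ξ F C)
    (hprim : (incidence ξ).IsPrimitive) (hξ : ∀ a, ξ a ≠ []) {v : A → ℝ}
    (hv : v ∈ stableSpace ξ) (N : ℕ) {x : ℤ → A} (hx : x ∈ Omega ξ) :
    |F (transposeMap ξ v) (SubstShift.shiftZ (entranceTime ξ (N + 1) x) x)|
      ≤ C * ‖(transposeMap ξ ^ (N + 1)) v‖ := by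
  obtain ⟨y, hy, h1⟩ := exists_shiftZ_entranceTime hprim hξ (N + 1) hx
  rw [Nat.add_sub_cancel] at h1
  rw [← h1, hF.seqMap_iterate hξ (transposeMap_mem_stableSpace ξ v hv) hy, pow_succ,
    Module.End.mul_apply]
  refine hF.abs_le _ ?_ y hy
  exact transposeMap_pow_mem_stableSpace (transposeMap_mem_stableSpace ξ v hv) N

theorem IsTransfer.hasSum_mapTerm (hF : IsTransfer ξ F C) (hprim : (incidence ξ).IsPrimitive)
    (hξ : ∀ a, ξ a ≠ []) (hrec : ∀ k, IsRecognizable (iter ξ k) (Omega ξ)) {v : A → ℝ}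
    (hv : v ∈ stableSpace ξ) {x : ℤ → A} (hx : x ∈ Omega ξ) :
    HasSum (fun k : ℕ => mapTerm ξ v (k + 1) x) (F (transposeMap ξ v) x) := by
  obtain ⟨K, ρ, hK, hρ, hρ1, hdec⟩ := exists_norm_transposeMap_pow_le ξ
  have hb : ∀ N, |F (transposeMap ξ v) (SubstShift.shiftZ (entranceTime ξ (N + 1) x) x)|
      ≤ C * (K * ‖v‖) * ρ * ρ ^ N := fun N => by
    refine (hF.abs_shiftZ_entranceTime_le hprim hξ hv N hx).trans ?_
    have := mul_le_mul_of_nonneg_left (hdec v hv (N + 1)) hF.nonneg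
    refine this.trans (le_of_eq ?_)
    rw [pow_succ]; ring
  have hsum : Summable fun N => F (transposeMap ξ v)
      (SubstShift.shiftZ (entranceTime ξ (N + 1) x) x) :=
    Summable.of_norm_bounded ((summable_geometric_of_lt_one hρ.le hρ1).mul_left _) hb
  have hS : Summable fun k : ℕ => mapTerm ξ v (k + 1) x := by
    simp only [hF.mapTerm_eq hprim hξ hrec hv _ hx]
    exact hsum.sub ((summable_nat_add_iff 1).2 hsum)
  rw [hS.hasSum_iff_tendsto_nat]
  simp only [hF.sum_mapTerm_eq hprim hξ hrec hv _ hx]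
  simpa using tendsto_const_nhds.sub hsum.tendsto_atTop_zero

theorem IsTransfer.mapF_eq (hF : IsTransfer ξ F C) (hprim : (incidence ξ).IsPrimitive)
    (hξ : ∀ a, ξ a ≠ []) (hrec : ∀ k, IsRecognizable (iter ξ k) (Omega ξ)) {n : ℕ}
    {v : Fin n → A → ℝ} (hv : ∀ i, v i ∈ stableSpace ξ) (x : Omega ξ) :
    mapF ξ v x = fun i => F (transposeMap ξ (v i)) x :=
  funext fun i => (hF.hasSum_mapTerm hprim hξ hrec (hv i) x.2).tsum_eq

theorem IsTransfer.tendstoUniformly_mapPartial (hF : IsTransfer ξ F C)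
    (hprim : (incidence ξ).IsPrimitive) (hξ : ∀ a, ξ a ≠ [])
    (hrec : ∀ k, IsRecognizable (iter ξ k) (Omega ξ)) {n : ℕ} {v : Fin n → A → ℝ}
    (hv : ∀ i, v i ∈ stableSpace ξ) :
    TendstoUniformly (mapPartial ξ v) (mapF ξ v) atTop := by
  rw [Metric.tendstoUniformly_iff]
  intro ε hε
  have hlim : ∀ i, Tendsto (fun N => C * ‖(transposeMap ξ ^ N) (v i)‖) atTop (𝓝 0) := fun i => by
    have h1 : Tendsto (fun k : ℕ => (transposeMap ξ ^ k) (v i)) atTop (𝓝 0) := (hv i).1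
    simpa using h1.norm.const_mul C
  have hev : ∀ᶠ N in atTop, ∀ i, C * ‖(transposeMap ξ ^ N) (v i)‖ < ε :=
    Filter.eventually_all.2 fun i => (hlim i).eventually_lt_const hε
  filter_upwards [hev, eventually_ge_atTop 1] with N hN hN1 x
  obtain ⟨M, rfl⟩ := Nat.exists_eq_add_of_le' hN1
  rw [dist_pi_lt_iff hε]
  intro i
  have h1 : mapPartial ξ v (M + 1) x i = ∑ k ∈ Finset.range M, mapTerm ξ (v i) (k + 1) x := by
    rw [mapPartial, Finset.sum_Ico_eq_sum_range, Nat.add_sub_cancel]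
    simp only [add_comm 1]
  rw [hF.mapF_eq hprim hξ hrec hv, h1, hF.sum_mapTerm_eq hprim hξ hrec (hv i) M x.2,
    Real.dist_eq, sub_sub_cancel]
  exact (hF.abs_shiftZ_entranceTime_le hprim hξ (hv i) M x.2).trans_lt (hN i)

end Series

end SubstShift

open SubstShift

theorem mainTheorem4 {A : Type*} [Fintype A] [DecidableEq A]
    [TopologicalSpace A] [DiscreteTopology A] [MeasurableSpace A] [MeasurableSingletonClass A]
    (ξ : A → List A) (hsub : SubstShift.IsSubstitution ξ)
    (hprim : (SubstShift.incidence ξ).IsPrimitive) (hproper : SubstShift.IsProper ξ)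
    (μ : Measure (SubstShift.Omega ξ)) [IsProbabilityMeasure μ]
    (hμ : MeasurePreserving (SubstShift.shiftOmega ξ) μ μ)
    (hi : ∃! z : ℂ, SubstShift.IsCharRoot ξ z ∧ 1 < ‖z‖)
    (d : ℕ) (hd : 1 ≤ d) (hdim : Module.finrank ℝ (SubstShift.stableSpace ξ) = d - 1)
    (α : Fin (d - 1) → ℝ)
    (hii : ∀ i, SubstShift.IsSystemEigenvalue μ (SubstShift.shiftOmega ξ)
      (Complex.exp (2 * Real.pi * Complex.I * α i)))
    (hindep : LinearIndependent ℚ (fun o : Option (Fin (d - 1)) => o.elim (1 : ℝ) α))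
    (β : ℝ) (hβ : SubstShift.IsPerronNumber ξ β)
    (hiii : β * |SubstShift.stableDet ξ| = 1) :
    (∃ v : Fin (d - 1) → A → ℝ, SubstShift.IsSplitting ξ α v) ∧
    ∀ v : Fin (d - 1) → A → ℝ, SubstShift.IsSplitting ξ α v →
      TendstoUniformly (SubstShift.mapPartial ξ v) (SubstShift.mapF ξ v) atTop ∧
      Continuous (SubstShift.mapF ξ v) ∧
      ∃ N : Set (SubstShift.Omega ξ), μ N = 0 ∧ Set.InjOn (SubstShift.mapF ξ v) Nᶜ := by
  have hξ : ∀ a, ξ a ≠ [] := hproper.ne_nil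
  have hne : (Omega ξ).Nonempty := by
    by_contra hempty
    have : IsEmpty (Omega ξ) := Set.isEmpty_coe_sort.2 (Set.not_nonempty_iff_eq_empty.1 hempty)
    exact IsProbabilityMeasure.ne_zero μ (Measure.eq_zero_of_isEmpty μ)
  have : Nonempty A := ⟨hne.some 0⟩
  refine ⟨?_, fun v hv => ?_⟩
  · choose v hv using fun i => exists_splitting_of_tendsto (ξ := ξ) (α := α i)
      (fun b => (hii i).tendsto_pow_length hprim hsub hproper hμ (norm_exp_two_pi_I_mul _) b)
    exact ⟨v, hv⟩
  have hvs : ∀ i, v i ∈ stableSpace ξ := fun i => (hv i).1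
  obtain ⟨F, C, hF⟩ := exists_isTransfer hprim hξ hne
  obtain ⟨H, hdet, hH⟩ := exists_matrix_stableSpace hdim hvs (hv.linearIndependent hξ hindep)
  have hβ0 : 0 < β := by
    by_contra! h0
    have := mul_nonpos_of_nonpos_of_nonneg h0 (abs_nonneg (stableDet ξ))
    linarith
  have hT : IsTiling ξ F C v H β := ⟨hF, hvs, hH, hprim, hξ, hβ, hβ0, by rw [hdet, hiii]⟩
  have hac : ∀ N : Set (Fin (d - 1) → ℝ), volume N = 0 → μ {x | vecF F v x ∈ N} = 0 :=
    fun N hN => hF.measure_vecF_preimage_eq_zero hξ hμ hv hindep hH hN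
  have hrec := hT.isRecognizable hproper hac
  -- The extra factor `M_ξᵗ` left by the telescoping is the matrix `H`, invertible because `β |det
  -- H| = 1`; continuity and injectivity are therefore those of `vecF`.
  have hmap : mapF ξ v = fun x : Omega ξ => H.mulVec (vecF F v x) := funext fun x => by
    have h1 := hF.vecF_seqMap hξ hvs hH x.2 1
    rw [pow_one] at h1
    rw [hF.mapF_eq hprim hξ hrec hvs, ← h1]
    exact funext fun i => (hF.seqMap _ (hvs i) _ x.2).symm
  refine ⟨hF.tendstoUniformly_mapPartial hprim hξ hrec hvs, ?_, ?_⟩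
  · rw [hmap]
    exact H.mulVecLin.continuous_of_finiteDimensional.comp
      (continuousOn_iff_continuous_domRestrict.1 (hF.continuousOn_vecF hvs))
  · obtain ⟨N, hN, hinj⟩ := hT.exists_injOn hproper hμ hac
    refine ⟨N, hN, ?_⟩
    rw [hmap]
    have hunit : IsUnit H :=
      (Matrix.isUnit_iff_isUnit_det H).2 (isUnit_iff_ne_zero.2 hT.det_ne_zero)
    exact fun x hx y hy hxy => hinj hx hy (Matrix.mulVec_injective_of_isUnit hunit hxy)
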